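/- Let $n\ge 1$, let $(\Omega,\mathcal A,\mu)$ be a probability space with an ergodic $n$-dimensional measure-preserving dynamical system $(T_x)_{x\in\mathbb R^n}$ (so that $T_0=\mathrm{id}$, $T_{x+y}=T_xT_y$, each $T_x$ maps measurable sets to measurable sets of the same measure, $(x,\omega)\mapsto g(T_x\omega)$ is measurable for every measurable $g:\Omega\to\mathbb R^m$, and every measurable $g:\Omega\to\mathbb R$ with $g\circ T_x=g$ a.e. for each $x$ is a.e. constant). Let $p\in(1,\infty)$ and $q=p/(p-1)$. For $r\in\{p,q\}$ let $\mathcal V^r_{\rm sol}(\Omega;\mathbb R^n)$ (respectively $\mathcal V^r_{\rm pot}(\Omega;\mathbb R^n)$) be the space of all $g\in L^r(\Omega;\mathbb R^n)$ with $\int_\Omega g\,d\mu=0$ such that for $\mu$-a.e. $\omega$ the realization $x\mapsto g(T_x\omega)$ is divergence-free (respectively curl-free, i.e. $\partial_j g^i=\partial_i g^j$ for all $i,j$) on $\mathbb R^n$ in the sense of distributions. Let $\mathcal F(\mathbb R^n)$ be the class of representative functions, i.e. of all proper, convex, lower semicontinuous functions $h:\mathbb R^n\times\mathbb R^n\to\mathbb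 R\cup\{+\infty\}$ with $h(\xi,\eta)\ge\xi\cdot\eta$ for all $(\xi,\eta)$. Let $\alpha:\mathbb R^n\times\Omega\to\mathcal P(\mathbb R^n)$ be a random maximal monotone operator: $\{(x,\omega):\alpha(x,\omega)\cap R\ne\emptyset\}$ is $\mathcal B(\mathbb R^n)\otimes\mathcal A$-measurable for every open $R\subseteq\mathbb R^n$, $\alpha(x,\omega)$ is closed for every $x$ and a.e. $\omega$, and $\alpha(\cdot,\omega)$ is maximal monotone for a.e. $\omega$. Let $f:\mathbb R^n\times\mathbb R^n\times\Omega\to\mathbb R\cup\{+\infty\}$ be a measurable representation of $\alpha$: $f$ is $\mathcal B(\mathbb R^n\times\mathbb R^n)\otimes\mathcal A$-measurable and, for a.e. $\omega$, $f(\cdot,\cdot,\omega)$ is convex and lower semicontinuous, and for all $x,y\in\mathbb R^n$ one has $f(x,y,\omega)\ge x\cdot y$, with equality if and only if $y\in\alpha(x,\omega)$. Assume that $f$ is coercive: there are $c>0$ and $k\in L^1(\Omega)$ such that $$f(\xi,\eta,\omega)\ge c\,(|\xi|^p+|\eta|^q)+k(\omega)\qquad\text{for all }\xi,\eta\in\mathbb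 R^n,\ \omega\in\Omega .$$ Define the homogenized representation $$f_0(\xi,\eta):=\inf\Big\{\int_\Omega f(\xi+u(\omega),\eta+v(\omega),\omega)\,d\mu:\ u\in\mathcal V^p_{\rm sol}(\Omega;\mathbb R^n),\ v\in\mathcal V^q_{\rm pot}(\Omega;\mathbb R^n)\Big\}.$$ Then for every $(\xi,\eta)\in\mathbb R^n\times\mathbb R^n$ there is a pair $(\widetilde u,\widetilde v)\in\mathcal V^p_{\rm sol}(\Omega;\mathbb R^n)\times\mathcal V^q_{\rm pot}(\Omega;\mathbb R^n)$ at which this infimum is attained. Moreover $f_0\in\mathcal F(\mathbb R^n)$: it takes values in $\mathbb R\cup\{+\infty\}$ and is proper, convex and lower semicontinuous, and in particular $f_0(\xi,\eta)\ge\xi\cdot\eta$ for all $(\xi,\eta)\in\mathbb R^n\times\mathbb R^n$. -/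

import Mathlib

open MeasureTheory
open scoped ENNReal

noncomputable section

/-- The Euclidean space `ℝⁿ`. -/
abbrev Vec (n : ℕ) : Type := EuclideanSpace ℝ (Fin n)

/-! ### Dynamical systems -/

/-- `T` is an `n`-dimensional measure preserving dynamical system on `(Ω, μ)`. -/
structure IsDynamicalSystem {n : ℕ} {Ω : Type*} [MeasurableSpace Ω] (μ : Measure Ω)
    (T : Vec n → Ω → Ω) : Prop where
  zero : T 0 = id
  add : ∀ x y : Vec n, T (x + y) = T x ∘ T y
  measurableSet_image : ∀ (x : Vec n) (S : Set Ω), MeasurableSet S → MeasurableSet (T x '' S)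
  measure_image : ∀ (x : Vec n) (S : Set Ω), MeasurableSet S → μ (T x '' S) = μ S
  measurable_comp : ∀ (m : ℕ) (g : Ω → Vec m), Measurable g →
    Measurable (fun z : Vec n × Ω => g (T z.1 z.2))

/-- Ergodicity: the only invariant measurable functions are the (a.e.) constants. -/
def IsErgodicSystem {n : ℕ} {Ω : Type*} [MeasurableSpace Ω] (μ : Measure Ω)
    (T : Vec n → Ω → Ω) : Prop :=
  ∀ g : Ω → ℝ, Measurable g → (∀ x : Vec n, ∀ᵐ ω ∂μ, g (T x ω) = g ω) →
    ∃ a : ℝ, ∀ᵐ ω ∂μ, g ω = a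

/-! ### Potential and solenoidal fields -/

/-- The partial derivative `∂φ/∂xⱼ`. -/
def partialDeriv {n : ℕ} (j : Fin n) (φ : Vec n → ℝ) (x : Vec n) : ℝ :=
  fderiv ℝ φ x (EuclideanSpace.single j 1)

/-- `φ ∈ 𝒟(ℝⁿ)`. -/
def IsTestFunction {n : ℕ} (φ : Vec n → ℝ) : Prop :=
  ContDiff ℝ ((⊤ : ℕ∞) : WithTop ℕ∞) φ ∧ HasCompactSupport φ

/-- A locally integrable field on `ℝⁿ` that is vortex-free in the sense of distributions. -/
def IsPotentialField {n : ℕ} (v : Vec n → Vec n) : Prop :=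
  LocallyIntegrable v volume ∧
    ∀ (i j : Fin n) (φ : Vec n → ℝ), IsTestFunction φ →
      ∫ x, (v x i * partialDeriv j φ x - v x j * partialDeriv i φ x) = 0

/-- A locally integrable field on `ℝⁿ` that is divergence-free in the sense of distributions. -/
def IsSolenoidalField {n : ℕ} (v : Vec n → Vec n) : Prop :=
  LocallyIntegrable v volume ∧
    ∀ φ : Vec n → ℝ, IsTestFunction φ → ∑ i : Fin n, ∫ x, v x i * partialDeriv i φ x = 0

/-- The space of mean-zero potential fields in `L^p(Ω; ℝⁿ)` (as functions, not classes):
almost all realizations `x ↦ g (T x ω)` are potential. -/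
def VPot {n : ℕ} {Ω : Type*} [MeasurableSpace Ω] (μ : Measure Ω) (T : Vec n → Ω → Ω) (p : ℝ) :
    Set (Ω → Vec n) :=
  {g | MemLp g (ENNReal.ofReal p) μ ∧ (∀ᵐ ω ∂μ, IsPotentialField (fun x => g (T x ω))) ∧
    ∫ ω, g ω ∂μ = 0}

/-- The space of mean-zero solenoidal fields in `L^p(Ω; ℝⁿ)` (as functions, not classes):
almost all realizations `x ↦ g (T x ω)` are solenoidal. -/
def VSol {n : ℕ} {Ω : Type*} [MeasurableSpace Ω] (μ : Measure Ω) (T : Vec n → Ω → Ω) (p : ℝ) :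
    Set (Ω → Vec n) :=
  {g | MemLp g (ENNReal.ofReal p) μ ∧ (∀ᵐ ω ∂μ, IsSolenoidalField (fun x => g (T x ω))) ∧
    ∫ ω, g ω ∂μ = 0}

/-! ### Monotone operators -/

/-- Monotonicity of a set-valued operator on `ℝⁿ`. -/
def IsMonotoneOp {n : ℕ} (α : Vec n → Set (Vec n)) : Prop :=
  ∀ x y, y ∈ α x → ∀ x₀ y₀, y₀ ∈ α x₀ → 0 ≤ inner ℝ (y - y₀) (x - x₀)

/-- Maximal monotonicity of a set-valued operator on `ℝⁿ`. -/
def IsMaximalMonotoneOp {n : ℕ} (α : Vec n → Set (Vec n)) : Prop :=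
  IsMonotoneOp α ∧
    ∀ x y, (∀ x₀ y₀, y₀ ∈ α x₀ → 0 ≤ inner ℝ (y - y₀) (x - x₀)) → y ∈ α x

/-- Random maximal monotone operators on `ℝⁿ`. -/
structure IsRandomMaximalMonotone {n : ℕ} {Ω : Type*} [MeasurableSpace Ω] (μ : Measure Ω)
    (α : Vec n → Ω → Set (Vec n)) : Prop where
  measurable : ∀ R : Set (Vec n), IsOpen R →
    MeasurableSet {z : Vec n × Ω | (α z.1 z.2 ∩ R).Nonempty}
  closed : ∀ x, ∀ᵐ ω ∂μ, IsClosed (α x ω)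
  maximal : ∀ᵐ ω ∂μ, IsMaximalMonotoneOp (fun x => α x ω)

/-! ### Representative functions

Functions with values in `ℝ ∪ {+∞}` are modelled as `EReal`-valued functions that avoid `⊥`. -/

/-- Convexity of a function `ℝⁿ × ℝⁿ → ℝ ∪ {+∞}`. -/
def IsConvexFun {n : ℕ} (f : Vec n → Vec n → EReal) : Prop :=
  ∀ (x₁ y₁ x₂ y₂ : Vec n) (a b : ℝ), 0 < a → 0 < b → a + b = 1 →
    f (a • x₁ + b • x₂) (a • y₁ + b • y₂) ≤ (a : EReal) * f x₁ y₁ + (b : EReal) * f x₂ y₂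

/-- Joint lower semicontinuity. -/
def IsLscFun {n : ℕ} (f : Vec n → Vec n → EReal) : Prop :=
  LowerSemicontinuous (fun z : Vec n × Vec n => f z.1 z.2)

/-- The class `𝓕(ℝⁿ)` of representative functions: proper, convex, lower semicontinuous functions
`ℝⁿ × ℝⁿ → ℝ ∪ {+∞}` that dominate the duality product. -/
structure IsRepresentative {n : ℕ} (f : Vec n → Vec n → EReal) : Prop where
  ne_bot : ∀ x y, f x y ≠ ⊥
  proper : ∃ x y, f x y ≠ ⊤
  convex : IsConvexFun f
  lsc : IsLscFun f
  inner_le : ∀ x y, ((inner ℝ x y : ℝ) : EReal) ≤ f x y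

/-- The class `𝓕(Ω; ℝⁿ)` of measurable representative functions. -/
structure IsMeasurableRepresentative {n : ℕ} {Ω : Type*} [MeasurableSpace Ω] (μ : Measure Ω)
    (f : Vec n → Vec n → Ω → EReal) : Prop where
  ne_bot : ∀ x y ω, f x y ω ≠ ⊥
  measurable : Measurable (fun z : (Vec n × Vec n) × Ω => f z.1.1 z.1.2 z.2)
  convex : ∀ᵐ ω ∂μ, IsConvexFun (fun x y => f x y ω)
  lsc : ∀ᵐ ω ∂μ, IsLscFun (fun x y => f x y ω)
  inner_le : ∀ᵐ ω ∂μ, ∀ x y, ((inner ℝ x y : ℝ) : EReal) ≤ f x y ω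

/-- `f(·,·,ω)` represents the operator `α(·,ω)` for a.e. `ω`. -/
def Represents {n : ℕ} {Ω : Type*} [MeasurableSpace Ω] (μ : Measure Ω)
    (f : Vec n → Vec n → Ω → EReal) (α : Vec n → Ω → Set (Vec n)) : Prop :=
  ∀ᵐ ω ∂μ, ∀ x y, y ∈ α x ω ↔ f x y ω = ((inner ℝ x y : ℝ) : EReal)

/-- The coercivity condition with exponents `p` and `q`. -/
def IsCoerciveIntegrand {n : ℕ} {Ω : Type*} [MeasurableSpace Ω] (μ : Measure Ω) (p q : ℝ)
    (f : Vec n → Vec n → Ω → EReal) : Prop :=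
  ∃ c : ℝ, 0 < c ∧ ∃ k : Ω → ℝ, Integrable k μ ∧
    ∀ (ξ η : Vec n) (ω : Ω), ((c * (‖ξ‖ ^ p + ‖η‖ ^ q) + k ω : ℝ) : EReal) ≤ f ξ η ω

/-- The integral of an extended real function, as the integral of the positive part minus the
integral of the negative part (the latter is finite whenever the function is bounded from below
by an integrable function). -/
def extIntegral {Ω : Type*} [MeasurableSpace Ω] (μ : Measure Ω) (g : Ω → EReal) : EReal :=
  ((∫⁻ ω, (g ω).toENNReal ∂μ : ℝ≥0∞) : EReal) - ((∫⁻ ω, (-(g ω)).toENNReal ∂μ : ℝ≥0∞) : EReal)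

/-- The functional `(u, v) ↦ ∫ f(ξ + u(ω), η + v(ω), ω) dμ`. -/
def energy {n : ℕ} {Ω : Type*} [MeasurableSpace Ω] (μ : Measure Ω)
    (f : Vec n → Vec n → Ω → EReal) (ξ η : Vec n) (u v : Ω → Vec n) : EReal :=
  extIntegral μ (fun ω => f (ξ + u ω) (η + v ω) ω)

/-- The homogenized representation `f₀`. -/
def homogenized {n : ℕ} {Ω : Type*} [MeasurableSpace Ω] (μ : Measure Ω) (T : Vec n → Ω → Ω)
    (p q : ℝ) (f : Vec n → Vec n → Ω → EReal) (ξ η : Vec n) : EReal :=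
  ⨅ u ∈ VSol μ T p, ⨅ v ∈ VPot μ T q, energy μ f ξ η u v

end

/-! Subtracting the integrable lower bound k turns the energy into the integral of a nonnegative
convex integrand F = f - k plus a constant. Everything reduces to a cell problem: minimise ∫ F(U, V)
over solenoidal U and potential V with means ξ and η (`homogenized_eq`).

Existence, convexity, lower semicontinuity. Both differential constraints say that realizations are
orthogonal to a family of test fields, a condition closed under L¹ convergence
(`ae_annihilates_of_tendsto`). The direct method runs with strong convergence instead of weak
compactness. Among competitors whose constraints and energy bound are relaxed by δ_N, take almost
minimisers of ‖U‖^p + ‖V‖^q. These competitor sets are convex and decreasing, so uniform convexity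
makes the choice Cauchy, and Fatou's lemma passes to the limit
(`IsConvexIntegrand.exists_of_approx`). Fixed means give minimisers, varying means give lower
semicontinuity, and mixing minimisers gives convexity.

Lower bound. Since f(x, y) ≥ x·y, it suffices that ∫ U·V = ξ·η for admissible pairs. With C_ij(y) =
∫ U_i(T_y ω) V_j(ω), curl-freeness of V turns ∂_k Σ C_ii into Σ ∂_i C_ik, which vanishes because U
is divergence-free. Hence ∫ U(T_y ω)·V(ω) does not depend on y (`integral_inner_comp_eq`). When U
has mean zero, convex combinations of its translates converge to an invariant field, which is zero
by ergodicity (`integral_inner_eq_zero`).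

Properness. One pair of finite energy is needed. The representing function yields Minty's theorem
for α(·, ω), and the resolvents are measurable in ω. Let K be the closed subspace of potential
fields in L²; fields in its complement are solenoidal. The problem V ∈ α(U), U ∈ Kᗮ, V ∈ K is a
fixed point equation for a nonexpansive map, the reflected resolvent followed by minus the
reflection in K. A damped version is a contraction, and its fixed point solves V ∈ α(U) with
constraints violated by an arbitrarily small amount and ∫ U·V ≤ 0. On the graph f = U·V, so
coercivity bounds the norms, the means and the energy uniformly, and the direct method removes the
error (`exists_finite_energy`). -/

/-! ### Annihilators of families of test fields -/

/-- `v` is locally integrable and orthogonal to every field of the family `𝒯`. -/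
def Annihilates {n : ℕ} (𝒯 : Set (Vec n → Vec n)) (v : Vec n → Vec n) : Prop :=
  LocallyIntegrable v volume ∧ ∀ Ψ ∈ 𝒯, ∫ x, inner ℝ (v x) (Ψ x) = 0

/-- Every field of the family is continuous and compactly supported. -/
def IsTestFamily {n : ℕ} (𝒯 : Set (Vec n → Vec n)) : Prop :=
  ∀ Ψ ∈ 𝒯, Continuous Ψ ∧ HasCompactSupport Ψ

theorem integrable_inner_of_locallyIntegrable {n : ℕ} {v Ψ : Vec n → Vec n}
    (hv : LocallyIntegrable v volume) (hΨ : Continuous Ψ) (hΨc : HasCompactSupport Ψ) :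
    Integrable (fun x => inner ℝ (v x) (Ψ x)) volume := by
  obtain ⟨C, hC⟩ := hΨc.exists_bound_of_continuous hΨ
  have h1 : IntegrableOn v (tsupport Ψ) volume := hv.integrableOn_isCompact hΨc
  have h2 : IntegrableOn (fun x => inner ℝ (v x) (Ψ x)) (tsupport Ψ) volume := by
    refine Integrable.mono' (h1.norm.mul_const C)
      (h1.aestronglyMeasurable.inner hΨ.aestronglyMeasurable) (ae_of_all _ fun x => ?_)
    exact (norm_inner_le_norm _ _).trans
      (mul_le_mul_of_nonneg_left (hC x) (norm_nonneg _))
  refine (integrableOn_iff_integrable_of_support_subset ?_).1 h2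
  intro x hx
  by_contra h
  exact hx (by simp [image_eq_zero_of_notMem_tsupport h])

theorem Annihilates.add {n : ℕ} {𝒯 : Set (Vec n → Vec n)} (h𝒯 : IsTestFamily 𝒯)
    {v w : Vec n → Vec n} (hv : Annihilates 𝒯 v) (hw : Annihilates 𝒯 w) :
    Annihilates 𝒯 (fun x => v x + w x) := by
  refine ⟨hv.1.add hw.1, fun Ψ hΨ => ?_⟩
  simp only [inner_add_left]
  rw [integral_add (integrable_inner_of_locallyIntegrable hv.1 (h𝒯 Ψ hΨ).1 (h𝒯 Ψ hΨ).2)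
    (integrable_inner_of_locallyIntegrable hw.1 (h𝒯 Ψ hΨ).1 (h𝒯 Ψ hΨ).2), hv.2 Ψ hΨ, hw.2 Ψ hΨ,
    add_zero]

theorem Annihilates.smul {n : ℕ} {𝒯 : Set (Vec n → Vec n)} (a : ℝ)
    {v : Vec n → Vec n} (hv : Annihilates 𝒯 v) :
    Annihilates 𝒯 (fun x => a • v x) := by
  refine ⟨hv.1.smul a, fun Ψ hΨ => ?_⟩
  simp only [inner_smul_left]
  rw [integral_const_mul, hv.2 Ψ hΨ, mul_zero]

theorem norm_integral_inner_le {n : ℕ} {v Φ : Vec n → Vec n} {K : Set (Vec n)}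
    (hv : IntegrableOn v K volume) {ε : ℝ} (hK : MeasurableSet K) (hΦ : ∀ x ∈ K, ‖Φ x‖ ≤ ε)
    (h0 : ∀ x ∉ K, Φ x = 0) :
    ‖∫ x, inner ℝ (v x) (Φ x)‖ ≤ ε * ∫ x in K, ‖v x‖ := by
  have : ∫ x, inner ℝ (v x) (Φ x) = ∫ x in K, inner ℝ (v x) (Φ x) := by
    refine (setIntegral_eq_integral_of_forall_compl_eq_zero fun x hx => ?_).symm
    simp [h0 x hx]
  rw [this, ← integral_const_mul]
  refine norm_integral_le_of_norm_le (hv.norm.const_mul ε) ?_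
  filter_upwards [ae_restrict_mem hK] with x hx
  refine (norm_inner_le_norm _ _).trans ?_
  rw [mul_comm]
  exact mul_le_mul_of_nonneg_right (hΦ x hx) (norm_nonneg _)

/-- The pseudometric induced by `F` is second countable, hence separable, so the approximating
points can be taken in `X` itself and not merely in the closure of its image. -/
theorem exists_countable_dist_lt {X Y : Type*} [PseudoMetricSpace Y] [SecondCountableTopology Y]
    (F : X → Y) : ∃ D : Set X, D.Countable ∧ ∀ x, ∀ ε > 0, ∃ x' ∈ D, dist (F x) (F x') < ε := by
  let _ : PseudoMetricSpace X := PseudoMetricSpace.induced F inferInstance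
  have hF : Topology.IsInducing F := ⟨rfl⟩
  have : SecondCountableTopology X := hF.secondCountableTopology
  obtain ⟨D, hDc, hDd⟩ := TopologicalSpace.exists_countable_dense X
  exact ⟨D, hDc, fun x ε hε => hDd.exists_dist_lt x hε⟩

/-- Continuous fields on a closed ball form a separable space for the sup norm, and pairing with a
field integrable on the ball is continuous for that norm. -/
theorem IsTestFamily.exists_countable_subset_closedBall {n : ℕ} {𝒯 : Set (Vec n → Vec n)}
    (h𝒯 : IsTestFamily 𝒯) (N : ℕ) :
    ∃ D : Set (Vec n → Vec n), D.Countable ∧ D ⊆ 𝒯 ∧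
      ∀ v : Vec n → Vec n, LocallyIntegrable v volume →
        (∀ Ψ ∈ D, ∫ x, inner ℝ (v x) (Ψ x) = 0) →
        ∀ Ψ ∈ 𝒯, tsupport Ψ ⊆ Metric.closedBall 0 N → ∫ x, inner ℝ (v x) (Ψ x) = 0 := by
  let X := {Ψ : Vec n → Vec n // Ψ ∈ 𝒯 ∧ tsupport Ψ ⊆ Metric.closedBall 0 (N : ℝ)}
  let F : X → C(Metric.closedBall (0 : Vec n) (N : ℝ), Vec n) := fun Ψ =>
    ⟨fun x => Ψ.1 x, (h𝒯 Ψ.1 Ψ.2.1).1.comp continuous_subtype_val⟩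
  obtain ⟨D, hDc, hDd⟩ := exists_countable_dist_lt F
  refine ⟨Subtype.val '' D, hDc.image _, ?_, ?_⟩
  · rintro _ ⟨Ψ, -, rfl⟩
    exact Ψ.2.1
  · intro v hv hD Ψ hΨ hsupp
    have hvK : IntegrableOn v (Metric.closedBall 0 (N : ℝ)) volume :=
      hv.integrableOn_isCompact (isCompact_closedBall _ _)
    set I := ∫ x in Metric.closedBall (0 : Vec n) (N : ℝ), ‖v x‖ with hI
    have hI0 : 0 ≤ I := integral_nonneg fun _ => norm_nonneg _
    have key : ∀ ε > 0, ‖∫ x, inner ℝ (v x) (Ψ x)‖ ≤ ε * I := by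
      intro ε hε
      obtain ⟨Ψ', hΨ'D, hdist⟩ := hDd (⟨Ψ, hΨ, hsupp⟩ : X) ε hε
      have h1 : ∫ x, inner ℝ (v x) (Ψ x) = ∫ x, inner ℝ (v x) (Ψ x - Ψ'.1 x) := by
        simp only [inner_sub_right]
        rw [integral_sub
          (integrable_inner_of_locallyIntegrable hv (h𝒯 Ψ hΨ).1 (h𝒯 Ψ hΨ).2)
          (integrable_inner_of_locallyIntegrable hv (h𝒯 _ Ψ'.2.1).1 (h𝒯 _ Ψ'.2.1).2),
          hD _ ⟨Ψ', hΨ'D, rfl⟩, sub_zero]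
      rw [h1]
      refine norm_integral_inner_le hvK measurableSet_closedBall ?_ ?_
      · intro x hx
        have h2 : dist (F ⟨Ψ, hΨ, hsupp⟩) (F Ψ') < ε := hdist
        have h3 := (ContinuousMap.dist_apply_le_dist (⟨x, hx⟩ : Metric.closedBall (0 : Vec n) (N : ℝ))
          (f := F ⟨Ψ, hΨ, hsupp⟩) (g := F Ψ')).trans h2.le
        rwa [dist_eq_norm] at h3
      · intro x hx
        rw [image_eq_zero_of_notMem_tsupport fun h => hx (hsupp h),
          image_eq_zero_of_notMem_tsupport fun h => hx (Ψ'.2.2 h), sub_zero]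
    have h0 : ‖∫ x, inner ℝ (v x) (Ψ x)‖ ≤ 0 := by
      refine le_of_forall_pos_le_add fun ε hε => ?_
      have := key (ε / (I + 1)) (by positivity)
      refine this.trans ?_
      rw [zero_add, div_mul_eq_mul_div, div_le_iff₀ (by positivity)]
      nlinarith
    exact norm_le_zero_iff.1 h0

/-- Countability is what allows "for each test field, for almost every ω" to be replaced by "for
almost every ω, for each test field". -/
theorem IsTestFamily.exists_countable_subset {n : ℕ} {𝒯 : Set (Vec n → Vec n)}
    (h𝒯 : IsTestFamily 𝒯) :
    ∃ D : Set (Vec n → Vec n), D.Countable ∧ D ⊆ 𝒯 ∧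
      ∀ v : Vec n → Vec n, LocallyIntegrable v volume →
        (∀ Ψ ∈ D, ∫ x, inner ℝ (v x) (Ψ x) = 0) → Annihilates 𝒯 v := by
  choose D hDc hD𝒯 hD using h𝒯.exists_countable_subset_closedBall
  refine ⟨⋃ N, D N, Set.countable_iUnion hDc, Set.iUnion_subset hD𝒯, fun v hv h => ⟨hv, ?_⟩⟩
  intro Ψ hΨ
  obtain ⟨R, hR⟩ := (h𝒯 Ψ hΨ).2.isCompact.isBounded.subset_closedBall (0 : Vec n)
  obtain ⟨N, hN⟩ := exists_nat_ge R
  exact hD N v hv (fun Φ hΦ => h Φ (Set.mem_iUnion.2 ⟨N, hΦ⟩)) Ψ hΨ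
    (hR.trans (Metric.closedBall_subset_closedBall hN))

/-! ### Gradient and curl test fields -/

/-- The gradient `∇φ` as a vector field. -/
noncomputable def gradField {n : ℕ} (φ : Vec n → ℝ) (x : Vec n) : Vec n :=
  WithLp.toLp 2 fun i => partialDeriv i φ x

/-- The field `∂ⱼφ eᵢ - ∂ᵢφ eⱼ`. -/
noncomputable def curlField {n : ℕ} (i j : Fin n) (φ : Vec n → ℝ) (x : Vec n) : Vec n :=
  partialDeriv j φ x • EuclideanSpace.single i (1 : ℝ) -
    partialDeriv i φ x • EuclideanSpace.single j (1 : ℝ)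

/-- The family of gradients of test functions. -/
def gradTests (n : ℕ) : Set (Vec n → Vec n) :=
  {Ψ | ∃ φ, IsTestFunction φ ∧ Ψ = gradField φ}

/-- The family of elementary divergence-free test fields. -/
def curlTests (n : ℕ) : Set (Vec n → Vec n) :=
  {Ψ | ∃ i j φ, IsTestFunction φ ∧ Ψ = curlField i j φ}

theorem IsTestFunction.continuous_partialDeriv {n : ℕ} {φ : Vec n → ℝ} (h : IsTestFunction φ)
    (j : Fin n) : Continuous (partialDeriv j φ) :=
  (h.1.continuous_fderiv (by simp)).clm_apply continuous_const

theorem IsTestFunction.hasCompactSupport_partialDeriv {n : ℕ} {φ : Vec n → ℝ}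
    (h : IsTestFunction φ) (j : Fin n) : HasCompactSupport (partialDeriv j φ) :=
  h.2.fderiv_apply ℝ _

theorem isTestFamily_gradTests (n : ℕ) : IsTestFamily (gradTests n) := by
  rintro _ ⟨φ, hφ, rfl⟩
  constructor
  · exact (PiLp.continuous_toLp 2 _).comp
      (continuous_pi fun i => hφ.continuous_partialDeriv i)
  · refine (hφ.2.fderiv ℝ).mono ?_
    refine Function.support_subset_iff'.2 fun x hx => ?_
    have h : fderiv ℝ φ x = 0 := Function.notMem_support.1 hx
    ext i
    simp [gradField, partialDeriv, h]

theorem isTestFamily_curlTests (n : ℕ) : IsTestFamily (curlTests n) := by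
  rintro _ ⟨i, j, φ, hφ, rfl⟩
  constructor
  · exact ((hφ.continuous_partialDeriv j).smul continuous_const).sub
      ((hφ.continuous_partialDeriv i).smul continuous_const)
  · refine (hφ.2.fderiv ℝ).mono ?_
    refine Function.support_subset_iff'.2 fun x hx => ?_
    have h : fderiv ℝ φ x = 0 := Function.notMem_support.1 hx
    simp [curlField, partialDeriv, h]

theorem inner_gradField {n : ℕ} (a : Vec n) (φ : Vec n → ℝ) (x : Vec n) :
    inner ℝ a (gradField φ x) = ∑ i, a i * partialDeriv i φ x := by
  simp [gradField, PiLp.inner_apply, mul_comm]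

theorem inner_curlField {n : ℕ} (a : Vec n) (i j : Fin n) (φ : Vec n → ℝ) (x : Vec n) :
    inner ℝ a (curlField i j φ x) = a i * partialDeriv j φ x - a j * partialDeriv i φ x := by
  simp [curlField, inner_sub_right, inner_smul_right, EuclideanSpace.inner_single_right, mul_comm]

theorem integrable_coord_mul_partialDeriv {n : ℕ} {v : Vec n → Vec n}
    (hv : LocallyIntegrable v volume) {φ : Vec n → ℝ} (hφ : IsTestFunction φ) (i j : Fin n) :
    Integrable (fun x => v x i * partialDeriv j φ x) volume := by
  have := integrable_inner_of_locallyIntegrable hv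
    (Ψ := fun x => partialDeriv j φ x • EuclideanSpace.single i (1 : ℝ))
    ((hφ.continuous_partialDeriv j).smul continuous_const)
    ((hφ.hasCompactSupport_partialDeriv j).smul_right)
  refine this.congr (ae_of_all _ fun x => ?_)
  simp [inner_smul_right, EuclideanSpace.inner_single_right, mul_comm]

/-- Together with `isPotentialField_iff`, this puts both constraints in the form of orthogonality to
a test family, so that sums, limits and changes on null sets are treated once for both. -/
theorem isSolenoidalField_iff {n : ℕ} {v : Vec n → Vec n} :
    IsSolenoidalField v ↔ Annihilates (gradTests n) v := by
  have key : LocallyIntegrable v volume → ∀ φ : Vec n → ℝ, IsTestFunction φ →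
      ∫ x, inner ℝ (v x) (gradField φ x) = ∑ i : Fin n, ∫ x, v x i * partialDeriv i φ x := by
    intro hv φ hφ
    simp only [inner_gradField]
    exact integral_finsetSum _ fun i _ => integrable_coord_mul_partialDeriv hv hφ i i
  constructor
  · rintro ⟨hv, h⟩
    refine ⟨hv, ?_⟩
    rintro _ ⟨φ, hφ, rfl⟩
    rw [key hv φ hφ, h φ hφ]
  · rintro ⟨hv, h⟩
    exact ⟨hv, fun φ hφ => by rw [← key hv φ hφ, h _ ⟨φ, hφ, rfl⟩]⟩

theorem isPotentialField_iff {n : ℕ} {v : Vec n → Vec n} :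
    IsPotentialField v ↔ Annihilates (curlTests n) v := by
  constructor
  · rintro ⟨hv, h⟩
    refine ⟨hv, ?_⟩
    rintro _ ⟨i, j, φ, hφ, rfl⟩
    simp only [inner_curlField]
    exact h i j φ hφ
  · rintro ⟨hv, h⟩
    refine ⟨hv, fun i j φ hφ => ?_⟩
    have := h _ ⟨i, j, φ, hφ, rfl⟩
    simpa only [inner_curlField] using this

theorem partialDeriv_comp_neg {n : ℕ} (j : Fin n) (φ : Vec n → ℝ) (x : Vec n) :
    partialDeriv j (fun y => φ (-y)) x = - partialDeriv j φ (-x) := by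
  have h := fderiv_comp_smul (𝕜 := ℝ) (f := φ) (x := x) (c := (-1 : ℝ))
  simp only [neg_smul, one_smul] at h
  simp [partialDeriv, h]

theorem IsTestFunction.comp_neg {n : ℕ} {φ : Vec n → ℝ} (h : IsTestFunction φ) :
    IsTestFunction (fun y => φ (-y)) :=
  ⟨h.1.comp contDiff_neg, h.2.comp_homeomorph (Homeomorph.neg _)⟩

/-! ### Measure preserving dynamical systems -/

namespace IsDynamicalSystem

variable {n : ℕ} {Ω : Type*} [MeasurableSpace Ω] {μ : Measure Ω} {T : Vec n → Ω → Ω}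

theorem add_apply (hT : IsDynamicalSystem μ T) (x y : Vec n) (ω : Ω) :
    T (x + y) ω = T x (T y ω) := by
  rw [hT.add]; rfl

theorem zero_apply (hT : IsDynamicalSystem μ T) (ω : Ω) : T 0 ω = ω := by
  rw [hT.zero]; rfl

theorem neg_apply_apply (hT : IsDynamicalSystem μ T) (x : Vec n) (ω : Ω) :
    T (-x) (T x ω) = ω := by
  rw [← hT.add_apply, neg_add_cancel, hT.zero_apply]

theorem apply_neg_apply (hT : IsDynamicalSystem μ T) (x : Vec n) (ω : Ω) :
    T x (T (-x) ω) = ω := by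
  rw [← hT.add_apply, add_neg_cancel, hT.zero_apply]

/-- Joint measurability is assumed only after composition with vector-valued functions; an indicator
with values in a one-dimensional space detects an arbitrary measurable set. -/
theorem measurable_uncurry (hT : IsDynamicalSystem μ T) :
    Measurable (fun z : Vec n × Ω => T z.1 z.2) := by
  classical
  intro B hB
  have hg : Measurable (B.indicator fun _ => (EuclideanSpace.single 0 1 : Vec 1)) :=
    measurable_const.indicator hB
  have h := hT.measurable_comp 1 _ hg (measurableSet_singleton (0 : Vec 1)).compl
  convert h using 1
  ext z
  simp [Set.indicator_apply]

theorem measurable (hT : IsDynamicalSystem μ T) (x : Vec n) : Measurable (T x) :=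
  hT.measurable_uncurry.comp measurable_prodMk_left

theorem preimage_eq_image (hT : IsDynamicalSystem μ T) (x : Vec n) (S : Set Ω) :
    T x ⁻¹' S = T (-x) '' S := by
  ext ω
  constructor
  · intro h
    exact ⟨T x ω, h, hT.neg_apply_apply x ω⟩
  · rintro ⟨ω', h, rfl⟩
    simpa [hT.apply_neg_apply] using h

theorem measurePreserving (hT : IsDynamicalSystem μ T) (x : Vec n) :
    MeasurePreserving (T x) μ μ := by
  refine ⟨hT.measurable x, ?_⟩
  ext S hS
  rw [Measure.map_apply (hT.measurable x) hS, hT.preimage_eq_image, hT.measure_image _ _ hS]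

theorem measurableEmbedding (hT : IsDynamicalSystem μ T) (x : Vec n) :
    MeasurableEmbedding (T x) where
  injective a b h := by
    have := congrArg (T (-x)) h
    simpa [hT.neg_apply_apply] using this
  measurable := hT.measurable x
  measurableSet_image' := fun {_} hS => hT.measurableSet_image x _ hS

/-- Every slice in x of the preimage of a null set is null because `T x` preserves μ. This transfers
almost everywhere statements on Ω to almost every point of almost every realization. -/
theorem quasiMeasurePreserving_uncurry [SFinite μ] (hT : IsDynamicalSystem μ T)
    (ν : Measure (Vec n)) [SFinite ν] :
    Measure.QuasiMeasurePreserving (fun z : Vec n × Ω => T z.1 z.2) (ν.prod μ) μ := by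
  refine ⟨hT.measurable_uncurry, Measure.AbsolutelyContinuous.mk fun S hS h0 => ?_⟩
  rw [Measure.map_apply hT.measurable_uncurry hS,
    Measure.measure_prod_null (hT.measurable_uncurry hS)]
  refine ae_of_all _ fun x => ?_
  exact ((hT.measurePreserving x).measure_preimage hS.nullMeasurableSet).trans h0

theorem ae_ae_realization [SFinite μ] (hT : IsDynamicalSystem μ T) {P : Ω → Prop}
    (hP : ∀ᵐ ω ∂μ, P ω) : ∀ᵐ ω ∂μ, ∀ᵐ x : Vec n, P (T x ω) := by
  have h := (hT.quasiMeasurePreserving_uncurry volume).ae hP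
  have h2 := (Measure.measurePreserving_swap (μ := μ) (ν := (volume : Measure (Vec n)))).quasiMeasurePreserving.ae h
  exact Measure.ae_ae_of_ae_prod h2

/-- By Fubini some single translate of `g` vanishes almost everywhere; translating back by `T (-x)`
gives the claim. -/
theorem ae_of_ae_ae_realization [SFinite μ] (hT : IsDynamicalSystem μ T) {g : Ω → Vec n}
    (hg : Measurable g) (h : ∀ᵐ ω ∂μ, ∀ᵐ x : Vec n, g (T x ω) = 0) : g =ᵐ[μ] 0 := by
  have hm : MeasurableSet {z : Ω × Vec n | g (T z.2 z.1) = 0} :=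
    (hg.comp (hT.measurable_uncurry.comp measurable_swap)) (measurableSet_singleton 0)
  have h1 : ∀ᵐ x : Vec n, ∀ᵐ ω ∂μ, g (T x ω) = 0 := (Measure.ae_ae_comm hm).1 h
  obtain ⟨x, hx⟩ := h1.exists
  have h2 := (hT.measurePreserving (-x)).quasiMeasurePreserving.ae hx
  filter_upwards [h2] with ω hω
  simpa [hT.apply_neg_apply] using hω

theorem aestronglyMeasurable_uncurry [SFinite μ] (hT : IsDynamicalSystem μ T)
    (ν : Measure (Vec n)) [SFinite ν] {E : Type*} [TopologicalSpace E] {u : Ω → E}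
    (hu : AEStronglyMeasurable u μ) :
    AEStronglyMeasurable (fun z : Vec n × Ω => u (T z.1 z.2)) (ν.prod μ) :=
  hu.comp_quasiMeasurePreserving (hT.quasiMeasurePreserving_uncurry ν)

theorem lintegral_comp (hT : IsDynamicalSystem μ T) (x : Vec n) (g : Ω → ℝ≥0∞) :
    ∫⁻ ω, g (T x ω) ∂μ = ∫⁻ ω, g ω ∂μ :=
  (hT.measurePreserving x).lintegral_comp_emb (hT.measurableEmbedding x) g

theorem integral_comp (hT : IsDynamicalSystem μ T) (x : Vec n) {E : Type*} [NormedAddCommGroup E]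
    [NormedSpace ℝ E] (g : Ω → E) :
    ∫ ω, g (T x ω) ∂μ = ∫ ω, g ω ∂μ :=
  (hT.measurePreserving x).integral_comp (hT.measurableEmbedding x) g

theorem integrable_restrict_prod [SFinite μ] (hT : IsDynamicalSystem μ T) {u : Ω → Vec n}
    (hu : Integrable u μ) {K : Set (Vec n)} (hK : volume K ≠ ∞) :
    Integrable (fun z : Vec n × Ω => u (T z.1 z.2)) ((volume.restrict K).prod μ) := by
  refine ⟨hT.aestronglyMeasurable_uncurry _ hu.1, ?_⟩
  have h := (hT.aestronglyMeasurable_uncurry (volume.restrict K) hu.1).enorm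
  rw [HasFiniteIntegral, lintegral_prod _ h]
  have : ∀ x : Vec n, ∫⁻ ω, ‖u (T x ω)‖ₑ ∂μ = ∫⁻ ω, ‖u ω‖ₑ ∂μ := fun x =>
    hT.lintegral_comp x fun ω => ‖u ω‖ₑ
  simp only [this, lintegral_const, Measure.restrict_apply_univ]
  exact ENNReal.mul_lt_top hu.2 hK.lt_top

theorem ae_locallyIntegrable [SFinite μ] (hT : IsDynamicalSystem μ T) {u : Ω → Vec n}
    (hu : Integrable u μ) :
    ∀ᵐ ω ∂μ, LocallyIntegrable (fun x => u (T x ω)) volume := by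
  have h : ∀ᵐ ω ∂μ, ∀ N : ℕ,
      IntegrableOn (fun x => u (T x ω)) (Metric.closedBall (0 : Vec n) N) volume := by
    refine ae_all_iff.2 fun N => ?_
    exact (hT.integrable_restrict_prod hu (isCompact_closedBall _ _).measure_ne_top).prod_left_ae
  filter_upwards [h] with ω hω
  rw [locallyIntegrable_iff]
  intro K hK
  obtain ⟨R, hR⟩ := hK.isBounded.subset_closedBall (0 : Vec n)
  obtain ⟨N, hN⟩ := exists_nat_ge R
  exact (hω N).mono_set (hR.trans (Metric.closedBall_subset_closedBall hN))

end IsDynamicalSystem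

/-- The pairing of the realization of `u` at `ω` with the test field `Ψ`. -/
noncomputable def pairing {n : ℕ} {Ω : Type*} (T : Vec n → Ω → Ω) (Ψ : Vec n → Vec n)
    (u : Ω → Vec n) (ω : Ω) : ℝ :=
  ∫ x : Vec n, inner ℝ (u (T x ω)) (Ψ x)

theorem lintegral_enorm_lt_top_of_hasCompactSupport {n : ℕ} {Ψ : Vec n → Vec n}
    (hΨ : Continuous Ψ) (hΨc : HasCompactSupport Ψ) : ∫⁻ x, ‖Ψ x‖ₑ < ∞ :=
  (hΨ.integrable_of_hasCompactSupport hΨc).2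

theorem enorm_inner_le_mul {n : ℕ} (a b : Vec n) :
    ‖(inner ℝ a b : ℝ)‖ₑ ≤ ‖a‖ₑ * ‖b‖ₑ := by
  simp only [← ofReal_norm]
  rw [← ENNReal.ofReal_mul (norm_nonneg _)]
  exact ENNReal.ofReal_le_ofReal (norm_inner_le_norm _ _)

/-! ### Pairings of realizations with test fields: bounds, limits and Fubini. -/

namespace IsDynamicalSystem

variable {n : ℕ} {Ω : Type*} [MeasurableSpace Ω] {μ : Measure Ω} {T : Vec n → Ω → Ω}

theorem aestronglyMeasurable_inner_uncurry [SFinite μ] (hT : IsDynamicalSystem μ T) {u : Ω → Vec n}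
    {Ψ : Vec n → Vec n} (hu : AEStronglyMeasurable u μ) (hΨ : Continuous Ψ) :
    AEStronglyMeasurable (fun z : Vec n × Ω => (inner ℝ (u (T z.1 z.2)) (Ψ z.1) : ℝ))
      ((volume : Measure (Vec n)).prod μ) :=
  (hT.aestronglyMeasurable_uncurry volume hu).inner
    ((hΨ.measurable.comp measurable_fst).aestronglyMeasurable)

theorem aestronglyMeasurable_pairing [SFinite μ] (hT : IsDynamicalSystem μ T) {u : Ω → Vec n}
    {Ψ : Vec n → Vec n} (hu : AEStronglyMeasurable u μ) (hΨ : Continuous Ψ) :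
    AEStronglyMeasurable (pairing T Ψ u) μ :=
  (hT.aestronglyMeasurable_inner_uncurry hu hΨ).prod_swap.integral_prod_right'

/-- Tonelli and invariance of μ: pairing with a fixed test field is bounded from L¹ to L¹, so the
constraints are stable under L¹ convergence. -/
theorem lintegral_enorm_pairing_le [SFinite μ] (hT : IsDynamicalSystem μ T) {u : Ω → Vec n}
    {Ψ : Vec n → Vec n} (hu : AEStronglyMeasurable u μ) (hΨ : Continuous Ψ) :
    ∫⁻ ω, ‖pairing T Ψ u ω‖ₑ ∂μ ≤ (∫⁻ x, ‖Ψ x‖ₑ) * ∫⁻ ω, ‖u ω‖ₑ ∂μ := by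
  have hm := (hT.aestronglyMeasurable_inner_uncurry hu hΨ).enorm
  calc ∫⁻ ω, ‖pairing T Ψ u ω‖ₑ ∂μ
      ≤ ∫⁻ ω, ∫⁻ x : Vec n, ‖(inner ℝ (u (T x ω)) (Ψ x) : ℝ)‖ₑ ∂volume ∂μ :=
        lintegral_mono fun ω => enorm_integral_le_lintegral_enorm _
    _ = ∫⁻ x : Vec n, ∫⁻ ω, ‖(inner ℝ (u (T x ω)) (Ψ x) : ℝ)‖ₑ ∂μ ∂volume :=
        (lintegral_lintegral_swap hm).symm
    _ ≤ ∫⁻ x : Vec n, ∫⁻ ω, ‖u (T x ω)‖ₑ * ‖Ψ x‖ₑ ∂μ ∂volume :=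
        lintegral_mono fun x => lintegral_mono fun ω => enorm_inner_le_mul _ _
    _ = ∫⁻ x : Vec n, (∫⁻ ω, ‖u ω‖ₑ ∂μ) * ‖Ψ x‖ₑ := by
        refine lintegral_congr fun x => ?_
        rw [lintegral_mul_const' _ _ (by simp), hT.lintegral_comp x fun ω => ‖u ω‖ₑ]
    _ = _ := by
        rw [lintegral_const_mul _ hΨ.measurable.enorm, mul_comm]

theorem ae_annihilates_of_forall [SFinite μ] (hT : IsDynamicalSystem μ T)
    {𝒯 : Set (Vec n → Vec n)} (h𝒯 : IsTestFamily 𝒯) {u : Ω → Vec n} (hu : Integrable u μ)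
    (h : ∀ Ψ ∈ 𝒯, ∀ᵐ ω ∂μ, pairing T Ψ u ω = 0) :
    ∀ᵐ ω ∂μ, Annihilates 𝒯 (fun x => u (T x ω)) := by
  obtain ⟨D, hDc, hD𝒯, hD⟩ := h𝒯.exists_countable_subset
  have h1 : ∀ᵐ ω ∂μ, ∀ Ψ ∈ D, pairing T Ψ u ω = 0 :=
    (ae_ball_iff hDc).2 fun Ψ hΨ => h Ψ (hD𝒯 hΨ)
  filter_upwards [h1, hT.ae_locallyIntegrable hu] with ω h1 h2
  exact hD _ h2 h1

/-- The pairing of `w k` vanishes, so that of `u` equals minus that of `w k - u`, whose L¹ norm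
tends to zero. -/
theorem ae_annihilates_of_tendsto [SFinite μ] (hT : IsDynamicalSystem μ T)
    {𝒯 : Set (Vec n → Vec n)} (h𝒯 : IsTestFamily 𝒯) {u : Ω → Vec n} (hu : Integrable u μ)
    {w : ℕ → Ω → Vec n} (hw : ∀ k, Integrable (w k) μ)
    (hwa : ∀ k, ∀ᵐ ω ∂μ, Annihilates 𝒯 (fun x => w k (T x ω)))
    (hlim : Filter.Tendsto (fun k => eLpNorm (fun ω => w k ω - u ω) 1 μ) Filter.atTop (nhds 0)) :
    ∀ᵐ ω ∂μ, Annihilates 𝒯 (fun x => u (T x ω)) := by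
  refine hT.ae_annihilates_of_forall h𝒯 hu fun Ψ hΨ => ?_
  obtain ⟨hΨ1, hΨ2⟩ := h𝒯 Ψ hΨ
  have hk : ∀ k, ∫⁻ ω, ‖pairing T Ψ u ω‖ₑ ∂μ ≤
      (∫⁻ x, ‖Ψ x‖ₑ) * eLpNorm (fun ω => w k ω - u ω) 1 μ := by
    intro k
    rw [eLpNorm_one_eq_lintegral_enorm]
    refine le_trans (le_of_eq ?_)
      (hT.lintegral_enorm_pairing_le ((hw k).sub hu).aestronglyMeasurable hΨ1)
    refine lintegral_congr_ae ?_
    filter_upwards [hwa k, hT.ae_locallyIntegrable hu] with ω h1 h2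
    have : pairing T Ψ (w k - u) ω = - pairing T Ψ u ω := by
      have h3 := h1.2 Ψ hΨ
      simp only [pairing, Pi.sub_apply, inner_sub_left]
      rw [integral_sub (integrable_inner_of_locallyIntegrable h1.1 hΨ1 hΨ2)
        (integrable_inner_of_locallyIntegrable h2 hΨ1 hΨ2), h3, zero_sub]
    have h4 : ‖pairing T Ψ (w k - u) ω‖ₑ = ‖pairing T Ψ u ω‖ₑ := by rw [this, enorm_neg]
    exact h4.symm
  have h0 : ∫⁻ ω, ‖pairing T Ψ u ω‖ₑ ∂μ = 0 := by
    have := ENNReal.Tendsto.const_mul (a := ∫⁻ x, ‖Ψ x‖ₑ) hlim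
      (Or.inr (lintegral_enorm_lt_top_of_hasCompactSupport hΨ1 hΨ2).ne)
    rw [mul_zero] at this
    exact le_antisymm (ge_of_tendsto' this hk) bot_le
  rw [lintegral_eq_zero_iff' (hT.aestronglyMeasurable_pairing hu.1 hΨ1).enorm] at h0
  filter_upwards [h0] with ω hω
  simpa using hω

theorem ae_annihilates_congr [SFinite μ] (hT : IsDynamicalSystem μ T)
    {𝒯 : Set (Vec n → Vec n)} {u w : Ω → Vec n} (huw : u =ᵐ[μ] w)
    (h : ∀ᵐ ω ∂μ, Annihilates 𝒯 (fun x => u (T x ω))) :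
    ∀ᵐ ω ∂μ, Annihilates 𝒯 (fun x => w (T x ω)) := by
  filter_upwards [h, hT.ae_ae_realization huw] with ω h1 h2
  refine ⟨h1.1.congr h2, fun Ψ hΨ => ?_⟩
  rw [← h1.2 Ψ hΨ]
  refine integral_congr_ae ?_
  filter_upwards [h2] with x hx
  rw [hx]

/-- Fubini. The uniform bound `hbu` covers both uses: a bounded weight against an L¹ field, and a
Hölder pair. -/
theorem integral_mul_pairing [SFinite μ] (hT : IsDynamicalSystem μ T) {u : Ω → Vec n}
    {Ψ : Vec n → Vec n} (hu : AEStronglyMeasurable u μ) (hΨ : Continuous Ψ)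
    (hΨc : HasCompactSupport Ψ) {b : Ω → ℝ} (hb : AEStronglyMeasurable b μ) {C : ℝ≥0∞}
    (hC : C ≠ ∞) (hbu : ∀ x, ∫⁻ ω, ‖b ω‖ₑ * ‖u (T x ω)‖ₑ ∂μ ≤ C) :
    ∫ ω, b ω * pairing T Ψ u ω ∂μ =
      ∫ x : Vec n, ∫ ω, b ω * (inner ℝ (u (T x ω)) (Ψ x) : ℝ) ∂μ := by
  simp only [pairing, ← integral_const_mul]
  symm
  refine integral_integral_swap (f := fun x ω => b ω * (inner ℝ (u (T x ω)) (Ψ x) : ℝ)) ?_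
  have hm : AEStronglyMeasurable
      (fun z : Vec n × Ω => b z.2 * (inner ℝ (u (T z.1 z.2)) (Ψ z.1) : ℝ))
      ((volume : Measure (Vec n)).prod μ) :=
    hb.comp_snd.mul (hT.aestronglyMeasurable_inner_uncurry hu hΨ)
  refine ⟨hm, ?_⟩
  rw [HasFiniteIntegral, lintegral_prod _ (by exact hm.enorm)]
  refine lt_of_le_of_lt (b := ∫⁻ x : Vec n, C * ‖Ψ x‖ₑ) (lintegral_mono fun x => ?_) ?_
  · calc ∫⁻ ω, ‖b ω * (inner ℝ (u (T x ω)) (Ψ x) : ℝ)‖ₑ ∂μ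
        ≤ ∫⁻ ω, ‖b ω‖ₑ * ‖u (T x ω)‖ₑ * ‖Ψ x‖ₑ ∂μ := by
          refine lintegral_mono fun ω => ?_
          rw [enorm_mul, mul_assoc]
          gcongr
          exact enorm_inner_le_mul _ _
      _ = (∫⁻ ω, ‖b ω‖ₑ * ‖u (T x ω)‖ₑ ∂μ) * ‖Ψ x‖ₑ := lintegral_mul_const' _ _ (by simp)
      _ ≤ _ := by gcongr; exact hbu x
  · rw [lintegral_const_mul _ hΨ.measurable.enorm]
    exact ENNReal.mul_lt_top hC.lt_top (lintegral_enorm_lt_top_of_hasCompactSupport hΨ hΨc)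

end IsDynamicalSystem

/-! ### Averages of indicator functions along the flow -/

/-- The field `ω ↦ ∫ 1_B(T₋ₓ ω) Ψ(x) dx`. -/
noncomputable def flowAverage {n : ℕ} {Ω : Type*} (T : Vec n → Ω → Ω) (B : Set Ω)
    (Ψ : Vec n → Vec n) (ω : Ω) : Vec n :=
  ∫ x : Vec n, B.indicator (fun _ => (1 : ℝ)) (T (-x) ω) • Ψ x

theorem norm_flowAverage_le {n : ℕ} {Ω : Type*} (T : Vec n → Ω → Ω) (Ψ : Vec n → Vec n)
    (hΨ : Continuous Ψ) (hΨc : HasCompactSupport Ψ) (B : Set Ω) (ω : Ω) :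
    ‖flowAverage T B Ψ ω‖ ≤ ∫ x, ‖Ψ x‖ := by
  refine norm_integral_le_of_norm_le (hΨ.integrable_of_hasCompactSupport hΨc).norm
    (ae_of_all _ fun x => ?_)
  rw [norm_smul]
  refine mul_le_of_le_one_left (norm_nonneg _) ?_
  by_cases h : T (-x) ω ∈ B <;> simp [h]

namespace IsDynamicalSystem

variable {n : ℕ} {Ω : Type*} [MeasurableSpace Ω] {μ : Measure Ω} {T : Vec n → Ω → Ω}

theorem measurable_indicator_flow (hT : IsDynamicalSystem μ T) {B : Set Ω} (hB : MeasurableSet B) :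
    Measurable (fun z : Vec n × Ω => B.indicator (fun _ => (1 : ℝ)) (T z.1 z.2)) :=
  (measurable_const.indicator hB).comp hT.measurable_uncurry

theorem measurable_flowAverage (hT : IsDynamicalSystem μ T) {B : Set Ω} (hB : MeasurableSet B)
    {Ψ : Vec n → Vec n} (hΨ : Continuous Ψ) : Measurable (flowAverage T B Ψ) := by
  have h1 : Measurable (fun z : Ω × Vec n =>
      B.indicator (fun _ => (1 : ℝ)) (T (-z.2) z.1) • Ψ z.2) := by
    refine Measurable.fun_smul ?_ (hΨ.measurable.comp measurable_snd)
    exact (hT.measurable_indicator_flow hB).comp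
      ((measurable_snd.neg).prodMk measurable_fst)
  exact (h1.stronglyMeasurable.integral_prod_right (ν := volume)).measurable

theorem integrable_indicator_smul (hT : IsDynamicalSystem μ T) {B : Set Ω} (hB : MeasurableSet B)
    {Ψ : Vec n → Vec n} (hΨ : Continuous Ψ) (hΨc : HasCompactSupport Ψ) (ω : Ω) :
    Integrable (fun x : Vec n => B.indicator (fun _ => (1 : ℝ)) (T (-x) ω) • Ψ x) := by
  refine (hΨ.integrable_of_hasCompactSupport hΨc).mono ?_ (ae_of_all _ fun x => ?_)
  · refine Measurable.aestronglyMeasurable (Measurable.fun_smul ?_ hΨ.measurable)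
    exact (hT.measurable_indicator_flow hB).comp (measurable_neg.prodMk measurable_const)
  · rw [norm_smul]
    refine mul_le_of_le_one_left (norm_nonneg _) ?_
    by_cases h : T (-x) ω ∈ B <;> simp [h]

theorem memLp_flowAverage [IsFiniteMeasure μ] (hT : IsDynamicalSystem μ T) {B : Set Ω}
    (hB : MeasurableSet B) {Ψ : Vec n → Vec n} (hΨ : Continuous Ψ) (hΨc : HasCompactSupport Ψ)
    (p : ℝ≥0∞) : MemLp (flowAverage T B Ψ) p μ :=
  MemLp.of_bound (hT.measurable_flowAverage hB hΨ).aestronglyMeasurable _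
    (ae_of_all _ (norm_flowAverage_le T Ψ hΨ hΨc B))

/-- Substituting z = y - x displays the realization as a convolution of `Ψ` with the realization of
an indicator, so it inherits regularity and differential structure from `Ψ`. -/
theorem flowAverage_realization (hT : IsDynamicalSystem μ T) (B : Set Ω) (Ψ : Vec n → Vec n)
    (y : Vec n) (ω : Ω) :
    flowAverage T B Ψ (T y ω) =
      ∫ z : Vec n, B.indicator (fun _ => (1 : ℝ)) (T z ω) • Ψ (y - z) := by
  rw [flowAverage, ← integral_sub_left_eq_self _ _ y]
  refine integral_congr_ae (ae_of_all _ fun z => ?_)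
  simp only
  rw [← hT.add_apply, neg_sub, sub_add_cancel]

/-- Flow averaging is adjoint to the pairing: invariance of μ moves `T x` from `g` onto the
indicator as `T (-x)`, which explains the sign in the definition of `flowAverage`. -/
theorem integral_inner_flowAverage [IsFiniteMeasure μ] (hT : IsDynamicalSystem μ T) {B : Set Ω}
    (hB : MeasurableSet B) {Ψ : Vec n → Vec n} (hΨ : Continuous Ψ) (hΨc : HasCompactSupport Ψ)
    {g : Ω → Vec n} (hg : Integrable g μ) :
    ∫ ω, inner ℝ (g ω) (flowAverage T B Ψ ω) ∂μ = ∫ ω in B, pairing T Ψ g ω ∂μ := by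
  set b : Ω → ℝ := B.indicator fun _ => (1 : ℝ) with hb
  have hbm : Measurable b := measurable_const.indicator hB
  have hb1 : ∀ ω, ‖b ω‖ ≤ 1 := fun ω => by
    by_cases h : ω ∈ B <;> simp [hb, h]
  have h1 : ∫ ω in B, pairing T Ψ g ω ∂μ = ∫ ω, b ω * pairing T Ψ g ω ∂μ := by
    rw [← integral_indicator hB]
    refine integral_congr_ae (ae_of_all _ fun ω => ?_)
    by_cases h : ω ∈ B <;> simp [hb, h]
  have h2 := hT.integral_mul_pairing hg.1 hΨ hΨc hbm.aestronglyMeasurable (C := ∫⁻ ω, ‖g ω‖ₑ ∂μ)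
    hg.2.ne (fun x => by
      rw [← hT.lintegral_comp x fun ω => ‖g ω‖ₑ]
      refine lintegral_mono fun ω => mul_le_of_le_one_left bot_le ?_
      rw [← ofReal_norm]
      exact ENNReal.ofReal_le_one.2 (hb1 ω))
  have h3 : ∀ x : Vec n, ∫ ω, b ω * (inner ℝ (g (T x ω)) (Ψ x) : ℝ) ∂μ =
      ∫ ω, b (T (-x) ω) * (inner ℝ (g ω) (Ψ x) : ℝ) ∂μ := by
    intro x
    rw [← hT.integral_comp x fun ω => b (T (-x) ω) * (inner ℝ (g ω) (Ψ x) : ℝ)]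
    simp only [hT.neg_apply_apply]
  rw [h1, h2]
  simp only [h3]
  rw [integral_integral_swap]
  · refine integral_congr_ae (ae_of_all _ fun ω => ?_)
    simp only [flowAverage]
    rw [← integral_inner (hT.integrable_indicator_smul hB hΨ hΨc ω)]
    refine integral_congr_ae (ae_of_all _ fun x => ?_)
    simp [inner_smul_right, hb]
  · have hi : Integrable (fun z : Vec n × Ω => ‖Ψ z.1‖ * ‖g z.2‖)
        ((volume : Measure (Vec n)).prod μ) :=
      (hΨ.integrable_of_hasCompactSupport hΨc).norm.mul_prod hg.norm
    refine hi.mono' ?_ (ae_of_all _ fun z => ?_)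
    · refine AEStronglyMeasurable.mul ?_ ?_
      · exact (hbm.comp (hT.measurable_uncurry.comp
          (measurable_fst.neg.prodMk measurable_snd))).aestronglyMeasurable
      · exact hg.1.comp_snd.inner (hΨ.measurable.comp measurable_fst).aestronglyMeasurable
    · simp only [Function.uncurry]
      rw [norm_mul]
      refine (mul_le_of_le_one_left (norm_nonneg _) (hb1 _)).trans ?_
      rw [mul_comm]
      exact norm_inner_le_norm _ _

/-- Flow averages serve as test elements on Ω: orthogonality to them makes the integral of the
pairing vanish over every measurable set. -/
theorem ae_pairing_eq_zero_of_inner_flowAverage [IsFiniteMeasure μ] (hT : IsDynamicalSystem μ T)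
    {Ψ : Vec n → Vec n} (hΨ : Continuous Ψ) (hΨc : HasCompactSupport Ψ)
    {g : Ω → Vec n} (hg : Integrable g μ)
    (h : ∀ B, MeasurableSet B → ∫ ω, inner ℝ (g ω) (flowAverage T B Ψ ω) ∂μ = 0) :
    ∀ᵐ ω ∂μ, pairing T Ψ g ω = 0 := by
  have hi : Integrable (pairing T Ψ g) μ := by
    refine ⟨hT.aestronglyMeasurable_pairing hg.1 hΨ, ?_⟩
    exact (hT.lintegral_enorm_pairing_le hg.1 hΨ).trans_lt
      (ENNReal.mul_lt_top (lintegral_enorm_lt_top_of_hasCompactSupport hΨ hΨc) hg.2)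
  refine hi.ae_eq_zero_of_forall_setIntegral_eq_zero fun B hB _ => ?_
  rw [← hT.integral_inner_flowAverage hB hΨ hΨc hg, h B hB]

end IsDynamicalSystem

/-! ### Convolutions and gradients -/

theorem partialDeriv_convolution {n : ℕ} {H : Vec n → ℝ} (hH : LocallyIntegrable H volume)
    {φ : Vec n → ℝ} (hφ : IsTestFunction φ) (j : Fin n) (y : Vec n) :
    partialDeriv j (convolution H φ (ContinuousLinearMap.mul ℝ ℝ) volume) y =
      ∫ z, H z * partialDeriv j φ (y - z) := by
  have h1 : ContDiff ℝ 1 φ := hφ.1.of_le (by exact_mod_cast le_top)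
  have h := hφ.2.hasFDerivAt_convolution_right (ContinuousLinearMap.mul ℝ ℝ) hH h1 y
  rw [partialDeriv, h.fderiv, convolution,
    ContinuousLinearMap.integral_apply]
  · rfl
  · exact (hφ.2.fderiv ℝ).convolutionExists_right _ hH (h1.continuous_fderiv (by simp)) y

theorem contDiff_convolution_test {n : ℕ} {H : Vec n → ℝ} (hH : LocallyIntegrable H volume)
    {φ : Vec n → ℝ} (hφ : IsTestFunction φ) :
    ContDiff ℝ ((⊤ : ℕ∞) : WithTop ℕ∞)
      (convolution H φ (ContinuousLinearMap.mul ℝ ℝ) volume) :=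
  hφ.2.contDiff_convolution_right _ hH hφ.1

theorem integrable_gradField_sub {n : ℕ} {H : Vec n → ℝ} (hH : LocallyIntegrable H volume)
    {Ψ : Vec n → Vec n} (hΨ : Continuous Ψ) (hΨc : HasCompactSupport Ψ) (y : Vec n) :
    Integrable (fun z => H z • Ψ (y - z)) volume :=
  hΨc.convolutionExists_right (ContinuousLinearMap.lsmul ℝ ℝ) hH hΨ y

theorem gradField_convolution {n : ℕ} {H : Vec n → ℝ} (hH : LocallyIntegrable H volume)
    {φ : Vec n → ℝ} (hφ : IsTestFunction φ) (y : Vec n) :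
    gradField (convolution H φ (ContinuousLinearMap.mul ℝ ℝ) volume) y =
      ∫ z, H z • gradField φ (y - z) := by
  obtain ⟨h1, h2⟩ := isTestFamily_gradTests n _ ⟨φ, hφ, rfl⟩
  have hi := integrable_gradField_sub hH h1 h2 y
  ext j
  have h3 := (EuclideanSpace.proj (𝕜 := ℝ) j : Vec n →L[ℝ] ℝ).integral_comp_comm hi
  calc gradField (convolution H φ (ContinuousLinearMap.mul ℝ ℝ) volume) y j
      = ∫ z, H z * partialDeriv j φ (y - z) := partialDeriv_convolution hH hφ j y
    _ = _ := h3

/-- One integration by parts and the symmetry of second derivatives. -/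
theorem isPotentialField_gradField {n : ℕ} {ζ : Vec n → ℝ}
    (hζ : ContDiff ℝ ((⊤ : ℕ∞) : WithTop ℕ∞) ζ) : IsPotentialField (gradField ζ) := by
  have hd1 : ContDiff ℝ ((⊤ : ℕ∞) : WithTop ℕ∞) (fderiv ℝ ζ) :=
    hζ.fderiv_right (by simp)
  have hpd : ∀ i, ContDiff ℝ ((⊤ : ℕ∞) : WithTop ℕ∞) (partialDeriv i ζ) := fun i =>
    hd1.clm_apply contDiff_const
  have hcont : Continuous (gradField ζ) := (PiLp.continuous_toLp 2 _).comp
    (continuous_pi fun i => (hpd i).continuous)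
  refine ⟨hcont.locallyIntegrable, fun i j φ hφ => ?_⟩
  have hint : ∀ i j, Integrable (fun x => partialDeriv i ζ x * partialDeriv j φ x) volume :=
    fun i j => ((hpd i).continuous.mul (hφ.continuous_partialDeriv j)).integrable_of_hasCompactSupport
      ((hφ.hasCompactSupport_partialDeriv j).mul_left)
  have hpcont : ∀ i j, Continuous (partialDeriv j (partialDeriv i ζ)) := fun i j =>
    ((hpd i).continuous_fderiv (by simp)).clm_apply continuous_const
  have hparts : ∀ i j, ∫ x, partialDeriv i ζ x * partialDeriv j φ x =
      - ∫ x, partialDeriv j (partialDeriv i ζ) x * φ x := by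
    intro i j
    refine integral_mul_fderiv_eq_neg_fderiv_mul_of_integrable ?_ (hint i j) ?_ ?_ ?_
    · exact ((hpcont i j).mul hφ.1.continuous).integrable_of_hasCompactSupport hφ.2.mul_left
    · exact ((hpd i).continuous.mul hφ.1.continuous).integrable_of_hasCompactSupport hφ.2.mul_left
    · exact fun x _ => ((hpd i).differentiable (by simp)).differentiableAt
    · exact fun x _ => (hφ.1.differentiable (by simp)).differentiableAt
  have hsymm : ∀ x, partialDeriv j (partialDeriv i ζ) x = partialDeriv i (partialDeriv j ζ) x := by
    intro x
    have h2 : HasFDerivAt (fderiv ℝ ζ) (fderiv ℝ (fderiv ℝ ζ) x) x :=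
      (hd1.differentiable (by simp)).differentiableAt.hasFDerivAt
    have h3 : ∀ i j : Fin n, partialDeriv j (partialDeriv i ζ) x =
        fderiv ℝ (fderiv ℝ ζ) x (EuclideanSpace.single j 1) (EuclideanSpace.single i 1) := by
      intro i j
      have := h2.clm_apply (hasFDerivAt_const (EuclideanSpace.single i (1 : ℝ) : Vec n) x)
      have h4 : fderiv ℝ (partialDeriv i ζ) x = _ := this.fderiv
      rw [partialDeriv, h4]
      simp
    rw [h3, h3]
    exact second_derivative_symmetric
      (fun y => (hζ.differentiable (by simp)).differentiableAt.hasFDerivAt) h2 _ _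
  have : ∀ x, gradField ζ x i * partialDeriv j φ x - gradField ζ x j * partialDeriv i φ x =
    partialDeriv i ζ x * partialDeriv j φ x - partialDeriv j ζ x * partialDeriv i φ x := fun x => rfl
  simp only [this]
  rw [integral_sub (hint i j) (hint j i), hparts, hparts]
  simp only [hsymm, sub_self]

/-- A continuous function with vanishing distributional gradient is constant. -/
theorem eq_of_forall_integral_partialDeriv_eq_zero {n : ℕ} {c : Vec n → ℝ} (hc : Continuous c)
    (h : ∀ φ, IsTestFunction φ → ∀ k, ∫ x, c x * partialDeriv k φ x = 0) (y : Vec n) :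
    c y = c 0 := by
  have hcl : LocallyIntegrable c volume := hc.locallyIntegrable
  -- Mollification: the derivative of c ∗ φ is an integral of c against a derivative of a reflected
  -- test function, hence zero, so each mollification is constant.
  have hconv : ∀ φ, IsTestFunction φ → ∀ y, convolution c φ (ContinuousLinearMap.mul ℝ ℝ) volume y =
      convolution c φ (ContinuousLinearMap.mul ℝ ℝ) volume 0 := by
    intro φ hφ y
    refine is_const_of_fderiv_eq_zero (𝕜 := ℝ)
      ((contDiff_convolution_test hcl hφ).differentiable (by simp)) (fun x => ?_) y 0
    have hp : ∀ j, fderiv ℝ (convolution c φ (ContinuousLinearMap.mul ℝ ℝ) volume) x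
        (EuclideanSpace.single j 1) = 0 := by
      intro j
      refine (partialDeriv_convolution hcl hφ j x).trans ?_
      have hφ' : IsTestFunction fun z => φ (x - z) :=
        ⟨hφ.1.comp (contDiff_const.sub contDiff_id), hφ.2.comp_homeomorph (Homeomorph.subLeft x)⟩
      have := h _ hφ' j
      have hd : ∀ z, partialDeriv j (fun z => φ (x - z)) z = - partialDeriv j φ (x - z) := by
        intro z
        have h1 : HasFDerivAt (fun z => φ (x - z))
            ((fderiv ℝ φ (x - z)).comp (-ContinuousLinearMap.id ℝ (Vec n))) z := by
          have h2 : HasFDerivAt (fun z : Vec n => x - z) (-ContinuousLinearMap.id ℝ (Vec n)) z :=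
            (hasFDerivAt_id z).const_sub x
          exact ((hφ.1.differentiable (by simp)).differentiableAt.hasFDerivAt).comp z h2
        rw [partialDeriv, h1.fderiv]
        simp [partialDeriv]
      simp only [hd, mul_neg, integral_neg] at this
      linarith
    refine ContinuousLinearMap.coe_injective
      ((EuclideanSpace.basisFun (Fin n) ℝ).toBasis.ext fun j => ?_)
    simpa using hp j
  have hae : ∀ᵐ x, c (x + y) - c x = 0 := by
    refine ae_eq_zero_of_integral_contDiff_smul_eq_zero
      ((hc.comp (continuous_add_const y)).sub hc).locallyIntegrable fun φ hφ1 hφ2 => ?_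
    have hφ : IsTestFunction φ := ⟨hφ1, hφ2⟩
    -- Reflecting φ turns equality of the mollifications at y and 0 into the vanishing of ∫ (c(x +
    -- y) - c(x)) φ(x) dx.
    have h1 := hconv _ hφ.comp_neg y
    simp only [convolution, ContinuousLinearMap.mul_apply', zero_sub, neg_neg, neg_sub] at h1
    have hi1 : Integrable (fun x => φ x * c (x + y)) volume :=
      (hφ1.continuous.mul (hc.comp (continuous_add_const y))).integrable_of_hasCompactSupport
        hφ2.mul_right
    have hi2 : Integrable (fun x => φ x * c x) volume :=
      (hφ1.continuous.mul hc).integrable_of_hasCompactSupport hφ2.mul_right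
    simp only [smul_eq_mul, mul_sub]
    rw [integral_sub hi1 hi2, sub_eq_zero, ← integral_sub_right_eq_self _ y]
    simp only [sub_add_cancel, mul_comm (φ _)]
    exact h1
  have heq : (fun x => c (x + y) - c x) = fun _ => 0 :=
    (Continuous.ae_eq_iff_eq volume ((hc.comp (continuous_add_const y)).sub hc)
      continuous_const).1 hae
  have := congrFun heq 0
  simp only [zero_add] at this
  linarith

/-! ### Strong continuity of the Koopman group on `L²` -/

/-- For y within distance 1 of y₀ the integrand lives on one compact set, where continuity of
parametric integrals applies. -/
theorem tendsto_integral_norm_translate_sub {n : ℕ} {Ψ : Vec n → Vec n} (hΨ : Continuous Ψ)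
    (hΨc : HasCompactSupport Ψ) (y₀ : Vec n) :
    Filter.Tendsto (fun y => ∫ z, ‖Ψ (y - z) - Ψ (y₀ - z)‖) (nhds y₀) (nhds 0) := by
  set K : Set (Vec n) := (fun a : Vec n × Vec n => a.1 - a.2) ''
    (Metric.closedBall y₀ 1 ×ˢ tsupport Ψ) with hK
  have hKc : IsCompact K := ((isCompact_closedBall y₀ 1).prod hΨc).image
    (continuous_fst.sub continuous_snd)
  have h1 : Continuous fun y => ∫ z in K, ‖Ψ (y - z) - Ψ (y₀ - z)‖ :=
    continuous_parametric_integral_of_continuous (by unfold Function.uncurry; fun_prop) hKc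
  have h2 := h1.tendsto y₀
  simp only [sub_self, norm_zero, integral_zero] at h2
  refine h2.congr' ?_
  filter_upwards [Metric.closedBall_mem_nhds y₀ one_pos] with y hy
  refine setIntegral_eq_integral_of_forall_compl_eq_zero fun z hz => ?_
  have hnot : ∀ y ∈ Metric.closedBall y₀ 1, Ψ (y - z) = 0 := by
    intro y hy
    refine image_eq_zero_of_notMem_tsupport fun h => hz ?_
    exact ⟨(y, y - z), ⟨hy, h⟩, by simp⟩
  rw [hnot y hy, hnot y₀ (Metric.mem_closedBall_self zero_le_one), sub_self, norm_zero]

/-- Testing with φ e, where e is the vector ∫ φ v itself, gives |e|² = 0 for every smooth φ of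
compact support. -/
theorem ae_eq_zero_of_annihilates_all {n : ℕ} {v : Vec n → Vec n}
    (hv : Annihilates {Ψ | Continuous Ψ ∧ HasCompactSupport Ψ} v) : ∀ᵐ x, v x = 0 := by
  refine ae_eq_zero_of_integral_contDiff_smul_eq_zero hv.1 fun φ hφ hφc => ?_
  set e := ∫ x, φ x • v x with he
  have hi : Integrable (fun x => φ x • v x) :=
    hv.1.integrable_smul_left_of_hasCompactSupport hφ.continuous hφc
  have h1 := hv.2 (fun x => φ x • e) ⟨hφ.continuous.smul continuous_const, hφc.smul_right⟩
  have h2 := integral_inner (𝕜 := ℝ) hi e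
  rw [← he] at h2
  have h3 : inner ℝ e e = (0 : ℝ) := by
    rw [← h2, ← h1]
    refine integral_congr_ae (ae_of_all _ fun x => ?_)
    simp only [inner_smul_right]
    rw [real_inner_comm]
  exact inner_self_eq_zero.1 h3

namespace IsDynamicalSystem

variable {n : ℕ} {Ω : Type*} [MeasurableSpace Ω] {μ : Measure Ω} {T : Vec n → Ω → Ω}

/-- The Koopman operator on `L²`. -/
noncomputable def koopman (hT : IsDynamicalSystem μ T) (x : Vec n) :
    Lp (Vec n) 2 μ →ₗᵢ[ℝ] Lp (Vec n) 2 μ :=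
  Lp.compMeasurePreservingₗᵢ ℝ (T x) (hT.measurePreserving x)

theorem koopman_coeFn (hT : IsDynamicalSystem μ T) (x : Vec n) (a : Lp (Vec n) 2 μ) :
    hT.koopman x a =ᵐ[μ] fun ω => a (T x ω) :=
  Lp.coeFn_compMeasurePreserving a (hT.measurePreserving x)

/-- The subspace of strong continuity of the Koopman group. -/
noncomputable def continuousVectors (hT : IsDynamicalSystem μ T) :
    Submodule ℝ (Lp (Vec n) 2 μ) where
  carrier := {a | Continuous fun x => hT.koopman x a}
  add_mem' {a b} ha hb := by
    simp only [Set.mem_ofPred_eq, map_add] at *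
    exact ha.add hb
  zero_mem' := by
    simp only [Set.mem_ofPred_eq, map_zero]
    exact continuous_const
  smul_mem' r a ha := by
    simp only [Set.mem_ofPred_eq, map_smul] at *
    exact ha.const_smul r

theorem isClosed_continuousVectors (hT : IsDynamicalSystem μ T) :
    IsClosed (hT.continuousVectors : Set (Lp (Vec n) 2 μ)) := by
  refine isClosed_of_closure_subset fun a ha => ?_
  refine continuous_of_uniform_approx_of_continuous fun u hu => ?_
  obtain ⟨ε, hε, hεu⟩ := Metric.mem_uniformity_dist.1 hu
  obtain ⟨b, hb, hab⟩ := Metric.mem_closure_iff.1 ha ε hε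
  exact ⟨_, hb, fun x => hεu (by rwa [(hT.koopman x).isometry.dist_eq])⟩

/-- Translating a flow average amounts to translating `Ψ`, so the difference is bounded uniformly in
ω by an L¹ distance between translates of `Ψ`. -/
theorem flowAverage_mem_continuousVectors [IsProbabilityMeasure μ] (hT : IsDynamicalSystem μ T)
    {B : Set Ω} (hB : MeasurableSet B) {Ψ : Vec n → Vec n} (hΨ : Continuous Ψ)
    (hΨc : HasCompactSupport Ψ) :
    (hT.memLp_flowAverage hB hΨ hΨc 2).toLp _ ∈ hT.continuousVectors := by
  refine continuous_iff_continuousAt.2 fun y₀ => ?_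
  rw [ContinuousAt, tendsto_iff_dist_tendsto_zero]
  refine squeeze_zero (fun _ => dist_nonneg) (fun y => ?_)
    (tendsto_integral_norm_translate_sub hΨ hΨc y₀)
  rw [dist_eq_norm]
  have h0 : 0 ≤ ∫ z, ‖Ψ (y - z) - Ψ (y₀ - z)‖ := integral_nonneg fun _ => norm_nonneg _
  refine (Lp.norm_le_of_ae_bound h0 ?_).trans (by simp [measureUnivNNReal])
  have hc := (hT.memLp_flowAverage hB hΨ hΨc 2).coeFn_toLp
  filter_upwards [Lp.coeFn_sub (hT.koopman y ((hT.memLp_flowAverage hB hΨ hΨc 2).toLp _))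
      (hT.koopman y₀ ((hT.memLp_flowAverage hB hΨ hΨc 2).toLp _)),
    hT.koopman_coeFn y ((hT.memLp_flowAverage hB hΨ hΨc 2).toLp _),
    hT.koopman_coeFn y₀ ((hT.memLp_flowAverage hB hΨ hΨc 2).toLp _),
    (hT.measurePreserving y).quasiMeasurePreserving.ae hc,
    (hT.measurePreserving y₀).quasiMeasurePreserving.ae hc] with ω h1 h2 h3 h4 h5
  rw [h1, Pi.sub_apply, h2, h3, h4, h5, hT.flowAverage_realization, hT.flowAverage_realization]
  have hint : ∀ y, Integrable
      (fun z : Vec n => B.indicator (fun _ => (1 : ℝ)) (T z ω) • Ψ (y - z)) := by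
    intro y
    have := (hT.integrable_indicator_smul hB hΨ hΨc (T y ω)).comp_sub_left y
    refine this.congr (ae_of_all _ fun z => ?_)
    simp only
    rw [← hT.add_apply, neg_sub, sub_add_cancel]
  have hΨi : ∀ y, Integrable (fun z : Vec n => Ψ (y - z)) := fun y =>
    (hΨ.integrable_of_hasCompactSupport hΨc).comp_sub_left y
  rw [← integral_sub (hint y) (hint y₀)]
  refine norm_integral_le_of_norm_le ((hΨi y).sub (hΨi y₀)).norm (ae_of_all _ fun z => ?_)
  rw [← smul_sub, norm_smul]
  refine mul_le_of_le_one_left (norm_nonneg _) ?_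
  by_cases h : T z ω ∈ B <;> simp [h]

/-- A field orthogonal to the closed subspace of continuous vectors is orthogonal to all flow
averages. Its realizations then annihilate every continuous compactly supported field, so it
vanishes and the subspace is everything. -/
theorem continuous_koopman [IsProbabilityMeasure μ] (hT : IsDynamicalSystem μ T)
    (a : Lp (Vec n) 2 μ) : Continuous fun x => hT.koopman x a := by
  have : IsClosed (hT.continuousVectors : Set (Lp (Vec n) 2 μ)) := hT.isClosed_continuousVectors
  have : CompleteSpace hT.continuousVectors := this.completeSpace_coe
  have htop : hT.continuousVectors = ⊤ := by
    rw [← Submodule.orthogonal_eq_bot_iff, Submodule.eq_bot_iff]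
    intro g hg
    have hgi : Integrable g μ := (Lp.memLp g).integrable (by norm_num)
    have h1 : ∀ᵐ ω ∂μ, Annihilates {Ψ | Continuous Ψ ∧ HasCompactSupport Ψ}
        (fun x => g (T x ω)) := by
      refine hT.ae_annihilates_of_forall (fun Ψ hΨ => hΨ) hgi fun Ψ hΨ => ?_
      refine hT.ae_pairing_eq_zero_of_inner_flowAverage hΨ.1 hΨ.2 hgi fun B hB => ?_
      have h2 := (Submodule.mem_orthogonal' _ _).1 hg _
        (hT.flowAverage_mem_continuousVectors hB hΨ.1 hΨ.2)
      rw [L2.inner_def] at h2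
      rw [← h2]
      refine integral_congr_ae ?_
      filter_upwards [(hT.memLp_flowAverage hB hΨ.1 hΨ.2 2).coeFn_toLp] with ω hω
      rw [hω]
    have h3 := hT.ae_of_ae_ae_realization (Lp.stronglyMeasurable g).measurable
      (h1.mono fun ω hω => ae_eq_zero_of_annihilates_all hω)
    exact Lp.eq_zero_iff_ae_eq_zero.2 h3
  have : a ∈ hT.continuousVectors := htop ▸ Submodule.mem_top
  exact this

/-! ### Potential fields in `L²` and their orthogonal complement -/

/-- The subspace of `L²` of all fields with potential realizations. -/
noncomputable def potentialSubspace [IsFiniteMeasure μ] (hT : IsDynamicalSystem μ T) :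
    Submodule ℝ (Lp (Vec n) 2 μ) where
  carrier := {a | ∀ᵐ ω ∂μ, Annihilates (curlTests n) fun x => a (T x ω)}
  add_mem' {a b} ha hb := by
    refine hT.ae_annihilates_congr (Lp.coeFn_add a b).symm ?_
    filter_upwards [ha, hb] with ω h1 h2
    exact h1.add (isTestFamily_curlTests n) h2
  zero_mem' := by
    refine hT.ae_annihilates_congr (u := fun _ => 0) (Lp.coeFn_zero _ _ _).symm ?_
    exact ae_of_all _ fun ω => ⟨locallyIntegrable_zero, fun Ψ _ => by simp⟩
  smul_mem' r a ha := by
    refine hT.ae_annihilates_congr (Lp.coeFn_smul r a).symm ?_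
    filter_upwards [ha] with ω h1
    exact h1.smul r

theorem isClosed_potentialSubspace [IsProbabilityMeasure μ] (hT : IsDynamicalSystem μ T) :
    IsClosed (hT.potentialSubspace : Set (Lp (Vec n) 2 μ)) := by
  refine IsSeqClosed.isClosed fun a b ha hab => ?_
  have hint : ∀ a : Lp (Vec n) 2 μ, Integrable a μ := fun a =>
    (Lp.memLp a).integrable (by norm_num)
  refine hT.ae_annihilates_of_tendsto (isTestFamily_curlTests n) (hint b)
    (fun k => hint (a k)) ha ?_
  have h1 := (Lp.tendsto_Lp_iff_tendsto_eLpNorm' a b).1 hab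
  refine tendsto_of_tendsto_of_tendsto_of_le_of_le tendsto_const_nhds h1 (fun _ => bot_le)
    fun k => ?_
  exact eLpNorm_le_eLpNorm_of_exponent_le (by norm_num)
    ((Lp.aestronglyMeasurable (a k)).sub (Lp.aestronglyMeasurable b))

/-- The realization is the gradient of the convolution of φ with the realization of the indicator of
`B`. -/
theorem flowAverage_mem_potentialSubspace [IsProbabilityMeasure μ] (hT : IsDynamicalSystem μ T)
    {B : Set Ω} (hB : MeasurableSet B) {φ : Vec n → ℝ} (hφ : IsTestFunction φ)
    (hm : MemLp (flowAverage T B (gradField φ)) 2 μ) :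
    hm.toLp _ ∈ hT.potentialSubspace := by
  refine hT.ae_annihilates_congr hm.coeFn_toLp.symm (ae_of_all _ fun ω => ?_)
  rw [← isPotentialField_iff]
  have hH : LocallyIntegrable (fun z => B.indicator (fun _ => (1 : ℝ)) (T z ω)) volume := by
    refine (locallyIntegrable_const (1 : ℝ)).mono ?_ (ae_of_all _ fun z => ?_)
    · exact ((hT.measurable_indicator_flow hB).comp
        (measurable_id.prodMk measurable_const)).aestronglyMeasurable
    · by_cases h : T z ω ∈ B <;> simp [h]
  have : (fun x => flowAverage T B (gradField φ) (T x ω)) = gradField (convolution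
      (fun z => B.indicator (fun _ => (1 : ℝ)) (T z ω)) φ (ContinuousLinearMap.mul ℝ ℝ) volume) := by
    funext y
    rw [hT.flowAverage_realization, gradField_convolution hH hφ]
  rw [this]
  exact isPotentialField_gradField (contDiff_convolution_test hH hφ)

/-- Flow averages of gradients are potential, so orthogonality to potential fields tests against all
gradients. Of the Helmholtz decomposition, the fixed point argument needs only this inclusion. -/
theorem ae_annihilates_gradTests_of_mem_orthogonal [IsProbabilityMeasure μ]
    (hT : IsDynamicalSystem μ T) {g : Lp (Vec n) 2 μ} (hg : g ∈ hT.potentialSubspaceᗮ) :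
    ∀ᵐ ω ∂μ, Annihilates (gradTests n) (fun x => g (T x ω)) := by
  have hgi : Integrable g μ := (Lp.memLp g).integrable (by norm_num)
  refine hT.ae_annihilates_of_forall (isTestFamily_gradTests n) hgi fun Ψ hΨ => ?_
  obtain ⟨hΨ1, hΨ2⟩ := isTestFamily_gradTests n Ψ hΨ
  refine hT.ae_pairing_eq_zero_of_inner_flowAverage hΨ1 hΨ2 hgi fun B hB => ?_
  obtain ⟨φ, hφ, rfl⟩ := hΨ
  have h2 := (Submodule.mem_orthogonal' _ _).1 hg _
    (hT.flowAverage_mem_potentialSubspace hB hφ (hT.memLp_flowAverage hB hΨ1 hΨ2 2))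
  rw [L2.inner_def] at h2
  rw [← h2]
  refine integral_congr_ae ?_
  filter_upwards [(hT.memLp_flowAverage hB hΨ1 hΨ2 2).coeFn_toLp] with ω hω
  rw [hω]

end IsDynamicalSystem

/-! ### Uniform convexity of powers of norms -/

theorem two_mul_norm_midpoint_rpow_le {E : Type*} [NormedAddCommGroup E] [NormedSpace ℝ E] {p : ℝ}
    (hp : 1 < p) (a b : E) : 2 * ‖(1 / 2 : ℝ) • (a + b)‖ ^ p ≤ ‖a‖ ^ p + ‖b‖ ^ p := by
  have h1 := (strictConvexOn_rpow hp).convexOn.2 (norm_nonneg a) (norm_nonneg b)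
    (by norm_num : (0 : ℝ) ≤ 1 / 2) (by norm_num : (0 : ℝ) ≤ 1 / 2) (by norm_num)
  simp only [smul_eq_mul] at h1
  have h2 : ‖(1 / 2 : ℝ) • (a + b)‖ ≤ 1 / 2 * ‖a‖ + 1 / 2 * ‖b‖ := by
    rw [norm_smul, Real.norm_of_nonneg (by norm_num : (0 : ℝ) ≤ 1 / 2), ← mul_add]
    gcongr
    exact norm_add_le a b
  have h3 := Real.rpow_le_rpow (norm_nonneg _) h2 (by linarith : 0 ≤ p)
  linarith

/-- If the norms differ, strict convexity of t ↦ t^p gives strictness; if they agree, strict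
convexity of the norm does. -/
theorem two_mul_norm_midpoint_rpow_lt {E : Type*} [NormedAddCommGroup E] [NormedSpace ℝ E]
    [StrictConvexSpace ℝ E] {p : ℝ} (hp : 1 < p) {a b : E} (hab : a ≠ b) :
    2 * ‖(1 / 2 : ℝ) • (a + b)‖ ^ p < ‖a‖ ^ p + ‖b‖ ^ p := by
  have hm : ‖(1 / 2 : ℝ) • (a + b)‖ = 1 / 2 * ‖a + b‖ := by
    rw [norm_smul, Real.norm_of_nonneg (by norm_num : (0 : ℝ) ≤ 1 / 2)]
  by_cases hn : ‖a‖ = ‖b‖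
  · have h2 : ‖a + b‖ < ‖a‖ + ‖b‖ := lt_of_le_of_ne (norm_add_le a b)
      fun h => hab (eq_of_norm_eq_of_norm_add_eq hn h)
    have h3 : ‖(1 / 2 : ℝ) • (a + b)‖ < ‖a‖ := by rw [hm]; linarith
    have h4 := Real.rpow_lt_rpow (norm_nonneg _) h3 (by linarith : 0 < p)
    rw [← hn]
    linarith
  · have h1 := (strictConvexOn_rpow hp).2 (norm_nonneg a) (norm_nonneg b) hn
      (by norm_num : (0 : ℝ) < 1 / 2) (by norm_num : (0 : ℝ) < 1 / 2) (by norm_num)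
    simp only [smul_eq_mul] at h1
    have h2 : ‖(1 / 2 : ℝ) • (a + b)‖ ≤ 1 / 2 * ‖a‖ + 1 / 2 * ‖b‖ := by
      rw [hm]
      linarith [norm_add_le a b]
    have h3 := Real.rpow_le_rpow (norm_nonneg _) h2 (by linarith : 0 ≤ p)
    linarith

/-- Compactness: on normalised pairs with ‖a - b‖^p ≥ ε the convexity gap is continuous and
positive, hence at least some δ > 0. -/
theorem exists_norm_sub_rpow_le_of_eq_one {n : ℕ} {p : ℝ} (hp : 1 < p) {ε : ℝ} (hε : 0 < ε) :
    ∃ C : ℝ, 0 ≤ C ∧ ∀ a b : Vec n, ‖a‖ ^ p + ‖b‖ ^ p = 1 →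
      ‖a - b‖ ^ p ≤ ε + C * (‖a‖ ^ p + ‖b‖ ^ p - 2 * ‖(1 / 2 : ℝ) • (a + b)‖ ^ p) := by
  have hp0 : 0 < p := by linarith
  have hcont : ∀ g : Vec n × Vec n → Vec n, Continuous g → Continuous fun z => ‖g z‖ ^ p :=
    fun g hg => hg.norm.rpow_const fun _ => Or.inr hp0.le
  have c1 := hcont _ continuous_fst
  have c2 := hcont _ continuous_snd
  have c3 := hcont _ (continuous_fst.sub continuous_snd)
  have c4 := hcont (fun z => (1 / 2 : ℝ) • (z.1 + z.2)) (by fun_prop)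
  have hle1 : ∀ a b : Vec n, ‖a‖ ^ p + ‖b‖ ^ p = 1 → ‖a‖ ≤ 1 := by
    intro a b h
    by_contra! hlt
    have := Real.one_lt_rpow hlt hp0
    have := Real.rpow_nonneg (norm_nonneg b) p
    linarith
  have hle2 : ∀ a b : Vec n, ‖a‖ ^ p + ‖b‖ ^ p = 1 → ‖b‖ ≤ 1 := fun a b h =>
    hle1 b a (by linarith)
  let K : Set (Vec n × Vec n) := {z | ‖z.1‖ ^ p + ‖z.2‖ ^ p = 1 ∧ ε ≤ ‖z.1 - z.2‖ ^ p}
  have hK : IsCompact K := by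
    refine Metric.isCompact_of_isClosed_isBounded ?_ ?_
    · exact (isClosed_eq (c1.add c2) continuous_const).inter (isClosed_le continuous_const c3)
    · refine (Metric.isBounded_closedBall (x := (0 : Vec n × Vec n)) (r := 1)).subset ?_
      rintro ⟨a, b⟩ ⟨h, -⟩
      rw [mem_closedBall_zero_iff, Prod.norm_def]
      exact max_le (hle1 a b h) (hle2 a b h)
  let D : Vec n × Vec n → ℝ := fun z =>
    ‖z.1‖ ^ p + ‖z.2‖ ^ p - 2 * ‖(1 / 2 : ℝ) • (z.1 + z.2)‖ ^ p
  have hD : Continuous D := (c1.add c2).sub (continuous_const.mul c4)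
  obtain ⟨δ, hδ, hδK⟩ : ∃ δ > 0, ∀ z ∈ K, δ ≤ D z := by
    rcases K.eq_empty_or_nonempty with hE | hE
    · exact ⟨1, one_pos, by simp [hE]⟩
    · obtain ⟨z, hz, hmin⟩ := hK.exists_isMinOn hE hD.continuousOn
      refine ⟨D z, ?_, fun w hw => hmin hw⟩
      have hne : z.1 ≠ z.2 := by
        intro h
        have h2 := hz.2
        rw [h, sub_self, norm_zero, Real.zero_rpow hp0.ne'] at h2
        linarith
      exact sub_pos.2 (two_mul_norm_midpoint_rpow_lt hp hne)
  -- Normalised vectors have norm at most 1, so ‖a - b‖^p ≤ 2^p, and a gap of at least δ times this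
  -- constant dominates it.
  refine ⟨2 ^ p / δ, by positivity, fun a b h => ?_⟩
  have hD0 : 0 ≤ D (a, b) := sub_nonneg.2 (two_mul_norm_midpoint_rpow_le hp a b)
  change ‖a - b‖ ^ p ≤ ε + 2 ^ p / δ * D (a, b)
  by_cases hab : ε ≤ ‖a - b‖ ^ p
  · have h1 : ‖a - b‖ ^ p ≤ 2 ^ p := by
      refine Real.rpow_le_rpow (norm_nonneg _) ?_ hp0.le
      linarith [norm_sub_le a b, hle1 a b h, hle2 a b h]
    have h2 := hδK (a, b) ⟨h, hab⟩
    have h3 : (2 : ℝ) ^ p ≤ 2 ^ p / δ * D (a, b) := by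
      rw [div_mul_eq_mul_div, le_div_iff₀ hδ]
      exact mul_le_mul_of_nonneg_left h2 (by positivity)
    linarith
  · have : 0 ≤ 2 ^ p / δ * D (a, b) := by positivity
    linarith

/-- Both sides are homogeneous of degree p, so rescaling reduces to the normalised case. The
additive form can be integrated over Ω. -/
theorem exists_norm_sub_rpow_le {n : ℕ} {p : ℝ} (hp : 1 < p) {ε : ℝ} (hε : 0 < ε) :
    ∃ C : ℝ, 0 ≤ C ∧ ∀ a b : Vec n, ‖a - b‖ ^ p ≤ ε * (‖a‖ ^ p + ‖b‖ ^ p) +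
      C * (‖a‖ ^ p + ‖b‖ ^ p - 2 * ‖(1 / 2 : ℝ) • (a + b)‖ ^ p) := by
  have hp0 : 0 < p := by linarith
  obtain ⟨C, hC, h⟩ := exists_norm_sub_rpow_le_of_eq_one (n := n) hp hε
  refine ⟨C, hC, fun a b => ?_⟩
  set s := ‖a‖ ^ p + ‖b‖ ^ p with hs
  have ha0 := Real.rpow_nonneg (norm_nonneg a) p
  have hb0 := Real.rpow_nonneg (norm_nonneg b) p
  rcases (add_nonneg ha0 hb0).eq_or_lt with h0 | h0
  · have ha : a = 0 := by
      have : ‖a‖ ^ p = 0 := by linarith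
      exact norm_eq_zero.1 ((Real.rpow_eq_zero (norm_nonneg _) hp0.ne').1 this)
    have hb : b = 0 := by
      have : ‖b‖ ^ p = 0 := by linarith
      exact norm_eq_zero.1 ((Real.rpow_eq_zero (norm_nonneg _) hp0.ne').1 this)
    simp [hs, ha, hb, Real.zero_rpow hp0.ne']
  · rw [← hs] at h0
    set r := s⁻¹ ^ p⁻¹ with hr
    have hr0 : 0 ≤ r := by positivity
    have hrp : r ^ p = s⁻¹ := Real.rpow_inv_rpow (by positivity) hp0.ne'
    have hsc : ∀ c : Vec n, ‖r • c‖ ^ p = s⁻¹ * ‖c‖ ^ p := fun c => by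
      rw [norm_smul, Real.norm_of_nonneg hr0, Real.mul_rpow hr0 (norm_nonneg _), hrp]
    have h1 := h (r • a) (r • b) (by
      rw [hsc, hsc, ← mul_add, ← hs, inv_mul_cancel₀ h0.ne'])
    rw [← smul_sub, ← smul_add, smul_comm, hsc, hsc, hsc, hsc] at h1
    have h2 := mul_le_mul_of_nonneg_left h1 h0.le
    have h3 : s * (s⁻¹ * ‖a - b‖ ^ p) = ‖a - b‖ ^ p := by field_simp
    have h4 : s * (ε + C * (s⁻¹ * ‖a‖ ^ p + s⁻¹ * ‖b‖ ^ p -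
        2 * (s⁻¹ * ‖(1 / 2 : ℝ) • (a + b)‖ ^ p))) =
        ε * s + C * (‖a‖ ^ p + ‖b‖ ^ p - 2 * ‖(1 / 2 : ℝ) • (a + b)‖ ^ p) := by
      field_simp
    rw [h3, h4] at h2
    exact h2

/-! ### Uniformly convex functionals and almost minimising sequences -/

/-- A functional whose midpoint convexity gap controls the distance on sublevel sets. -/
def IsUniformlyConvexFunctional {E : Type*} [NormedAddCommGroup E] [NormedSpace ℝ E]
    (Φ : E → ℝ) : Prop :=
  ∀ M : ℝ, ∀ ε > 0, ∃ δ > 0, ∀ a b : E, Φ a ≤ M → Φ b ≤ M →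
    Φ a + Φ b - 2 * Φ ((1 / 2 : ℝ) • (a + b)) ≤ δ → ‖a - b‖ ≤ ε

theorem Convex.half_smul_add_mem {E : Type*} [NormedAddCommGroup E] [NormedSpace ℝ E] {C : Set E}
    (hC : Convex ℝ C) {a b : E} (ha : a ∈ C) (hb : b ∈ C) : (1 / 2 : ℝ) • (a + b) ∈ C := by
  rw [smul_add]
  exact hC ha hb (by norm_num) (by norm_num) (by norm_num)

theorem exists_almost_minimiser {E : Type*} {Φ : E → ℝ} (h0 : ∀ a, 0 ≤ Φ a) {C : Set E}
    (hne : C.Nonempty) {ε : ℝ} (hε : 0 < ε) : ∃ w ∈ C, ∀ a ∈ C, Φ w ≤ Φ a + ε := by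
  have hbdd : BddBelow (Φ '' C) := ⟨0, by rintro _ ⟨a, -, rfl⟩; exact h0 a⟩
  obtain ⟨_, ⟨w, hw, rfl⟩, hlt⟩ := exists_lt_of_csInf_lt (hne.image Φ)
    (lt_add_of_pos_right (sInf (Φ '' C)) hε)
  refine ⟨w, hw, fun a ha => ?_⟩
  have := csInf_le hbdd ⟨a, ha, rfl⟩
  linarith

/-- The infima m_N over the decreasing sets increase to a finite limit L. For k ≥ N the midpoint of
w_k and w_N lies in C_N, so its value is at least m_N and the convexity gap is at most L - m_N +
2/(N + 1). This replaces weak compactness by strong convergence. -/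
theorem IsUniformlyConvexFunctional.cauchySeq {E : Type*} [NormedAddCommGroup E]
    [NormedSpace ℝ E] {Φ : E → ℝ} (hΦ : IsUniformlyConvexFunctional Φ) (h0 : ∀ a, 0 ≤ Φ a)
    {C : ℕ → Set E} (hC : ∀ N, Convex ℝ (C N)) (hanti : Antitone C) {M : ℝ}
    (hM : ∀ a ∈ C 0, Φ a ≤ M) {w : ℕ → E} (hw : ∀ N, w N ∈ C N)
    (hmin : ∀ N, ∀ a ∈ C N, Φ (w N) ≤ Φ a + 1 / (N + 1)) : CauchySeq w := by
  have hwM : ∀ N, Φ (w N) ≤ M := fun N => hM _ (hanti (Nat.zero_le N) (hw N))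
  set m : ℕ → ℝ := fun N => sInf (Φ '' C N) with hm
  have hbdd : ∀ N, BddBelow (Φ '' C N) := fun N => ⟨0, by rintro _ ⟨a, -, rfl⟩; exact h0 a⟩
  have hml : ∀ N, ∀ a ∈ C N, m N ≤ Φ a := fun N a ha => csInf_le (hbdd N) ⟨a, ha, rfl⟩
  have hmu : ∀ N, Φ (w N) ≤ m N + 1 / (N + 1) := fun N => by
    have : Φ (w N) - 1 / (N + 1) ≤ m N := by
      refine le_csInf ⟨_, _, hw N, rfl⟩ ?_
      rintro _ ⟨a, ha, rfl⟩
      linarith [hmin N a ha]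
    linarith
  have hmono : Monotone m := fun N N' h =>
    csInf_le_csInf (hbdd N) ⟨_, _, hw N', rfl⟩ (Set.image_mono (hanti h))
  have hmb : BddAbove (Set.range m) :=
    ⟨M, by rintro _ ⟨N, rfl⟩; exact (hml N _ (hw N)).trans (hwM N)⟩
  have hlim := tendsto_atTop_ciSup hmono hmb
  set L := ⨆ N, m N with hL
  have hmL : ∀ N, m N ≤ L := fun N => le_ciSup hmb N
  rw [Metric.cauchySeq_iff']
  intro ε hε
  obtain ⟨δ, hδ, h⟩ := hΦ M (ε / 2) (by positivity)
  have e1 : ∀ᶠ N in Filter.atTop, L - δ / 4 < m N :=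
    hlim.eventually_const_lt (by linarith)
  have e2 : ∀ᶠ N : ℕ in Filter.atTop, 1 / ((N : ℝ) + 1) < δ / 4 :=
    tendsto_one_div_add_atTop_nhds_zero_nat.eventually_lt_const (by linarith)
  obtain ⟨N, hN1, hN2⟩ := (e1.and e2).exists
  refine ⟨N, fun k hk => ?_⟩
  have hk2 : 1 / ((k : ℝ) + 1) ≤ 1 / ((N : ℝ) + 1) := by
    have : (N : ℝ) ≤ k := by exact_mod_cast hk
    gcongr
  have hmid := hml N _ ((hC N).half_smul_add_mem (hanti hk (hw k)) (hw N))
  have := h (w k) (w N) (hwM k) (hwM N) (by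
    linarith [hmu k, hmu N, hmL k, hmL N])
  rw [dist_eq_norm]
  linarith

theorem IsUniformlyConvexFunctional.exists_cauchySeq {E : Type*} [NormedAddCommGroup E]
    [NormedSpace ℝ E] {Φ : E → ℝ} (hΦ : IsUniformlyConvexFunctional Φ) (h0 : ∀ a, 0 ≤ Φ a)
    {C : ℕ → Set E} (hC : ∀ N, Convex ℝ (C N)) (hanti : Antitone C) (hne : ∀ N, (C N).Nonempty)
    {M : ℝ} (hM : ∀ a ∈ C 0, Φ a ≤ M) :
    ∃ w : ℕ → E, (∀ N, w N ∈ C N) ∧ CauchySeq w ∧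
      ∀ N, ∀ a ∈ C N, Φ (w N) ≤ Φ a + 1 / (N + 1) := by
  choose w hw hmin using fun N : ℕ =>
    exists_almost_minimiser h0 (hne N) (show (0 : ℝ) < 1 / (N + 1) by positivity)
  exact ⟨w, hw, hΦ.cauchySeq h0 hC hanti hM hw hmin, hmin⟩

/-- Both midpoint gaps are nonnegative, so each is controlled by their sum. -/
theorem IsUniformlyConvexFunctional.prod {E F : Type*} [NormedAddCommGroup E] [NormedSpace ℝ E]
    [NormedAddCommGroup F] [NormedSpace ℝ F] {Φ : E → ℝ} {Θ : F → ℝ}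
    (hΦ : IsUniformlyConvexFunctional Φ) (hΘ : IsUniformlyConvexFunctional Θ)
    (hΦ0 : ∀ a, 0 ≤ Φ a) (hΘ0 : ∀ a, 0 ≤ Θ a)
    (hΦm : ∀ a b, 2 * Φ ((1 / 2 : ℝ) • (a + b)) ≤ Φ a + Φ b)
    (hΘm : ∀ a b, 2 * Θ ((1 / 2 : ℝ) • (a + b)) ≤ Θ a + Θ b) :
    IsUniformlyConvexFunctional (fun z : E × F => Φ z.1 + Θ z.2) := by
  intro M ε hε
  obtain ⟨δ, hδ, h⟩ := hΦ M ε hε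
  obtain ⟨δ', hδ', h'⟩ := hΘ M ε hε
  refine ⟨min δ δ', lt_min hδ hδ', fun a b ha hb hab => ?_⟩
  have m1 := min_le_left δ δ'
  have m2 := min_le_right δ δ'
  have h1 := hΦm a.1 b.1
  have h2 := hΘm a.2 b.2
  simp only [Prod.smul_fst, Prod.smul_snd, Prod.fst_add, Prod.snd_add] at hab
  rw [Prod.norm_def]
  refine max_le (h _ _ ?_ ?_ ?_) (h' _ _ ?_ ?_ ?_)
  all_goals linarith [hΦ0 a.1, hΦ0 b.1, hΘ0 a.2, hΘ0 b.2]

/-! ### Uniform convexity of `Lᵖ` -/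

theorem Lp_norm_rpow_eq_integral {n : ℕ} {Ω : Type*} [MeasurableSpace Ω] {μ : Measure Ω} {p : ℝ}
    (hp : 1 < p) (a : Lp (Vec n) (ENNReal.ofReal p) μ) : ‖a‖ ^ p = ∫ ω, ‖a ω‖ ^ p ∂μ := by
  have hp0 : 0 < p := by linarith
  have h := (Lp.memLp a).eLpNorm_eq_integral_rpow_norm (by simpa using hp0) (by simp)
  rw [Lp.norm_def, h, ENNReal.toReal_ofReal hp0.le, ENNReal.toReal_ofReal (by positivity),
    Real.rpow_inv_rpow (integral_nonneg fun _ => by positivity) hp0.ne']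

theorem MemLp_integrable_rpow {n : ℕ} {Ω : Type*} [MeasurableSpace Ω] {μ : Measure Ω} {p : ℝ}
    (hp : 1 < p) {a : Ω → Vec n} (ha : MemLp a (ENNReal.ofReal p) μ) :
    Integrable (fun ω => ‖a ω‖ ^ p) μ := by
  have hp0 : 0 < p := by linarith
  have := ha.integrable_norm_rpow (by simpa using hp0) (by simp)
  rwa [ENNReal.toReal_ofReal hp0.le] at this

/-- Integrate the pointwise inequality; the parameters are chosen so that its two terms contribute
at most ε^p / 2 each. -/
theorem isUniformlyConvexFunctional_Lp {n : ℕ} {Ω : Type*} [MeasurableSpace Ω] {μ : Measure Ω}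
    {p : ℝ} (hp : 1 < p) [Fact (1 ≤ ENNReal.ofReal p)] :
    IsUniformlyConvexFunctional (fun a : Lp (Vec n) (ENNReal.ofReal p) μ => ‖a‖ ^ p) := by
  intro M ε hε
  have hp0 : 0 < p := by linarith
  have hεp : 0 < ε ^ p := by positivity
  obtain ⟨C, hC, h⟩ := exists_norm_sub_rpow_le (n := n) hp
    (show 0 < ε ^ p / (4 * (|M| + 1)) by positivity)
  refine ⟨ε ^ p / (2 * (C + 1)), by positivity, fun a b ha hb hab => ?_⟩
  have key : ‖a - b‖ ^ p ≤ ε ^ p / (4 * (|M| + 1)) * (‖a‖ ^ p + ‖b‖ ^ p) +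
      C * (‖a‖ ^ p + ‖b‖ ^ p - 2 * ‖(1 / 2 : ℝ) • (a + b)‖ ^ p) := by
    simp only [Lp_norm_rpow_eq_integral hp]
    have i1 := MemLp_integrable_rpow hp (Lp.memLp a)
    have i2 := MemLp_integrable_rpow hp (Lp.memLp b)
    have i3 := MemLp_integrable_rpow hp (Lp.memLp ((1 / 2 : ℝ) • (a + b)))
    have i4 := MemLp_integrable_rpow hp (Lp.memLp (a - b))
    rw [← integral_add i1 i2, ← integral_const_mul, ← integral_const_mul, ← integral_sub,
      ← integral_const_mul, ← integral_add]
    · refine integral_mono_ae i4 ?_ ?_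
      · exact ((i1.add i2).const_mul _).add (((i1.add i2).sub (i3.const_mul 2)).const_mul C)
      · filter_upwards [Lp.coeFn_sub a b, Lp.coeFn_smul (1 / 2 : ℝ) (a + b), Lp.coeFn_add a b]
          with ω h1 h2 h3
        simp only [h1, h2, Pi.sub_apply, Pi.smul_apply, h3, Pi.add_apply]
        exact h (a ω) (b ω)
    · exact (i1.add i2).const_mul _
    · exact ((i1.add i2).sub (i3.const_mul 2)).const_mul C
    · exact i1.add i2
    · exact i3.const_mul 2
  have hM : M ≤ |M| := le_abs_self M
  have h1 : ε ^ p / (4 * (|M| + 1)) * (‖a‖ ^ p + ‖b‖ ^ p) ≤ ε ^ p / 2 := by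
    have : ‖a‖ ^ p + ‖b‖ ^ p ≤ 2 * (|M| + 1) := by linarith
    calc _ ≤ ε ^ p / (4 * (|M| + 1)) * (2 * (|M| + 1)) := by gcongr
      _ = _ := by field_simp; norm_num
  have h2 : C * (‖a‖ ^ p + ‖b‖ ^ p - 2 * ‖(1 / 2 : ℝ) • (a + b)‖ ^ p) ≤ ε ^ p / 2 := by
    calc _ ≤ C * (ε ^ p / (2 * (C + 1))) := by gcongr
      _ ≤ (C + 1) * (ε ^ p / (2 * (C + 1))) := by gcongr; linarith
      _ = _ := by field_simp
  exact (Real.rpow_le_rpow_iff (norm_nonneg _) hε.le hp0).1 (by linarith)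

/-! ### The duality pairing of `Lᵖ` and `L^q` -/

section Duality

variable {n : ℕ} {Ω : Type*} [MeasurableSpace Ω] {μ : Measure Ω} {P Q : ℝ≥0∞}

theorem lintegral_enorm_mul_enorm_le {E F : Type*} [NormedAddCommGroup E] [NormedAddCommGroup F]
    [P.HolderConjugate Q] {a : Ω → E} {b : Ω → F}
    (ha : AEStronglyMeasurable a μ) (hb : AEStronglyMeasurable b μ) :
    ∫⁻ ω, ‖a ω‖ₑ * ‖b ω‖ₑ ∂μ ≤ eLpNorm a P μ * eLpNorm b Q μ := by
  have h := eLpNorm_le_eLpNorm_mul_eLpNorm_of_nnnorm (p := P) (q := Q) (r := 1) ha hb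
    (fun x y => ‖x‖ * ‖y‖) 1 (ae_of_all _ fun ω => by simp)
  rw [eLpNorm_one_eq_lintegral_enorm] at h
  simpa using h

theorem MeasureTheory.MemLp.integrable_inner_of_holderConjugate [P.HolderConjugate Q]
    {a b : Ω → Vec n} (ha : MemLp a P μ) (hb : MemLp b Q μ) :
    Integrable (fun ω => (inner ℝ (a ω) (b ω) : ℝ)) μ := by
  refine ⟨ha.1.inner hb.1, lt_of_le_of_lt (lintegral_mono fun ω => enorm_inner_le_mul _ _) ?_⟩
  exact (lintegral_enorm_mul_enorm_le ha.1 hb.1).trans_lt (ENNReal.mul_lt_top ha.2 hb.2)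

theorem norm_integral_inner_le_eLpNorm [P.HolderConjugate Q] {a b : Ω → Vec n}
    (ha : MemLp a P μ) (hb : MemLp b Q μ) :
    ‖∫ ω, (inner ℝ (a ω) (b ω) : ℝ) ∂μ‖ ≤ (eLpNorm a P μ * eLpNorm b Q μ).toReal := by
  rw [← toReal_enorm]
  refine ENNReal.toReal_mono (ENNReal.mul_lt_top ha.2 hb.2).ne ?_
  refine (enorm_integral_le_lintegral_enorm _).trans ?_
  exact (lintegral_mono fun ω => enorm_inner_le_mul _ _).trans
    (lintegral_enorm_mul_enorm_le ha.1 hb.1)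

theorem tendsto_integral_inner_of_tendsto_eLpNorm [P.HolderConjugate Q] {w : ℕ → Ω → Vec n}
    {m v : Ω → Vec n} (hw : ∀ k, MemLp (w k) P μ) (hm : MemLp m P μ) (hv : MemLp v Q μ)
    (hlim : Filter.Tendsto (fun k => eLpNorm (w k - m) P μ) Filter.atTop (nhds 0)) :
    Filter.Tendsto (fun k => ∫ ω, (inner ℝ (w k ω) (v ω) : ℝ) ∂μ) Filter.atTop
      (nhds (∫ ω, (inner ℝ (m ω) (v ω) : ℝ) ∂μ)) := by
  rw [tendsto_iff_norm_sub_tendsto_zero]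
  have h1 : Filter.Tendsto (fun k => (eLpNorm (w k - m) P μ * eLpNorm v Q μ).toReal)
      Filter.atTop (nhds 0) := by
    have := ENNReal.Tendsto.mul_const (b := eLpNorm v Q μ) hlim (Or.inr hv.2.ne)
    rw [zero_mul] at this
    exact (ENNReal.tendsto_toReal ENNReal.zero_ne_top).comp this
  refine squeeze_zero (fun _ => norm_nonneg _) (fun k => ?_) h1
  refine le_trans (le_of_eq ?_) (norm_integral_inner_le_eLpNorm ((hw k).sub hm) hv)
  rw [← integral_sub ((hw k).integrable_inner_of_holderConjugate hv)
    (hm.integrable_inner_of_holderConjugate hv)]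
  simp only [Pi.sub_apply, inner_sub_left]

end Duality

/-! ### Correlation functions -/

namespace IsDynamicalSystem

variable {n : ℕ} {Ω : Type*} [MeasurableSpace Ω] {μ : Measure Ω} {T : Vec n → Ω → Ω}
  {P Q : ℝ≥0∞}

theorem memLp_comp (hT : IsDynamicalSystem μ T) {E : Type*} [NormedAddCommGroup E] {a : Ω → E}
    (ha : MemLp a P μ) (x : Vec n) : MemLp (fun ω => a (T x ω)) P μ :=
  ha.comp_measurePreserving (hT.measurePreserving x)

theorem eLpNorm_comp (hT : IsDynamicalSystem μ T) {E : Type*} [NormedAddCommGroup E] {a : Ω → E}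
    (ha : AEStronglyMeasurable a μ) (x : Vec n) :
    eLpNorm (fun ω => a (T x ω)) P μ = eLpNorm a P μ :=
  eLpNorm_comp_measurePreserving ha (hT.measurePreserving x)

theorem continuous_correlation_two [IsProbabilityMeasure μ] (hT : IsDynamicalSystem μ T)
    {a b : Ω → Vec n} (ha : MemLp a 2 μ) (hb : MemLp b 2 μ) :
    Continuous fun x => ∫ ω, (inner ℝ (a (T x ω)) (b ω) : ℝ) ∂μ := by
  have h := (hT.continuous_koopman (ha.toLp a)).inner (𝕜 := ℝ)
    (continuous_const (y := hb.toLp b))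
  convert h using 2 with x
  rw [L2.inner_def]
  refine integral_congr_ae ?_
  filter_upwards [hT.koopman_coeFn x (ha.toLp a), hb.coeFn_toLp,
    (hT.measurePreserving x).quasiMeasurePreserving.ae ha.coeFn_toLp] with ω h1 h2 h3
  rw [h1, h2, h3]

/-- Simple functions are dense in both spaces and lie in L², where the Koopman group is strongly
continuous. The approximation is uniform in x because translations preserve norms. -/
theorem continuous_correlation [IsProbabilityMeasure μ] (hT : IsDynamicalSystem μ T)
    [P.HolderConjugate Q] (hP : P ≠ ∞) (hQ : Q ≠ ∞)
    {a b : Ω → Vec n} (ha : MemLp a P μ) (hb : MemLp b Q μ) :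
    Continuous fun x => ∫ ω, (inner ℝ (a (T x ω)) (b ω) : ℝ) ∂μ := by
  refine continuous_of_uniform_approx_of_continuous fun s hs => ?_
  obtain ⟨ε, hε, hεs⟩ := Metric.mem_uniformity_dist.1 hs
  have hδ1 : ENNReal.ofReal (ε / 4 / ((eLpNorm b Q μ).toReal + 1)) ≠ 0 := by
    rw [Ne, ENNReal.ofReal_eq_zero, not_le]
    positivity
  obtain ⟨a', ha', ha'm⟩ := ha.exists_simpleFunc_eLpNorm_sub_lt hP hδ1
  -- The approximation of b is chosen after a', since its tolerance depends on the norm of a'.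
  have hδ2 : ENNReal.ofReal (ε / 4 / ((eLpNorm a' P μ).toReal + 1)) ≠ 0 := by
    rw [Ne, ENNReal.ofReal_eq_zero, not_le]
    positivity
  obtain ⟨b', hb', hb'm⟩ := hb.exists_simpleFunc_eLpNorm_sub_lt hQ hδ2
  refine ⟨_, hT.continuous_correlation_two (a'.memLp_of_isFiniteMeasure 2 μ)
    (b'.memLp_of_isFiniteMeasure 2 μ), fun x => hεs ?_⟩
  have e1 : ‖∫ ω, (inner ℝ (a (T x ω) - a' (T x ω)) (b ω) : ℝ) ∂μ‖ ≤ ε / 4 := by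
    have hsub : MemLp (fun ω => a ω - a' ω) P μ := ha.sub ha'm
    refine (norm_integral_inner_le_eLpNorm (P := P) (Q := Q) (hT.memLp_comp hsub x) hb).trans ?_
    rw [hT.eLpNorm_comp hsub.1, ENNReal.toReal_mul]
    have h1 : (eLpNorm (fun ω => a ω - a' ω) P μ).toReal ≤
        ε / 4 / ((eLpNorm b Q μ).toReal + 1) := ENNReal.toReal_le_of_le_ofReal (by positivity) ha'.le
    have h0 : 0 ≤ (eLpNorm b Q μ).toReal := ENNReal.toReal_nonneg
    calc _ ≤ ε / 4 / ((eLpNorm b Q μ).toReal + 1) * ((eLpNorm b Q μ).toReal + 1) := by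
          gcongr; linarith
      _ = _ := by field_simp
  have e2 : ‖∫ ω, (inner ℝ (a' (T x ω)) (b ω - b' ω) : ℝ) ∂μ‖ ≤ ε / 4 := by
    have hsub : MemLp (fun ω => b ω - b' ω) Q μ := hb.sub hb'm
    refine (norm_integral_inner_le_eLpNorm (P := P) (Q := Q) (hT.memLp_comp ha'm x) hsub).trans ?_
    rw [hT.eLpNorm_comp ha'm.1, ENNReal.toReal_mul]
    have h1 : (eLpNorm (fun ω => b ω - b' ω) Q μ).toReal ≤
        ε / 4 / ((eLpNorm a' P μ).toReal + 1) :=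
      ENNReal.toReal_le_of_le_ofReal (by positivity) hb'.le
    have h0 : 0 ≤ (eLpNorm a' P μ).toReal := ENNReal.toReal_nonneg
    calc _ ≤ ((eLpNorm a' P μ).toReal + 1) * (ε / 4 / ((eLpNorm a' P μ).toReal + 1)) := by
          gcongr; linarith
      _ = _ := by field_simp
  have i1 : Integrable (fun ω => (inner ℝ (a (T x ω)) (b ω) : ℝ)) μ :=
    (hT.memLp_comp ha x).integrable_inner_of_holderConjugate hb
  have i2 : Integrable (fun ω => (inner ℝ (a' (T x ω)) (b ω) : ℝ)) μ :=
    (hT.memLp_comp ha'm x).integrable_inner_of_holderConjugate hb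
  have i3 : Integrable (fun ω => (inner ℝ (a' (T x ω)) (b' ω) : ℝ)) μ :=
    (hT.memLp_comp ha'm x).integrable_inner_of_holderConjugate hb'm
  simp only [inner_sub_left, inner_sub_right] at e1 e2
  rw [integral_sub i1 i2] at e1
  rw [integral_sub i2 i3] at e2
  rw [dist_eq_norm]
  rw [Real.norm_eq_abs, abs_le] at *
  rw [abs_lt]
  constructor <;> linarith [e1.1, e1.2, e2.1, e2.2]

/-- The correlation of the coordinates `uᵢ` and `vⱼ`. -/
noncomputable def coordCorrelation (_ : IsDynamicalSystem μ T) (u v : Ω → Vec n) (i j : Fin n)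
    (x : Vec n) : ℝ :=
  ∫ ω, u (T x ω) i * v ω j ∂μ

theorem _root_.memLp_coord {u : Ω → Vec n} (hu : MemLp u P μ) (i : Fin n) :
    MemLp (fun ω => u ω i) P μ :=
  (EuclideanSpace.proj (𝕜 := ℝ) i : Vec n →L[ℝ] ℝ).comp_memLp' hu

theorem _root_.memLp_coord_smul_single {u : Ω → Vec n} (hu : MemLp u P μ) (i j : Fin n) :
    MemLp (fun ω => u ω i • (EuclideanSpace.single j (1 : ℝ) : Vec n)) P μ :=
  ((ContinuousLinearMap.toSpanSingleton ℝ (EuclideanSpace.single j (1 : ℝ) : Vec n)).comp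
    (EuclideanSpace.proj (𝕜 := ℝ) i : Vec n →L[ℝ] ℝ)).comp_memLp' hu

theorem _root_.integrable_coord_mul_coord [P.HolderConjugate Q] {u v : Ω → Vec n}
    (hu : MemLp u P μ) (hv : MemLp v Q μ) (i j : Fin n) :
    Integrable (fun ω => u ω i * v ω j) μ := by
  refine (hu.integrable_inner_of_holderConjugate (memLp_coord_smul_single hv j i)).congr
    (ae_of_all _ fun ω => ?_)
  simp [inner_smul_right, EuclideanSpace.inner_single_right, mul_comm]

theorem continuous_coordCorrelation [IsProbabilityMeasure μ] (hT : IsDynamicalSystem μ T)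
    [P.HolderConjugate Q] (hP : P ≠ ∞) (hQ : Q ≠ ∞) {u v : Ω → Vec n} (hu : MemLp u P μ)
    (hv : MemLp v Q μ) (i j : Fin n) : Continuous (hT.coordCorrelation u v i j) := by
  refine (hT.continuous_correlation hP hQ hu (memLp_coord_smul_single hv j i)).congr fun x => ?_
  refine integral_congr_ae (ae_of_all _ fun ω => ?_)
  simp [inner_smul_right, EuclideanSpace.inner_single_right, mul_comm]

theorem lintegral_mul_comp_le [IsProbabilityMeasure μ] (hT : IsDynamicalSystem μ T)
    [P.HolderConjugate Q] {b : Ω → ℝ} {u : Ω → Vec n} (hu : MemLp u P μ) (hb : MemLp b Q μ)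
    (x : Vec n) :
    ∫⁻ ω, ‖b ω‖ₑ * ‖u (T x ω)‖ₑ ∂μ ≤ eLpNorm u P μ * eLpNorm b Q μ := by
  simp only [mul_comm ‖b _‖ₑ]
  refine (lintegral_enorm_mul_enorm_le (P := P) (Q := Q) (hT.memLp_comp hu x).1 hb.1).trans ?_
  rw [hT.eLpNorm_comp hu.1]

/-- Pair the realizations of `u` with ∇φ and integrate against the coordinate `v j`: in the shift
variable the correlation inherits the divergence constraint. -/
theorem integral_sum_coordCorrelation_eq_zero [IsProbabilityMeasure μ]
    (hT : IsDynamicalSystem μ T) [P.HolderConjugate Q] {u v : Ω → Vec n} (hu : MemLp u P μ)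
    (hv : MemLp v Q μ) (hsol : ∀ᵐ ω ∂μ, Annihilates (gradTests n) fun x => u (T x ω))
    {φ : Vec n → ℝ} (hφ : IsTestFunction φ) (j : Fin n) :
    ∫ x, ∑ i, hT.coordCorrelation u v i j x * partialDeriv i φ x = 0 := by
  obtain ⟨h1, h2⟩ := isTestFamily_gradTests n _ ⟨φ, hφ, rfl⟩
  have h3 := hT.integral_mul_pairing hu.1 h1 h2 (memLp_coord hv j).1
    (C := eLpNorm u P μ * eLpNorm (fun ω => v ω j) Q μ)
    (ENNReal.mul_lt_top hu.2 (memLp_coord hv j).2).ne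
    (hT.lintegral_mul_comp_le hu (memLp_coord hv j))
  have h4 : ∫ ω, v ω j * pairing T (gradField φ) u ω ∂μ = 0 := by
    refine integral_eq_zero_of_ae ?_
    filter_upwards [hsol] with ω hω
    have : pairing T (gradField φ) u ω = 0 := hω.2 _ ⟨φ, hφ, rfl⟩
    simp [this]
  rw [← h4, h3]
  refine integral_congr_ae (ae_of_all _ fun x => ?_)
  simp only [inner_gradField, coordCorrelation, Finset.mul_sum]
  rw [integral_finsetSum]
  · refine Finset.sum_congr rfl fun i _ => ?_
    rw [← integral_mul_const]
    refine integral_congr_ae (ae_of_all _ fun ω => ?_)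
    ring
  · intro i _
    refine ((integrable_coord_mul_coord (hT.memLp_comp hu x) hv i j).mul_const
      (partialDeriv i φ x)).congr (ae_of_all _ fun ω => ?_)
    ring

/-- Here the shift must be moved from `u` to `v`, which replaces x by -x; hence the reflected test
function ψ. -/
theorem integral_coordCorrelation_curl_eq_zero [IsProbabilityMeasure μ]
    (hT : IsDynamicalSystem μ T) [P.HolderConjugate Q] {u v : Ω → Vec n} (hu : MemLp u P μ)
    (hv : MemLp v Q μ) (hpot : ∀ᵐ ω ∂μ, Annihilates (curlTests n) fun x => v (T x ω))
    {φ : Vec n → ℝ} (hφ : IsTestFunction φ) (i j k : Fin n) :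
    ∫ x, (hT.coordCorrelation u v i j x * partialDeriv k φ x -
      hT.coordCorrelation u v i k x * partialDeriv j φ x) = 0 := by
  have : Q.HolderConjugate P := ENNReal.HolderConjugate.symm
  set ψ : Vec n → ℝ := fun x => φ (-x) with hψdef
  have hψ : IsTestFunction ψ := hφ.comp_neg
  have hmem : curlField j k ψ ∈ curlTests n := ⟨j, k, ψ, hψ, rfl⟩
  obtain ⟨h1, h2⟩ := isTestFamily_curlTests n _ hmem
  have h3 := hT.integral_mul_pairing hv.1 h1 h2 (memLp_coord hu i).1
    (C := eLpNorm v Q μ * eLpNorm (fun ω => u ω i) P μ)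
    (ENNReal.mul_lt_top hv.2 (memLp_coord hu i).2).ne
    (hT.lintegral_mul_comp_le hv (memLp_coord hu i))
  have h4 : ∫ ω, u ω i * pairing T (curlField j k ψ) v ω ∂μ = 0 := by
    refine integral_eq_zero_of_ae ?_
    filter_upwards [hpot] with ω hω
    have : pairing T (curlField j k ψ) v ω = 0 := hω.2 _ hmem
    simp [this]
  rw [h3] at h4
  have hc : ∀ (l : Fin n) (x : Vec n),
      ∫ ω, u ω i * v (T x ω) l ∂μ = hT.coordCorrelation u v i l (-x) := by
    intro l x
    rw [coordCorrelation, ← hT.integral_comp x fun ω => u (T (-x) ω) i * v ω l]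
    simp only [hT.neg_apply_apply]
  have h5 : ∀ x, ∫ ω, u ω i * (inner ℝ (v (T x ω)) (curlField j k ψ x) : ℝ) ∂μ =
      -(hT.coordCorrelation u v i j (-x) * partialDeriv k φ (-x) -
        hT.coordCorrelation u v i k (-x) * partialDeriv j φ (-x)) := by
    intro x
    have e : ∀ ω, u ω i * (inner ℝ (v (T x ω)) (curlField j k ψ x) : ℝ) =
        u ω i * v (T x ω) j * partialDeriv k ψ x - u ω i * v (T x ω) k * partialDeriv j ψ x := by
      intro ω
      rw [inner_curlField]
      ring
    simp only [e]
    rw [integral_sub ((integrable_coord_mul_coord hu (hT.memLp_comp hv x) i j).mul_const _)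
      ((integrable_coord_mul_coord hu (hT.memLp_comp hv x) i k).mul_const _),
      integral_mul_const, integral_mul_const, hc, hc, hψdef, partialDeriv_comp_neg,
      partialDeriv_comp_neg]
    ring
  simp only [h5, integral_neg] at h4
  rw [← integral_neg_eq_self]
  linarith

/-- The div-curl identity: weakly, ∂_k Σ C_ii = Σ ∂_i C_ik by the curl constraint, and the right
side vanishes by the divergence constraint. A continuous function with zero distributional gradient
is constant. -/
theorem integral_inner_comp_eq [IsProbabilityMeasure μ]
    (hT : IsDynamicalSystem μ T) [P.HolderConjugate Q] (hP : P ≠ ∞) (hQ : Q ≠ ∞)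
    {u v : Ω → Vec n} (hu : MemLp u P μ) (hv : MemLp v Q μ)
    (hsol : ∀ᵐ ω ∂μ, Annihilates (gradTests n) fun x => u (T x ω))
    (hpot : ∀ᵐ ω ∂μ, Annihilates (curlTests n) fun x => v (T x ω)) (y : Vec n) :
    ∫ ω, (inner ℝ (u (T y ω)) (v ω) : ℝ) ∂μ = ∫ ω, (inner ℝ (u ω) (v ω) : ℝ) ∂μ := by
  have hc := fun i j => hT.continuous_coordCorrelation hP hQ hu hv i j
  have hsum : ∀ x, ∫ ω, (inner ℝ (u (T x ω)) (v ω) : ℝ) ∂μ =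
      ∑ i, hT.coordCorrelation u v i i x := by
    intro x
    simp only [coordCorrelation]
    rw [← integral_finsetSum _ fun i _ =>
      integrable_coord_mul_coord (hT.memLp_comp hu x) hv i i]
    simp [PiLp.inner_apply, mul_comm]
  have hint : ∀ φ, IsTestFunction φ → ∀ i j k,
      Integrable (fun x => hT.coordCorrelation u v i j x * partialDeriv k φ x) := fun φ hφ i j k =>
    ((hc i j).mul (hφ.continuous_partialDeriv k)).integrable_of_hasCompactSupport
      (hφ.hasCompactSupport_partialDeriv k).mul_left
  have h := eq_of_forall_integral_partialDeriv_eq_zero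
    (c := fun x => ∑ i, hT.coordCorrelation u v i i x)
    (continuous_finsetSum _ fun i _ => hc i i) (fun φ hφ k => ?_) y
  · rw [hsum, h, ← hsum]
    simp only [hT.zero_apply]
  · simp only [Finset.sum_mul]
    rw [← hT.integral_sum_coordCorrelation_eq_zero hu hv hsol hφ k,
      integral_finsetSum _ fun i _ => hint φ hφ i i k,
      integral_finsetSum _ fun i _ => hint φ hφ i k i]
    refine Finset.sum_congr rfl fun i _ => ?_
    have := hT.integral_coordCorrelation_curl_eq_zero hu hv hpot hφ i i k
    rw [integral_sub (hint φ hφ i i k) (hint φ hφ i k i)] at this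
    linarith

/-- Fields in the closed convex hull of an orbit contain an invariant field. -/
theorem exists_tendsto_convexHull_orbit [IsProbabilityMeasure μ] (hT : IsDynamicalSystem μ T)
    {p : ℝ} (hp : 1 < p) [Fact (1 ≤ ENNReal.ofReal p)] (A : Lp (Vec n) (ENNReal.ofReal p) μ) :
    ∃ (w : ℕ → Lp (Vec n) (ENNReal.ofReal p) μ) (m : Lp (Vec n) (ENNReal.ofReal p) μ),
      (∀ N, w N ∈ convexHull ℝ (Set.range fun x =>
        Lp.compMeasurePreservingₗᵢ ℝ (T x) (hT.measurePreserving x) A)) ∧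
      Filter.Tendsto w Filter.atTop (nhds m) ∧ ∀ y, ∀ᵐ ω ∂μ, m (T y ω) = m ω := by
  set K := fun x => (Lp.compMeasurePreservingₗᵢ ℝ (T x) (hT.measurePreserving x) :
    Lp (Vec n) (ENNReal.ofReal p) μ →ₗᵢ[ℝ] Lp (Vec n) (ENNReal.ofReal p) μ) with hK
  have hKc : ∀ x a, K x a =ᵐ[μ] fun ω => a (T x ω) := fun x a =>
    Lp.coeFn_compMeasurePreserving a (hT.measurePreserving x)
  set C := convexHull ℝ (Set.range fun x => K x A) with hC
  have hp0 : 0 < p := by linarith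
  have hbound : ∀ a ∈ C, ‖a‖ ^ p ≤ ‖A‖ ^ p := by
    intro a ha
    have h1 : C ⊆ Metric.closedBall 0 ‖A‖ := by
      refine convexHull_min ?_ (convex_closedBall _ _)
      rintro _ ⟨x, rfl⟩
      simp [(K x).norm_map]
    exact Real.rpow_le_rpow (norm_nonneg _) (mem_closedBall_zero_iff.1 (h1 ha)) hp0.le
  have hmaps : ∀ y, ∀ a ∈ C, K y a ∈ C := by
    intro y a ha
    have h1 : (K y).toLinearMap '' C = convexHull ℝ ((K y).toLinearMap '' _) :=
      (K y).toLinearMap.image_convexHull _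
    have h2 : K y a ∈ (K y).toLinearMap '' C := ⟨a, ha, rfl⟩
    rw [h1] at h2
    refine convexHull_mono ?_ h2
    rintro _ ⟨_, ⟨x, rfl⟩, rfl⟩
    refine ⟨x + y, ?_⟩
    refine Lp.ext ?_
    filter_upwards [hKc (x + y) A, hKc y (K x A),
      (hT.measurePreserving y).quasiMeasurePreserving.ae (hKc x A)] with ω h3 h4 h5
    simp only [LinearIsometry.coe_toLinearMap]
    rw [h3, h4, h5, hT.add_apply]
  have hΦ := isUniformlyConvexFunctional_Lp (n := n) (μ := μ) hp
  obtain ⟨w, hw, hcau, hmin⟩ := hΦ.exists_cauchySeq (fun a => by positivity)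
    (C := fun _ => C) (fun _ => convex_convexHull ℝ _) (fun _ _ _ => le_rfl)
    (fun _ => (Set.range_nonempty _).convexHull) hbound
  obtain ⟨m, hm⟩ := cauchySeq_tendsto_of_complete hcau
  refine ⟨w, m, hw, hm, fun y => ?_⟩
  have hlim : Filter.Tendsto (fun N => ‖K y (w N) - w N‖) Filter.atTop (nhds ‖K y m - m‖) :=
    ((((K y).continuous.tendsto m).comp hm).sub hm).norm
  -- The vectors w_N almost minimise the norm over the hull. K_y w_N has the same norm and lies in
  -- the hull, as does their midpoint, so uniform convexity forces K_y w_N - w_N to zero.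
  have hzero : ‖K y m - m‖ ≤ 0 := by
    refine le_of_forall_pos_le_add fun ε hε => ?_
    obtain ⟨δ, hδ, h⟩ := hΦ (‖A‖ ^ p) ε hε
    have e2 : ∀ᶠ N : ℕ in Filter.atTop, 1 / ((N : ℝ) + 1) < δ / 2 :=
      tendsto_one_div_add_atTop_nhds_zero_nat.eventually_lt_const (by linarith)
    rw [zero_add]
    refine le_of_tendsto hlim ?_
    filter_upwards [e2] with N hN
    have hKw := hmaps y _ (hw N)
    refine h _ _ (hbound _ hKw) (hbound _ (hw N)) ?_
    have := hmin N _ ((convex_convexHull ℝ _).half_smul_add_mem hKw (hw N))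
    simp only [(K y).norm_map]
    linarith
  have heq : K y m = m := sub_eq_zero.1 (norm_le_zero_iff.1 hzero)
  have := hKc y m
  rw [heq] at this
  exact this.mono fun ω hω => hω.symm

theorem ae_eq_zero_of_invariant (hE : IsErgodicSystem μ T) [IsProbabilityMeasure μ]
    {m : Ω → Vec n} (hm : Measurable m) (hmi : Integrable m μ) (h0 : ∫ ω, m ω ∂μ = 0)
    (hinv : ∀ y, ∀ᵐ ω ∂μ, m (T y ω) = m ω) : m =ᵐ[μ] 0 := by
  have h : ∀ i : Fin n, ∀ᵐ ω ∂μ, m ω i = 0 := by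
    intro i
    obtain ⟨a, ha⟩ := hE (fun ω => m ω i)
      ((EuclideanSpace.proj (𝕜 := ℝ) i : Vec n →L[ℝ] ℝ).measurable.comp hm)
      fun x => (hinv x).mono fun ω hω => by simp only [hω]
    have h1 : ∫ ω, m ω i ∂μ = (∫ ω, m ω ∂μ) i :=
      (EuclideanSpace.proj (𝕜 := ℝ) i : Vec n →L[ℝ] ℝ).integral_comp_comm hmi
    rw [h0, integral_congr_ae ha] at h1
    simp at h1
    filter_upwards [ha] with ω hω
    rw [hω, h1]
  filter_upwards [ae_all_iff.2 h] with ω hω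
  ext i
  exact hω i

/-- Orthogonality of solenoidal and potential fields, one of them with mean zero. -/
theorem integral_inner_eq_zero [IsProbabilityMeasure μ] (hT : IsDynamicalSystem μ T)
    (hE : IsErgodicSystem μ T) {p q : ℝ} (hpq : p.HolderConjugate q) {u v : Ω → Vec n}
    (hu : MemLp u (ENNReal.ofReal p) μ) (hv : MemLp v (ENNReal.ofReal q) μ)
    (hsol : ∀ᵐ ω ∂μ, Annihilates (gradTests n) fun x => u (T x ω))
    (hpot : ∀ᵐ ω ∂μ, Annihilates (curlTests n) fun x => v (T x ω))
    (hu0 : ∫ ω, u ω ∂μ = 0) : ∫ ω, (inner ℝ (u ω) (v ω) : ℝ) ∂μ = 0 := by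
  have hp1 : (1 : ℝ≥0∞) ≤ ENNReal.ofReal p := by
    rw [← ENNReal.ofReal_one]
    exact ENNReal.ofReal_le_ofReal hpq.lt.le
  have : Fact (1 ≤ ENNReal.ofReal p) := ⟨hp1⟩
  have : (ENNReal.ofReal p).HolderConjugate (ENNReal.ofReal q) := hpq.ennrealOfReal
  obtain ⟨w, m, hw, hm, hinv⟩ := hT.exists_tendsto_convexHull_orbit hpq.lt (hu.toLp u)
  set c := ∫ ω, (inner ℝ (u ω) (v ω) : ℝ) ∂μ with hc
  have hint : ∀ a : Lp (Vec n) (ENNReal.ofReal p) μ, Integrable a μ := fun a =>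
    (Lp.memLp a).integrable hp1
  have hinner : ∀ a : Lp (Vec n) (ENNReal.ofReal p) μ,
      Integrable (fun ω => (inner ℝ (a ω) (v ω) : ℝ)) μ := fun a =>
    (Lp.memLp a).integrable_inner_of_holderConjugate hv
  have hhull : ∀ N, ∫ ω, (inner ℝ (w N ω) (v ω) : ℝ) ∂μ = c ∧ ∫ ω, w N ω ∂μ = 0 := by
    intro N
    have hsub : convexHull ℝ (Set.range fun x =>
        Lp.compMeasurePreservingₗᵢ ℝ (T x) (hT.measurePreserving x) (hu.toLp u)) ⊆
        {a | ∫ ω, (inner ℝ (a ω) (v ω) : ℝ) ∂μ = c ∧ ∫ ω, a ω ∂μ = 0} := by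
      -- The pairing with v and the mean are constant along the orbit, and both are linear, hence
      -- constant on the hull.
      refine convexHull_min ?_ ?_
      · rintro _ ⟨x, rfl⟩
        have h1 : Lp.compMeasurePreservingₗᵢ ℝ (T x) (hT.measurePreserving x) (hu.toLp u)
            =ᵐ[μ] fun ω => u (T x ω) :=
          (Lp.coeFn_compMeasurePreserving _ (hT.measurePreserving x)).trans
            ((hT.measurePreserving x).quasiMeasurePreserving.ae_eq_comp hu.coeFn_toLp)
        constructor
        · rw [hc, ← hT.integral_inner_comp_eq (P := ENNReal.ofReal p) (Q := ENNReal.ofReal q)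
            (by simp) (by simp) hu hv hsol hpot x]
          refine integral_congr_ae ?_
          filter_upwards [h1] with ω hω
          rw [hω]
        · rw [integral_congr_ae h1, hT.integral_comp x u, hu0]
      · rintro a ⟨ha1, ha2⟩ b ⟨hb1, hb2⟩ s t hs ht hst
        have h1 : (s • a + t • b : Lp (Vec n) (ENNReal.ofReal p) μ) =ᵐ[μ]
            fun ω => s • a ω + t • b ω := by
          filter_upwards [Lp.coeFn_add (s • a) (t • b), Lp.coeFn_smul s a, Lp.coeFn_smul t b]
            with ω e1 e2 e3
          rw [e1, Pi.add_apply, e2, e3]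
          rfl
        constructor
        · have h2 : (fun ω => (inner ℝ ((s • a + t • b : Lp (Vec n) (ENNReal.ofReal p) μ) ω)
              (v ω) : ℝ)) =ᵐ[μ] fun ω => s * inner ℝ (a ω) (v ω) + t * inner ℝ (b ω) (v ω) := by
            filter_upwards [h1] with ω hω
            rw [hω, inner_add_left, real_inner_smul_left, real_inner_smul_left]
          rw [integral_congr_ae h2, integral_add ((hinner a).const_mul s) ((hinner b).const_mul t),
            integral_const_mul, integral_const_mul, ha1, hb1, ← add_mul, hst, one_mul]
        · rw [integral_congr_ae h1, integral_add ((hint a).fun_smul s) ((hint b).fun_smul t),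
            integral_smul, integral_smul, ha2, hb2, smul_zero, smul_zero, add_zero]
    exact hsub (hw N)
  have hlim := (Lp.tendsto_Lp_iff_tendsto_eLpNorm' w m).1 hm
  have hc' : ∫ ω, (inner ℝ (m ω) (v ω) : ℝ) ∂μ = c := by
    have := tendsto_integral_inner_of_tendsto_eLpNorm (fun k => Lp.memLp (w k)) (Lp.memLp m) hv hlim
    simp only [(hhull _).1] at this
    exact tendsto_nhds_unique this tendsto_const_nhds
  have hm0 : ∫ ω, m ω ∂μ = 0 := by
    have h1 : Filter.Tendsto (fun k => eLpNorm (⇑(w k) - ⇑m) 1 μ) Filter.atTop (nhds 0) :=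
      tendsto_of_tendsto_of_tendsto_of_le_of_le tendsto_const_nhds hlim (fun _ => bot_le)
        fun k => eLpNorm_le_eLpNorm_of_exponent_le hp1
          ((Lp.aestronglyMeasurable (w k)).sub (Lp.aestronglyMeasurable m))
    have := tendsto_integral_of_L1' m (hint m).1 (Filter.Eventually.of_forall fun k => hint (w k)) h1
    simp only [(hhull _).2] at this
    exact tendsto_nhds_unique this tendsto_const_nhds
  -- The limit is invariant with mean zero, so ergodicity annihilates it, and with it the common
  -- value c.
  have hzero := ae_eq_zero_of_invariant hE (Lp.stronglyMeasurable m).measurable (hint m) hm0 hinv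
  rw [← hc']
  refine integral_eq_zero_of_ae ?_
  filter_upwards [hzero] with ω hω
  simp [hω]

end IsDynamicalSystem

/-! ### Nonnegative convex integrands and the direct method -/

/-- A nonnegative, jointly measurable, convex, lower semicontinuous, coercive integrand. -/
structure IsConvexIntegrand {n : ℕ} {Ω : Type*} [MeasurableSpace Ω] (μ : Measure Ω) (p q : ℝ)
    (F : Vec n → Vec n → Ω → ℝ≥0∞) : Prop where
  measurable : Measurable (fun z : (Vec n × Vec n) × Ω => F z.1.1 z.1.2 z.2)
  convex : ∀ᵐ ω ∂μ, ∀ (x₁ y₁ x₂ y₂ : Vec n) (a b : ℝ), 0 < a → 0 < b → a + b = 1 →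
    F (a • x₁ + b • x₂) (a • y₁ + b • y₂) ω ≤
      ENNReal.ofReal a * F x₁ y₁ ω + ENNReal.ofReal b * F x₂ y₂ ω
  lsc : ∀ᵐ ω ∂μ, LowerSemicontinuous fun z : Vec n × Vec n => F z.1 z.2 ω
  coercive : ∃ c > 0, ∀ᵐ ω ∂μ, ∀ x y : Vec n, ENNReal.ofReal (c * (‖x‖ ^ p + ‖y‖ ^ q)) ≤ F x y ω

/-- Up to an error of size `δ` in `L¹`, the realizations of `u` annihilate `𝒯`. -/
def ApproxAnnihilates {n : ℕ} {Ω : Type*} [MeasurableSpace Ω] (μ : Measure Ω) (T : Vec n → Ω → Ω)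
    (𝒯 : Set (Vec n → Vec n)) (δ : ℝ) (u : Ω → Vec n) : Prop :=
  ∃ e : Ω → Vec n, Integrable e μ ∧ eLpNorm e 1 μ ≤ ENNReal.ofReal δ ∧
    ∀ᵐ ω ∂μ, Annihilates 𝒯 fun x => u (T x ω) - e (T x ω)

section DirectMethod

variable {n : ℕ} {Ω : Type*} [MeasurableSpace Ω] {μ : Measure Ω} {T : Vec n → Ω → Ω} {p q : ℝ}
  {F : Vec n → Vec n → Ω → ℝ≥0∞} {𝒯 : Set (Vec n → Vec n)}

theorem ApproxAnnihilates.congr [SFinite μ] (hT : IsDynamicalSystem μ T) {δ : ℝ} {u w : Ω → Vec n}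
    (h : ApproxAnnihilates μ T 𝒯 δ u) (huw : u =ᵐ[μ] w) : ApproxAnnihilates μ T 𝒯 δ w := by
  obtain ⟨e, he, heδ, hann⟩ := h
  refine ⟨e, he, heδ, ?_⟩
  refine hT.ae_annihilates_congr (u := fun ω => u ω - e ω) (w := fun ω => w ω - e ω) ?_ hann
  filter_upwards [huw] with ω hω
  rw [hω]

theorem ApproxAnnihilates.mono {δ δ' : ℝ} (hδ : δ ≤ δ') {u : Ω → Vec n}
    (h : ApproxAnnihilates μ T 𝒯 δ u) : ApproxAnnihilates μ T 𝒯 δ' u := by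
  obtain ⟨e, he, heδ, hann⟩ := h
  exact ⟨e, he, heδ.trans (ENNReal.ofReal_le_ofReal hδ), hann⟩

theorem approxAnnihilates_of_ae {δ : ℝ} {u : Ω → Vec n}
    (h : ∀ᵐ ω ∂μ, Annihilates 𝒯 fun x => u (T x ω)) : ApproxAnnihilates μ T 𝒯 δ u :=
  ⟨fun _ => 0, integrable_zero _ _ _, by simp, by simpa using h⟩

/-- The error fields combine with the same weights, so δ does not grow; this is the convexity that
the direct method requires. -/
theorem ApproxAnnihilates.combo (h𝒯 : IsTestFamily 𝒯) {δ a b : ℝ} {u w : Ω → Vec n}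
    (hu : ApproxAnnihilates μ T 𝒯 δ u) (hw : ApproxAnnihilates μ T 𝒯 δ w) (ha : 0 ≤ a) (hb : 0 ≤ b)
    (hab : a + b = 1) : ApproxAnnihilates μ T 𝒯 δ (fun ω => a • u ω + b • w ω) := by
  obtain ⟨e, he, heδ, hann⟩ := hu
  obtain ⟨e', he', heδ', hann'⟩ := hw
  refine ⟨fun ω => a • e ω + b • e' ω, (he.fun_smul a).add (he'.fun_smul b), ?_, ?_⟩
  · calc eLpNorm (fun ω => a • e ω + b • e' ω) 1 μ
        ≤ eLpNorm (fun ω => a • e ω) 1 μ + eLpNorm (fun ω => b • e' ω) 1 μ :=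
          eLpNorm_add_le (he.fun_smul a).1 (he'.fun_smul b).1 le_rfl
      _ = ENNReal.ofReal a * eLpNorm e 1 μ + ENNReal.ofReal b * eLpNorm e' 1 μ := by
          have h1 := eLpNorm_const_smul a e 1 μ
          have h2 := eLpNorm_const_smul b e' 1 μ
          rw [Real.enorm_of_nonneg ha] at h1
          rw [Real.enorm_of_nonneg hb] at h2
          rw [← h1, ← h2]
          rfl
      _ ≤ ENNReal.ofReal a * ENNReal.ofReal δ + ENNReal.ofReal b * ENNReal.ofReal δ := by gcongr
      _ = ENNReal.ofReal δ := by
          rw [← add_mul, ← ENNReal.ofReal_add ha hb, hab, ENNReal.ofReal_one, one_mul]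
  · filter_upwards [hann, hann'] with ω h1 h2
    convert (h1.smul a).add h𝒯 (h2.smul b) using 2 with x
    module

theorem ae_annihilates_of_tendsto_approx [IsProbabilityMeasure μ] (hT : IsDynamicalSystem μ T)
    (h𝒯 : IsTestFamily 𝒯) {P : ℝ≥0∞} (hP : 1 ≤ P) {u : Ω → Vec n} (hu : MemLp u P μ)
    {w : ℕ → Ω → Vec n} (hw : ∀ k, MemLp (w k) P μ) {δ : ℕ → ℝ}
    (hδ : Filter.Tendsto δ Filter.atTop (nhds 0))
    (hwa : ∀ k, ApproxAnnihilates μ T 𝒯 (δ k) (w k))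
    (hlim : Filter.Tendsto (fun k => eLpNorm (w k - u) P μ) Filter.atTop (nhds 0)) :
    ∀ᵐ ω ∂μ, Annihilates 𝒯 fun x => u (T x ω) := by
  choose e he heδ hann using hwa
  have hwi : ∀ k, Integrable (w k) μ := fun k => (hw k).integrable hP
  have hui := hu.integrable hP
  refine hT.ae_annihilates_of_tendsto h𝒯 hui (w := fun k ω => w k ω - e k ω)
    (fun k => (hwi k).sub (he k)) hann ?_
  have hδ' : Filter.Tendsto (fun k => ENNReal.ofReal (δ k)) Filter.atTop (nhds 0) := by
    simpa using ENNReal.tendsto_ofReal hδ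
  have hsum := hlim.add hδ'
  rw [add_zero] at hsum
  refine tendsto_of_tendsto_of_tendsto_of_le_of_le tendsto_const_nhds hsum (fun _ => bot_le)
    fun k => ?_
  have : (fun ω => w k ω - e k ω - u ω) = (w k - u) - e k := by
    ext1 ω
    simp only [Pi.sub_apply]
    abel
  rw [this]
  refine (eLpNorm_sub_le ((hwi k).sub hui).1 (he k).1 le_rfl).trans ?_
  exact add_le_add (eLpNorm_le_eLpNorm_of_exponent_le hP ((hwi k).sub hui).1) (heδ k)

theorem IsConvexIntegrand.aemeasurable (hF : IsConvexIntegrand μ p q F) {U V : Ω → Vec n}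
    (hU : AEStronglyMeasurable U μ) (hV : AEStronglyMeasurable V μ) :
    AEMeasurable (fun ω => F (U ω) (V ω) ω) μ :=
  hF.measurable.comp_aemeasurable ((hU.aemeasurable.prodMk hV.aemeasurable).prodMk aemeasurable_id)

theorem IsConvexIntegrand.lintegral_combo_le (hF : IsConvexIntegrand μ p q F)
    {U V U' V' : Ω → Vec n} (hU : AEStronglyMeasurable U μ) (hV : AEStronglyMeasurable V μ)
    {a b : ℝ} (ha : 0 < a) (hb : 0 < b) (hab : a + b = 1) :
    ∫⁻ ω, F (a • U ω + b • U' ω) (a • V ω + b • V' ω) ω ∂μ ≤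
      ENNReal.ofReal a * ∫⁻ ω, F (U ω) (V ω) ω ∂μ +
        ENNReal.ofReal b * ∫⁻ ω, F (U' ω) (V' ω) ω ∂μ := by
  rw [← lintegral_const_mul' _ _ ENNReal.ofReal_ne_top,
    ← lintegral_const_mul' _ _ ENNReal.ofReal_ne_top,
    ← lintegral_add_left' ((hF.aemeasurable hU hV).const_mul _)]
  refine lintegral_mono_ae ?_
  filter_upwards [hF.convex] with ω hω
  exact hω _ _ _ _ a b ha hb hab

/-- Two successive subsequences converge almost everywhere; pointwise lower semicontinuity and
Fatou's lemma do the rest. -/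
theorem IsConvexIntegrand.lintegral_le_of_tendsto (hF : IsConvexIntegrand μ p q F) {P Q : ℝ≥0∞}
    (hP : P ≠ 0) (hQ : Q ≠ 0) {U V : Ω → Vec n} {W X : ℕ → Ω → Vec n}
    (hU : AEStronglyMeasurable U μ) (hV : AEStronglyMeasurable V μ)
    (hW : ∀ k, AEStronglyMeasurable (W k) μ) (hX : ∀ k, AEStronglyMeasurable (X k) μ)
    (hWU : Filter.Tendsto (fun k => eLpNorm (W k - U) P μ) Filter.atTop (nhds 0))
    (hXV : Filter.Tendsto (fun k => eLpNorm (X k - V) Q μ) Filter.atTop (nhds 0))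
    {m : ℕ → ℝ≥0∞} {M : ℝ≥0∞} (hm : Filter.Tendsto m Filter.atTop (nhds M))
    (hle : ∀ k, ∫⁻ ω, F (W k ω) (X k ω) ω ∂μ ≤ m k) :
    ∫⁻ ω, F (U ω) (V ω) ω ∂μ ≤ M := by
  obtain ⟨ns, hns, hWae⟩ :=
    (tendstoInMeasure_of_tendsto_eLpNorm hP hW hU hWU).exists_seq_tendsto_ae
  obtain ⟨ms, hms, hXae⟩ := (tendstoInMeasure_of_tendsto_eLpNorm hQ (fun k => hX (ns k)) hV
    (hXV.comp hns.tendsto_atTop)).exists_seq_tendsto_ae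
  set ks := ns ∘ ms with hks
  have hkt : Filter.Tendsto ks Filter.atTop Filter.atTop :=
    hns.tendsto_atTop.comp hms.tendsto_atTop
  calc ∫⁻ ω, F (U ω) (V ω) ω ∂μ
      ≤ ∫⁻ ω, Filter.liminf (fun k => F (W (ks k) ω) (X (ks k) ω) ω) Filter.atTop ∂μ := by
        refine lintegral_mono_ae ?_
        filter_upwards [hF.lsc, hWae, hXae] with ω h1 h2 h3
        have h4 : Filter.Tendsto (fun k => (W (ks k) ω, X (ks k) ω)) Filter.atTop
            (nhds (U ω, V ω)) := (h2.comp hms.tendsto_atTop).prodMk_nhds h3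
        refine (h1.le_liminf (U ω, V ω)).trans ?_
        exact Filter.liminf_le_liminf_of_le h4
    _ ≤ Filter.liminf (fun k => ∫⁻ ω, F (W (ks k) ω) (X (ks k) ω) ω ∂μ) Filter.atTop :=
        lintegral_liminf_le' fun k => hF.aemeasurable (hW _) (hX _)
    _ ≤ Filter.liminf (fun k => m (ks k)) Filter.atTop :=
        Filter.liminf_le_liminf (Filter.Eventually.of_forall fun k => hle _)
    _ = M := (hm.comp hkt).liminf_eq

/-- Direct method: approximate competitors with bounded energy produce an exact one. -/
theorem IsConvexIntegrand.exists_of_approx [IsProbabilityMeasure μ] (hT : IsDynamicalSystem μ T)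
    (hp : 1 < p) (hq : 1 < q) (hF : IsConvexIntegrand μ p q F) {ξ η : Vec n} {M : ℝ≥0∞}
    (hM : M ≠ ∞)
    (h : ∀ δ : ℝ, 0 < δ → ∃ U V : Ω → Vec n, MemLp U (ENNReal.ofReal p) μ ∧
      MemLp V (ENNReal.ofReal q) μ ∧ ApproxAnnihilates μ T (gradTests n) δ U ∧
      ApproxAnnihilates μ T (curlTests n) δ V ∧ ‖∫ ω, U ω ∂μ - ξ‖ ≤ δ ∧ ‖∫ ω, V ω ∂μ - η‖ ≤ δ ∧
      ∫⁻ ω, F (U ω) (V ω) ω ∂μ ≤ M + ENNReal.ofReal δ) :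
    ∃ U V : Ω → Vec n, MemLp U (ENNReal.ofReal p) μ ∧
      MemLp V (ENNReal.ofReal q) μ ∧ (∀ᵐ ω ∂μ, Annihilates (gradTests n) fun x => U (T x ω)) ∧
      (∀ᵐ ω ∂μ, Annihilates (curlTests n) fun x => V (T x ω)) ∧ ∫ ω, U ω ∂μ = ξ ∧
      ∫ ω, V ω ∂μ = η ∧ ∫⁻ ω, F (U ω) (V ω) ω ∂μ ≤ M := by
  have hp1 : (1 : ℝ≥0∞) ≤ ENNReal.ofReal p := by
    rw [← ENNReal.ofReal_one]
    exact ENNReal.ofReal_le_ofReal hp.le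
  have hq1 : (1 : ℝ≥0∞) ≤ ENNReal.ofReal q := by
    rw [← ENNReal.ofReal_one]
    exact ENNReal.ofReal_le_ofReal hq.le
  have : Fact (1 ≤ ENNReal.ofReal p) := ⟨hp1⟩
  have : Fact (1 ≤ ENNReal.ofReal q) := ⟨hq1⟩
  have combo : ∀ {r : ℝ≥0∞} (a b : ℝ) (x y : Lp (Vec n) r μ),
      (a • x + b • y : Lp (Vec n) r μ) =ᵐ[μ] fun ω => a • x ω + b • y ω := by
    intro r a b x y
    filter_upwards [Lp.coeFn_add (a • x) (b • y), Lp.coeFn_smul a x, Lp.coeFn_smul b y]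
      with ω e1 e2 e3
    rw [e1, Pi.add_apply, e2, e3]
    rfl
  have convAnn : ∀ {𝒯 : Set (Vec n → Vec n)} (_ : IsTestFamily 𝒯) (r : ℝ≥0∞) (δ : ℝ),
      Convex ℝ {x : Lp (Vec n) r μ | ApproxAnnihilates μ T 𝒯 δ x} := by
    intro 𝒯 h𝒯 r δ x hx y hy a b ha hb hab
    exact (ApproxAnnihilates.combo h𝒯 hx hy ha hb hab).congr hT (combo a b x y).symm
  have convMean : ∀ {r : ℝ≥0∞} (_ : 1 ≤ r) (δ : ℝ) (ζ : Vec n),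
      Convex ℝ {x : Lp (Vec n) r μ | ‖∫ ω, x ω ∂μ - ζ‖ ≤ δ} := by
    intro r hr δ ζ x hx y hy a b ha hb hab
    have hxi := (Lp.memLp x).integrable hr
    have hyi := (Lp.memLp y).integrable hr
    have h1 : ∫ ω, (a • x + b • y : Lp (Vec n) r μ) ω ∂μ - ζ =
        a • (∫ ω, x ω ∂μ - ζ) + b • (∫ ω, y ω ∂μ - ζ) := by
      rw [integral_congr_ae (combo a b x y), integral_add (hxi.fun_smul a) (hyi.fun_smul b),
        integral_smul, integral_smul]
      nth_rewrite 1 [← one_smul ℝ ζ]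
      rw [← hab]
      module
    have h2 := convex_closedBall (0 : Vec n) δ (mem_closedBall_zero_iff.2 hx)
      (mem_closedBall_zero_iff.2 hy) ha hb hab
    rw [← h1] at h2
    exact mem_closedBall_zero_iff.1 h2
  have convF : ∀ K : ℝ≥0∞, Convex ℝ {z : Lp (Vec n) (ENNReal.ofReal p) μ ×
      Lp (Vec n) (ENNReal.ofReal q) μ | ∫⁻ ω, F (z.1 ω) (z.2 ω) ω ∂μ ≤ K} := by
    intro K
    refine convex_iff_forall_pos.2 fun z hz z' hz' a b ha hb hab => ?_
    have h1 : ∫⁻ ω, F ((a • z + b • z').1 ω) ((a • z + b • z').2 ω) ω ∂μ =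
        ∫⁻ ω, F (a • z.1 ω + b • z'.1 ω) (a • z.2 ω + b • z'.2 ω) ω ∂μ := by
      refine lintegral_congr_ae ?_
      filter_upwards [combo a b z.1 z'.1, combo a b z.2 z'.2] with ω e1 e2
      simp only [Prod.fst_add, Prod.snd_add, Prod.smul_fst, Prod.smul_snd]
      rw [e1, e2]
    have h2 : ∫⁻ ω, F ((a • z + b • z').1 ω) ((a • z + b • z').2 ω) ω ∂μ ≤ K := by
      rw [h1]
      refine (hF.lintegral_combo_le (Lp.aestronglyMeasurable _) (Lp.aestronglyMeasurable _)
        ha hb hab).trans ?_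
      calc _ ≤ ENNReal.ofReal a * K + ENNReal.ofReal b * K :=
            add_le_add (mul_le_mul_right hz _) (mul_le_mul_right hz' _)
        _ = K := by rw [← add_mul, ← ENNReal.ofReal_add ha.le hb.le, hab, ENNReal.ofReal_one,
            one_mul]
    exact h2
  set δ : ℕ → ℝ := fun N => 1 / ((N : ℝ) + 1) with hδ
  have hδpos : ∀ N, 0 < δ N := fun N => by positivity
  have hδlim : Filter.Tendsto δ Filter.atTop (nhds 0) := tendsto_one_div_add_atTop_nhds_zero_nat
  have hδanti : Antitone δ := fun N N' hN => by
    have : (N : ℝ) ≤ N' := by exact_mod_cast hN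
    simp only [hδ]
    gcongr
  -- Every constraint, including the energy bound, is relaxed by δ N. The resulting sets are convex,
  -- decreasing and nonempty.
  let C : ℕ → Set (Lp (Vec n) (ENNReal.ofReal p) μ × Lp (Vec n) (ENNReal.ofReal q) μ) := fun N =>
    (({x : Lp (Vec n) (ENNReal.ofReal p) μ | ApproxAnnihilates μ T (gradTests n) (δ N) x} ∩
        {x : Lp (Vec n) (ENNReal.ofReal p) μ | ‖∫ ω, x ω ∂μ - ξ‖ ≤ δ N}) ×ˢ
      ({x : Lp (Vec n) (ENNReal.ofReal q) μ | ApproxAnnihilates μ T (curlTests n) (δ N) x} ∩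
        {x : Lp (Vec n) (ENNReal.ofReal q) μ | ‖∫ ω, x ω ∂μ - η‖ ≤ δ N})) ∩
      {z | ∫⁻ ω, F (z.1 ω) (z.2 ω) ω ∂μ ≤ M + ENNReal.ofReal (δ N)}
  have hCconv : ∀ N, Convex ℝ (C N) := fun N =>
    (((convAnn (isTestFamily_gradTests n) _ _).inter (convMean hp1 _ _)).prod
      ((convAnn (isTestFamily_curlTests n) _ _).inter (convMean hq1 _ _))).inter (convF _)
  have hCanti : Antitone C := by
    rintro N N' hN z ⟨⟨⟨h1, h2⟩, h3, h4⟩, h5⟩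
    have hle := hδanti hN
    exact ⟨⟨⟨h1.mono hle, h2.trans hle⟩, h3.mono hle, h4.trans hle⟩,
      le_trans h5 (add_le_add le_rfl (ENNReal.ofReal_le_ofReal hle))⟩
  have hCne : ∀ N, (C N).Nonempty := by
    intro N
    obtain ⟨U, V, hU, hV, h1, h2, h3, h4, h5⟩ := h (δ N) (hδpos N)
    refine ⟨(hU.toLp U, hV.toLp V), ⟨⟨h1.congr hT hU.coeFn_toLp.symm, ?_⟩,
      h2.congr hT hV.coeFn_toLp.symm, ?_⟩, ?_⟩
    · have := integral_congr_ae hU.coeFn_toLp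
      change ‖∫ ω, (hU.toLp U) ω ∂μ - ξ‖ ≤ δ N
      rwa [this]
    · have := integral_congr_ae hV.coeFn_toLp
      change ‖∫ ω, (hV.toLp V) ω ∂μ - η‖ ≤ δ N
      rwa [this]
    · refine le_trans (le_of_eq (lintegral_congr_ae ?_)) h5
      filter_upwards [hU.coeFn_toLp, hV.coeFn_toLp] with ω e1 e2
      rw [e1, e2]
  obtain ⟨c, hc, hcoer⟩ := hF.coercive
  -- The sum of powers of norms is minimised, not the energy: F need not be uniformly convex, so its
  -- integral enters only as a constraint. Coercivity bounds Φ on C 0.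
  let Φ : Lp (Vec n) (ENNReal.ofReal p) μ × Lp (Vec n) (ENNReal.ofReal q) μ → ℝ := fun z =>
    ‖z.1‖ ^ p + ‖z.2‖ ^ q
  have hΦ : IsUniformlyConvexFunctional Φ :=
    (isUniformlyConvexFunctional_Lp hp).prod (isUniformlyConvexFunctional_Lp hq)
      (fun _ => by positivity) (fun _ => by positivity)
      (two_mul_norm_midpoint_rpow_le hp) (two_mul_norm_midpoint_rpow_le hq)
  have hbound : ∀ z ∈ C 0, Φ z ≤ (M + ENNReal.ofReal (δ 0)).toReal / c := by
    rintro z ⟨-, hz⟩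
    rw [le_div_iff₀ hc, mul_comm]
    have i1 := MemLp_integrable_rpow hp (Lp.memLp z.1)
    have i2 := MemLp_integrable_rpow hq (Lp.memLp z.2)
    have h1 : c * Φ z = ∫ ω, c * (‖z.1 ω‖ ^ p + ‖z.2 ω‖ ^ q) ∂μ := by
      rw [integral_const_mul, integral_add i1 i2]
      simp only [Φ, Lp_norm_rpow_eq_integral hp, Lp_norm_rpow_eq_integral hq]
    refine (ENNReal.ofReal_le_iff_le_toReal (by simp [hM])).1 ?_
    have i3 : Integrable (fun ω => c * (‖z.1 ω‖ ^ p + ‖z.2 ω‖ ^ q)) μ := (i1.add i2).const_mul c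
    rw [h1, ofReal_integral_eq_lintegral_ofReal i3
      (ae_of_all _ fun ω => by positivity)]
    refine (lintegral_mono_ae ?_).trans hz
    filter_upwards [hcoer] with ω hω
    exact hω _ _
  obtain ⟨w, hw, hcau, -⟩ := hΦ.exists_cauchySeq (fun z => by positivity) hCconv hCanti hCne hbound
  obtain ⟨z, hz⟩ := cauchySeq_tendsto_of_complete hcau
  have hlim1 := (Lp.tendsto_Lp_iff_tendsto_eLpNorm' _ _).1 ((continuous_fst.tendsto z).comp hz)
  have hlim2 := (Lp.tendsto_Lp_iff_tendsto_eLpNorm' _ _).1 ((continuous_snd.tendsto z).comp hz)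
  have mean : ∀ {r : ℝ≥0∞} (_ : 1 ≤ r) (y : ℕ → Lp (Vec n) r μ) (x : Lp (Vec n) r μ) (ζ : Vec n),
      Filter.Tendsto (fun k => eLpNorm (⇑(y k) - ⇑x) r μ) Filter.atTop (nhds 0) →
      (∀ k, ‖∫ ω, y k ω ∂μ - ζ‖ ≤ δ k) → ∫ ω, x ω ∂μ = ζ := by
    intro r hr y x ζ hyx hy
    have h1 : Filter.Tendsto (fun k => eLpNorm (⇑(y k) - ⇑x) 1 μ) Filter.atTop (nhds 0) :=
      tendsto_of_tendsto_of_tendsto_of_le_of_le tendsto_const_nhds hyx (fun _ => bot_le)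
        fun k => eLpNorm_le_eLpNorm_of_exponent_le hr
          ((Lp.aestronglyMeasurable (y k)).sub (Lp.aestronglyMeasurable x))
    have h2 := tendsto_integral_of_L1' x (Lp.aestronglyMeasurable x)
      (Filter.Eventually.of_forall fun k => (Lp.memLp (y k)).integrable hr) h1
    have h3 : Filter.Tendsto (fun k => ∫ ω, y k ω ∂μ) Filter.atTop (nhds ζ) :=
      tendsto_iff_norm_sub_tendsto_zero.2
        (squeeze_zero (fun _ => norm_nonneg _) hy hδlim)
    exact tendsto_nhds_unique h2 h3
  refine ⟨z.1, z.2, Lp.memLp _, Lp.memLp _, ?_, ?_, ?_, ?_, ?_⟩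
  · exact ae_annihilates_of_tendsto_approx hT (isTestFamily_gradTests n) hp1 (Lp.memLp z.1)
      (fun k => Lp.memLp (w k).1) hδlim (fun k => (hw k).1.1.1) hlim1
  · exact ae_annihilates_of_tendsto_approx hT (isTestFamily_curlTests n) hq1 (Lp.memLp z.2)
      (fun k => Lp.memLp (w k).2) hδlim (fun k => (hw k).1.2.1) hlim2
  · exact mean hp1 (fun k => (w k).1) z.1 ξ hlim1 fun k => (hw k).1.1.2
  · exact mean hq1 (fun k => (w k).2) z.2 η hlim2 fun k => (hw k).1.2.2
  · have hm : Filter.Tendsto (fun k => M + ENNReal.ofReal (δ k)) Filter.atTop (nhds M) := by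
      have := (ENNReal.tendsto_ofReal hδlim).const_add M
      simpa using this
    exact hF.lintegral_le_of_tendsto (by positivity) (by positivity)
      (Lp.aestronglyMeasurable _) (Lp.aestronglyMeasurable _)
      (fun k => Lp.aestronglyMeasurable (w k).1) (fun k => Lp.aestronglyMeasurable (w k).2)
      hlim1 hlim2 hm fun k => (hw k).2

end DirectMethod

/-! ### Finite dimensional theory of maximal monotone operators -/

section Minty

variable {n : ℕ} {A : Vec n → Set (Vec n)} {g : Vec n → Vec n → EReal}

theorem isBounded_quadratic_sublevel {l : ℝ} (hl : 0 < l) (x : Vec n) (k m : ℝ) :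
    ∃ R : ℝ, ∀ z w : Vec n,
      1 / (2 * l) * ‖z - x‖ ^ 2 + l / 2 * ‖w‖ ^ 2 - inner ℝ x w + k ≤ m → ‖z‖ ≤ R ∧ ‖w‖ ≤ R := by
  set B := m - k + 1 / (2 * l) * ‖x‖ ^ 2 with hB
  refine ⟨max (‖x‖ + 2 * l * B + 1) (‖x‖ / l + 2 / l * B + 1), fun z w h => ?_⟩
  have hin : inner ℝ x w ≤ ‖x‖ * ‖w‖ := real_inner_le_norm x w
  have hsq : l / 2 * ‖w‖ ^ 2 - ‖x‖ * ‖w‖ =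
      l / 2 * (‖w‖ - ‖x‖ / l) ^ 2 - 1 / (2 * l) * ‖x‖ ^ 2 := by
    field_simp
    ring
  have h1 : 1 / (2 * l) * ‖z - x‖ ^ 2 + l / 2 * (‖w‖ - ‖x‖ / l) ^ 2 ≤ B := by linarith
  have h2 : 1 / (2 * l) * ‖z - x‖ ^ 2 ≤ B := by
    have : 0 ≤ l / 2 * (‖w‖ - ‖x‖ / l) ^ 2 := by positivity
    linarith
  have h3 : l / 2 * (‖w‖ - ‖x‖ / l) ^ 2 ≤ B := by
    have : 0 ≤ 1 / (2 * l) * ‖z - x‖ ^ 2 := by positivity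
    linarith
  have h4 : ‖z - x‖ ^ 2 ≤ 2 * l * B := by
    have := mul_le_mul_of_nonneg_left h2 (by positivity : 0 ≤ 2 * l)
    have e : 2 * l * (1 / (2 * l) * ‖z - x‖ ^ 2) = ‖z - x‖ ^ 2 := by field_simp
    linarith
  have h5 : (‖w‖ - ‖x‖ / l) ^ 2 ≤ 2 / l * B := by
    have := mul_le_mul_of_nonneg_left h3 (by positivity : 0 ≤ 2 / l)
    have e : 2 / l * (l / 2 * (‖w‖ - ‖x‖ / l) ^ 2) = (‖w‖ - ‖x‖ / l) ^ 2 := by field_simp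
    linarith
  constructor
  · refine le_trans ?_ (le_max_left _ _)
    have := norm_le_norm_add_norm_sub' z x
    nlinarith [sq_nonneg (‖z - x‖ - 1), norm_nonneg (z - x)]
  · refine le_trans ?_ (le_max_right _ _)
    nlinarith [sq_nonneg (‖w‖ - ‖x‖ / l - 1)]

theorem IsMaximalMonotoneOp.exists_mem (hA : IsMaximalMonotoneOp A) : ∃ x y, y ∈ A x := by
  by_contra! h
  exact h 0 0 (hA.2 0 0 fun x₀ y₀ h₀ => absurd h₀ (h x₀ y₀))

theorem nonneg_of_forall_small {a b : ℝ}
    (h : ∀ t : ℝ, 0 < t → t < 1 → 0 ≤ t * a + t ^ 2 * b) : 0 ≤ a := by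
  by_contra! ha
  have hb : 0 < |b| + 1 - a := by linarith [abs_nonneg b]
  set t := -a / (2 * (|b| + 1 - a)) with ht
  have ht0 : 0 < t := by
    rw [ht]
    exact div_pos (by linarith) (by linarith)
  have ht1 : t < 1 := by
    rw [ht, div_lt_one (by linarith)]
    linarith [abs_nonneg b]
  have h1 := h t ht0 ht1
  have h2 : 0 ≤ a + t * b := by
    have : t * a + t ^ 2 * b = t * (a + t * b) := by ring
    rw [this] at h1
    exact nonneg_of_mul_nonneg_right h1 ht0
  have h3 : t * b ≤ t * (|b| + 1 - a) := mul_le_mul_of_nonneg_left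
    (by linarith [le_abs_self b]) ht0.le
  have h4 : t * (|b| + 1 - a) = -a / 2 := by
    rw [ht]
    field_simp
  linarith

/-- The quadratic term is chosen so that adding ⟨z, w⟩ to it gives ‖z + l w - x‖² / (2l). As g
dominates the duality product, the total vanishes exactly at a solution of w ∈ A z, z + l w = x.
Bounded sublevels and lower semicontinuity give a minimiser. -/
theorem exists_isMin_add_quadratic (hA : IsMaximalMonotoneOp A) (hlsc : IsLscFun g)
    (hrep : ∀ x y, y ∈ A x ↔ g x y = ((inner ℝ x y : ℝ) : EReal)) {k : ℝ}
    (hk : ∀ x y, (k : EReal) ≤ g x y) {l : ℝ} (hl : 0 < l) (x : Vec n) :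
    ∃ z₀ w₀ : Vec n, ∃ r : ℝ, g z₀ w₀ = r ∧ ∀ (z w : Vec n) (s : ℝ), g z w ≤ s →
      r + (1 / (2 * l) * ‖z₀ - x‖ ^ 2 + l / 2 * ‖w₀‖ ^ 2 - inner ℝ x w₀) ≤
        s + (1 / (2 * l) * ‖z - x‖ ^ 2 + l / 2 * ‖w‖ ^ 2 - inner ℝ x w) := by
  let quad : Vec n × Vec n → ℝ := fun z =>
    1 / (2 * l) * ‖z.1 - x‖ ^ 2 + l / 2 * ‖z.2‖ ^ 2 - inner ℝ x z.2
  have hquad : Continuous quad := by fun_prop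
  let h : Vec n × Vec n → EReal := fun z => g z.1 z.2 + (quad z : EReal)
  have hh : LowerSemicontinuous h := by
    refine LowerSemicontinuous.add' hlsc
      (continuous_coe_real_ereal.comp hquad).lowerSemicontinuous fun z => ?_
    exact EReal.continuousAt_add (Or.inr (EReal.coe_ne_bot _)) (Or.inr (EReal.coe_ne_top _))
  obtain ⟨a, b, hab⟩ := hA.exists_mem
  have hgab := (hrep a b).1 hab
  set m : ℝ := inner ℝ a b + quad (a, b) with hm
  have hhab : h (a, b) = (m : EReal) := by
    simp only [h, hgab, hm, EReal.coe_add]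
  obtain ⟨R, hR⟩ := isBounded_quadratic_sublevel hl x k m
  have hball : ∀ z : Vec n × Vec n, h z ≤ m → z ∈ Metric.closedBall (0 : Vec n × Vec n) R := by
    intro z hz
    have h1 : ((k + quad z : ℝ) : EReal) ≤ m := by
      rw [EReal.coe_add]
      exact (add_le_add (hk z.1 z.2) le_rfl).trans hz
    have h2 : k + quad z ≤ m := EReal.coe_le_coe_iff.1 h1
    obtain ⟨h3, h4⟩ := hR z.1 z.2 (by simp only [quad] at h2; linarith)
    rw [mem_closedBall_zero_iff, Prod.norm_def]
    exact max_le h3 h4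
  obtain ⟨z₀, -, hmin⟩ := LowerSemicontinuousOn.exists_isMinOn ⟨(a, b), hball _ hhab.le⟩
    (isCompact_closedBall (0 : Vec n × Vec n) R) (hh.lowerSemicontinuousOn _)
  have hz₀m : h z₀ ≤ m := by
    rw [← hhab]
    exact hmin (hball _ hhab.le)
  have hglob : ∀ z, h z₀ ≤ h z := by
    intro z
    by_cases hz : h z ≤ m
    · exact hmin (hball z hz)
    · exact hz₀m.trans (not_le.1 hz).le
  have hbot : g z₀.1 z₀.2 ≠ ⊥ := fun e => by
    have := hk z₀.1 z₀.2
    rw [e, le_bot_iff] at this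
    exact EReal.coe_ne_bot _ this
  have htop : g z₀.1 z₀.2 ≠ ⊤ := fun e => by
    have h1 : h z₀ = ⊤ := by
      simp only [h, e]
      exact EReal.top_add_coe _
    rw [h1, top_le_iff] at hz₀m
    exact EReal.coe_ne_top _ hz₀m
  refine ⟨z₀.1, z₀.2, (g z₀.1 z₀.2).toReal, (EReal.coe_toReal htop hbot).symm, fun z w s hs => ?_⟩
  have h1 : h z₀ ≤ ((s + quad (z, w) : ℝ) : EReal) := by
    rw [EReal.coe_add]
    exact (hglob (z, w)).trans (add_le_add hs le_rfl)
  have h2 : h z₀ = (((g z₀.1 z₀.2).toReal + quad z₀ : ℝ) : EReal) := by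
    rw [EReal.coe_add, EReal.coe_toReal htop hbot]
  rw [h2, EReal.coe_le_coe_iff] at h1
  exact h1

/-- Minty's theorem: `I + l A` is surjective for a maximal monotone operator represented by a
convex lower semicontinuous function. -/
theorem IsMaximalMonotoneOp.exists_add_smul_eq (hA : IsMaximalMonotoneOp A) (hconv : IsConvexFun g)
    (hlsc : IsLscFun g) (hinner : ∀ x y, ((inner ℝ x y : ℝ) : EReal) ≤ g x y)
    (hrep : ∀ x y, y ∈ A x ↔ g x y = ((inner ℝ x y : ℝ) : EReal)) {k : ℝ}
    (hk : ∀ x y, (k : EReal) ≤ g x y) {l : ℝ} (hl : 0 < l) (x : Vec n) :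
    ∃ z y, y ∈ A z ∧ z + l • y = x := by
  obtain ⟨P, W, r, hr, hmin⟩ := exists_isMin_add_quadratic hA hlsc hrep hk hl x
  have hPW : inner ℝ P W ≤ r := by
    have := hinner P W
    rwa [hr, EReal.coe_le_coe_iff] at this
  -- First-order optimality along the segment from the minimiser (P, W) to a point of the graph,
  -- where g is the duality product.
  have hfirst : ∀ z w, w ∈ A z →
      0 ≤ inner ℝ z w - r + (1 / l * inner ℝ (P - x) (z - P) + inner ℝ (l • W - x) (w - W)) := by
    intro z w hzw
    have hg := (hrep z w).1 hzw
    refine nonneg_of_forall_small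
      (b := 1 / (2 * l) * ‖z - P‖ ^ 2 + l / 2 * ‖w - W‖ ^ 2) fun t ht0 ht1 => ?_
    have hc := hconv P W z w (1 - t) t (by linarith) ht0 (by ring)
    rw [hr, hg, ← EReal.coe_mul, ← EReal.coe_mul, ← EReal.coe_add] at hc
    have h1 := hmin _ _ _ hc
    have e1 : (1 - t) • P + t • z - x = (P - x) + t • (z - P) := by module
    have e2 : (1 - t) • W + t • w = W + t • (w - W) := by module
    rw [e1, e2, norm_add_sq_real, norm_add_sq_real, inner_add_right, norm_smul, norm_smul, mul_pow,
      mul_pow, Real.norm_eq_abs, sq_abs, real_inner_smul_right, real_inner_smul_right,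
      real_inner_smul_right] at h1
    rw [inner_sub_left (l • W), real_inner_smul_left]
    have e3 : 1 / (2 * l) * (‖P - x‖ ^ 2 + 2 * (t * inner ℝ (P - x) (z - P)) +
        t ^ 2 * ‖z - P‖ ^ 2) = 1 / (2 * l) * ‖P - x‖ ^ 2 + t * (1 / l * inner ℝ (P - x) (z - P)) +
        t ^ 2 * (1 / (2 * l) * ‖z - P‖ ^ 2) := by
      field_simp
    rw [e3] at h1
    linarith
  -- Rearranged, optimality says that the pair (x - l W, (x - P)/l) is monotonically related to the
  -- graph, with a surplus given by the squared residual. Maximality puts this pair in the graph,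
  -- and testing it against itself makes the residual vanish.
  have hkey : ∀ z w, w ∈ A z → 1 / l * ‖P + l • W - x‖ ^ 2 ≤
      inner ℝ (w - (1 / l) • (x - P)) (z - (x - l • W)) := by
    intro z w hzw
    have h1 := hfirst z w hzw
    have e : inner ℝ (w - (1 / l) • (x - P)) (z - (x - l • W)) - 1 / l * ‖P + l • W - x‖ ^ 2 =
        inner ℝ z w - inner ℝ P W +
          (1 / l * inner ℝ (P - x) (z - P) + inner ℝ (l • W - x) (w - W)) := by
      rw [← real_inner_self_eq_norm_sq]
      simp only [inner_sub_left, inner_sub_right, inner_add_left, inner_add_right,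
        real_inner_smul_left, real_inner_smul_right]
      rw [real_inner_comm z w, real_inner_comm x w,
        real_inner_comm W w, real_inner_comm x P, real_inner_comm x W, real_inner_comm P W]
      field_simp
      ring
    linarith
  have hmem : (1 / l) • (x - P) ∈ A (x - l • W) := by
    refine hA.2 _ _ fun z w hzw => ?_
    have h1 := hkey z w hzw
    have h2 : 0 ≤ 1 / l * ‖P + l • W - x‖ ^ 2 := by positivity
    rw [← neg_sub w, ← neg_sub z, inner_neg_neg]
    exact h2.trans h1
  have h0 := hkey _ _ hmem
  rw [sub_self, inner_zero_left] at h0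
  have h1 : ‖P + l • W - x‖ ^ 2 ≤ 0 := by
    have hl' : 0 < 1 / l := by positivity
    by_contra! hlt
    exact absurd h0 (not_le.2 (mul_pos hl' hlt))
  have h2 : P + l • W - x = 0 := by
    have : ‖P + l • W - x‖ = 0 := by nlinarith [norm_nonneg (P + l • W - x)]
    exact norm_eq_zero.1 this
  have h3 : P + l • W = x := sub_eq_zero.1 h2
  have h4 : (1 / l) • (x - P) = W := by
    rw [← h3, add_sub_cancel_left, smul_smul, one_div, inv_mul_cancel₀ hl.ne', one_smul]
  have h5 : x - l • W = P := by rw [← h3, add_sub_cancel_right]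
  rw [h4, h5] at hmem
  exact ⟨P, W, hmem, h3⟩

/-! ### Coercive maximal monotone operators -/

/-- A maximal monotone operator such that `I + l A` is surjective for all `l > 0` and which is
bounded on bounded sets. -/
structure IsRegularMonotoneOp (A : Vec n → Set (Vec n)) : Prop where
  maximal : IsMaximalMonotoneOp A
  surj : ∀ l : ℝ, 0 < l → ∀ x, ∃ z y, y ∈ A z ∧ z + l • y = x
  bound : ∀ r : ℝ, ∃ B : ℝ, ∀ x y z, y ∈ A z → ‖x‖ ≤ r → inner ℝ z y ≤ inner ℝ x y → ‖y‖ ≤ B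

theorem exists_bound_of_rpow_le {c k q r₀ : ℝ} (hc : 0 < c) (hq : 1 < q) :
    ∃ B : ℝ, ∀ t, 0 ≤ t → c * t ^ q + k ≤ r₀ * t → t ≤ B := by
  refine ⟨max 1 (((|r₀| + |k|) / c) ^ (1 / (q - 1))), fun t ht h => ?_⟩
  rcases le_total t 1 with h1 | h1
  · exact h1.trans (le_max_left _ _)
  · refine le_trans ?_ (le_max_right _ _)
    have ht0 : 0 < t := by linarith
    have e : t ^ q = t ^ (q - 1) * t := by
      rw [← Real.rpow_add_one ht0.ne', sub_add_cancel]
    have h2 : c * t ^ (q - 1) * t ≤ (|r₀| + |k|) * t := by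
      have h3 := le_abs_self r₀
      have h4 := neg_abs_le k
      have h5 : |k| ≤ |k| * t := le_mul_of_one_le_right (abs_nonneg _) h1
      rw [e] at h
      nlinarith
    have h3 : t ^ (q - 1) ≤ (|r₀| + |k|) / c := by
      rw [le_div_iff₀ hc, mul_comm]
      exact le_of_mul_le_mul_right h2 ht0
    have h4 := Real.rpow_le_rpow (by positivity) h3 (by
      have : 0 < q - 1 := by linarith
      positivity : (0 : ℝ) ≤ 1 / (q - 1))
    rwa [← Real.rpow_mul ht, mul_one_div_cancel (by linarith), Real.rpow_one] at h4

/-- On the graph g equals ⟨z, y⟩, so c ‖y‖^q + k ≤ ⟨z, y⟩ ≤ r ‖y‖, and superlinear growth bounds y.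
-/
theorem isRegularMonotoneOp_of_coercive (hA : IsMaximalMonotoneOp A) (hconv : IsConvexFun g)
    (hlsc : IsLscFun g) (hinner : ∀ x y, ((inner ℝ x y : ℝ) : EReal) ≤ g x y)
    (hrep : ∀ x y, y ∈ A x ↔ g x y = ((inner ℝ x y : ℝ) : EReal)) {p q c k : ℝ} (hc : 0 < c)
    (hq : 1 < q) (hk : ∀ x y, ((c * (‖x‖ ^ p + ‖y‖ ^ q) + k : ℝ) : EReal) ≤ g x y) :
    IsRegularMonotoneOp A where
  maximal := hA
  surj l hl x := hA.exists_add_smul_eq hconv hlsc hinner hrep (k := k) (fun x y => by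
    refine le_trans ?_ (hk x y)
    rw [EReal.coe_le_coe_iff]
    have : 0 ≤ c * (‖x‖ ^ p + ‖y‖ ^ q) := by positivity
    linarith) hl x
  bound r := by
    obtain ⟨B, hB⟩ := exists_bound_of_rpow_le (k := k) (r₀ := r) hc hq
    refine ⟨B, fun x y z hy hx hle => hB _ (norm_nonneg y) ?_⟩
    have h1 := hk z y
    rw [(hrep z y).1 hy, EReal.coe_le_coe_iff] at h1
    have h2 : 0 ≤ ‖z‖ ^ p := by positivity
    have h3 := real_inner_le_norm x y
    have h4 : ‖x‖ * ‖y‖ ≤ r * ‖y‖ := by gcongr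
    nlinarith

namespace IsRegularMonotoneOp

/-- Solve z_k + y_k/(k + 1) = x. Then ⟨z_k, y_k⟩ ≤ ⟨x, y_k⟩, which is why `bound` has its particular
form: y_k stays bounded, z_k tends to x, and a limit point of y_k belongs to A x by maximality. -/
theorem exists_mem (hA : IsRegularMonotoneOp A) (x : Vec n) : ∃ y, y ∈ A x := by
  choose z y hy hzy using fun k : ℕ => hA.surj (1 / ((k : ℝ) + 1)) (by positivity) x
  obtain ⟨B, hB⟩ := hA.bound ‖x‖
  have hyB : ∀ k, y k ∈ Metric.closedBall (0 : Vec n) B := by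
    intro k
    rw [mem_closedBall_zero_iff]
    refine hB x (y k) (z k) (hy k) le_rfl ?_
    rw [← hzy k, inner_add_left, real_inner_smul_left]
    have : 0 ≤ 1 / ((k : ℝ) + 1) * inner ℝ (y k) (y k) :=
      mul_nonneg (by positivity) real_inner_self_nonneg
    linarith
  obtain ⟨y₀, -, φ, hφ, hlim⟩ := (isCompact_closedBall (0 : Vec n) B).tendsto_subseq hyB
  have hl : Filter.Tendsto (fun k => 1 / ((φ k : ℝ) + 1)) Filter.atTop (nhds 0) :=
    tendsto_one_div_add_atTop_nhds_zero_nat.comp hφ.tendsto_atTop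
  have hz : Filter.Tendsto (fun k => z (φ k)) Filter.atTop (nhds x) := by
    have h1 : Filter.Tendsto (fun k => x - (1 / ((φ k : ℝ) + 1)) • y (φ k)) Filter.atTop
        (nhds (x - (0 : ℝ) • y₀)) := tendsto_const_nhds.sub (hl.smul hlim)
    rw [zero_smul, sub_zero] at h1
    refine h1.congr fun k => ?_
    rw [sub_eq_iff_eq_add]
    exact (hzy (φ k)).symm
  refine ⟨y₀, hA.maximal.2 x y₀ fun x₀ y₁ h₁ => ?_⟩
  have h2 : Filter.Tendsto (fun k => (inner ℝ (y (φ k) - y₁) (z (φ k) - x₀) : ℝ)) Filter.atTop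
      (nhds (inner ℝ (y₀ - y₁) (x - x₀))) :=
    (hlim.sub_const y₁).inner (hz.sub_const x₀)
  exact ge_of_tendsto' h2 fun k => hA.maximal.1 _ _ (hy (φ k)) _ _ h₁

theorem exists_bound (hA : IsRegularMonotoneOp A) (r : ℝ) :
    ∃ B : ℝ, ∀ x y, ‖x‖ ≤ r → y ∈ A x → ‖y‖ ≤ B := by
  obtain ⟨B, hB⟩ := hA.bound r
  exact ⟨B, fun x y hx hy => hB x y x hy hx le_rfl⟩

/-- Membership in the graph can be tested against the values over a dense set. -/
theorem mem_of_dense (hA : IsRegularMonotoneOp A) {D : Set (Vec n)} (hD : Dense D) {z y : Vec n}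
    (h : ∀ x ∈ D, ∀ y' ∈ A x, 0 ≤ inner ℝ (y - y') (z - x)) : y ∈ A z := by
  refine hA.maximal.2 z y fun x₀ y₀ h₀ => ?_
  by_contra! hneg
  set κ : ℝ := -inner ℝ (y - y₀) (z - x₀) with hκ
  have hκ0 : 0 < κ := by linarith
  -- At the midpoint of x₀ and z, monotonicity against (x₀, y₀) and the hypothesis would give two
  -- nonnegative numbers with sum -κ/2. Local boundedness lets a nearby point of D replace the
  -- midpoint.
  set x₁ : Vec n := x₀ + (1 / 2 : ℝ) • (z - x₀) with hx₁
  obtain ⟨B, hB⟩ := hA.exists_bound (‖x₁‖ + 1)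
  set N : ℝ := ‖y‖ + ‖y₀‖ + 2 * |B| + 1 with hN
  have hN0 : 0 < N := by positivity
  obtain ⟨x', hx'D, hx'⟩ := hD.exists_dist_lt x₁ (show 0 < min 1 (κ / (2 * N)) by positivity)
  obtain ⟨y', hy'⟩ := hA.exists_mem x'
  set d : Vec n := x' - x₁ with hd
  have hdn : ‖d‖ < min 1 (κ / (2 * N)) := by
    rwa [hd, ← dist_eq_norm, dist_comm]
  have hd1 : ‖d‖ ≤ 1 := (hdn.trans_le (min_le_left _ _)).le
  have hd2 : ‖d‖ * N < κ / 2 := by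
    have := hdn.trans_le (min_le_right _ _)
    rw [lt_div_iff₀ (by positivity)] at this
    linarith
  have hx'eq : x' = x₁ + d := by rw [hd]; abel
  have hy'B : ‖y'‖ ≤ |B| := by
    refine (hB x' y' ?_ hy').trans (le_abs_self B)
    rw [hx'eq]
    exact (norm_add_le _ _).trans (by linarith)
  have h1 := hA.maximal.1 x' y' hy' x₀ y₀ h₀
  have h2 := h x' hx'D y' hy'
  have e1 : x' - x₀ = (1 / 2 : ℝ) • (z - x₀) + d := by rw [hx'eq, hx₁]; abel
  have e2 : z - x' = (1 / 2 : ℝ) • (z - x₀) - d := by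
    rw [hx'eq, hx₁]
    module
  rw [e1, inner_add_right, real_inner_smul_right] at h1
  rw [e2, inner_sub_right, real_inner_smul_right] at h2
  have b1 : inner ℝ (y' - y₀) d ≤ (|B| + ‖y₀‖) * ‖d‖ := by
    refine (real_inner_le_norm _ _).trans ?_
    gcongr
    exact (norm_sub_le _ _).trans (by linarith)
  have b2 : -inner ℝ (y - y') d ≤ (‖y‖ + |B|) * ‖d‖ := by
    refine (neg_le_abs _).trans ((abs_real_inner_le_norm _ _).trans ?_)
    gcongr
    exact (norm_sub_le _ _).trans (by linarith)
  have e3 : inner ℝ (y - y') (z - x₀) + inner ℝ (y' - y₀) (z - x₀) = -κ := by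
    rw [← inner_add_left, hκ, neg_neg]
    congr 1
    abel
  have hdn0 := norm_nonneg d
  nlinarith

/-- The resolvent `(I + A)⁻¹`. -/
theorem exists_resolvent (hA : IsRegularMonotoneOp A) (x : Vec n) : ∃ z, x - z ∈ A z := by
  obtain ⟨z, y, hy, hzy⟩ := hA.surj 1 one_pos x
  refine ⟨z, ?_⟩
  rwa [← hzy, one_smul, add_sub_cancel_left]

end IsRegularMonotoneOp

/-- With a = z - z' and b the difference of the chosen values, monotonicity reads ⟨a, b⟩ ≥ 0, that
is ‖a - b‖ ≤ ‖a + b‖. -/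
theorem IsMonotoneOp.reflected_resolvent_le (hA : IsMonotoneOp A) {x x' z z' : Vec n}
    (hz : x - z ∈ A z) (hz' : x' - z' ∈ A z') :
    ‖((2 : ℝ) • z - x) - ((2 : ℝ) • z' - x')‖ ≤ ‖x - x'‖ := by
  have h := hA z _ hz z' _ hz'
  set a := z - z' with ha
  set b := (x - z) - (x' - z') with hb
  have e1 : ((2 : ℝ) • z - x) - ((2 : ℝ) • z' - x') = a - b := by rw [ha, hb]; module
  have e2 : x - x' = a + b := by rw [ha, hb]; abel
  rw [e1, e2]
  refine (sq_le_sq₀ (norm_nonneg _) (norm_nonneg _)).1 ?_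
  rw [norm_sub_sq_real, norm_add_sq_real, real_inner_comm]
  linarith

theorem IsMonotoneOp.resolvent_unique (hA : IsMonotoneOp A) {x z z' : Vec n}
    (hz : x - z ∈ A z) (hz' : x - z' ∈ A z') : z = z' := by
  have h := hA.reflected_resolvent_le hz hz'
  rw [sub_self, norm_zero] at h
  have h1 := sub_eq_zero.1 (norm_le_zero_iff.1 h)
  have h2 : (2 : ℝ) • z = (2 : ℝ) • z' := sub_left_inj.1 h1
  exact smul_right_injective _ two_ne_zero h2

end Minty

/-! ### Measurability of resolvents -/

section Resolvent

variable {n : ℕ} {Ω : Type*} [MeasurableSpace Ω] {α : Vec n → Ω → Set (Vec n)}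

theorem measurable_of_measurable_norm_sub {j : Ω → Vec n}
    (h : ∀ w : Vec n, Measurable fun ω => ‖j ω - w‖) : Measurable j := by
  have hcoord : ∀ i, Measurable fun ω => j ω i := by
    intro i
    have h1 : (fun ω => j ω i) =
        fun ω => (‖j ω - 0‖ ^ 2 - ‖j ω - EuclideanSpace.single i (1 : ℝ)‖ ^ 2 + 1) / 2 := by
      funext ω
      rw [norm_sub_sq_real (j ω) (EuclideanSpace.single i 1), EuclideanSpace.inner_single_right]
      simp only [sub_zero, PiLp.norm_single, norm_one, conj_trivial, one_mul]
      ring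
    rw [h1]
    exact ((((h 0).pow_const 2).sub ((h _).pow_const 2)).add_const 1).div_const 2
  have h2 : Measurable fun ω => (WithLp.toLp 2 (fun i => j ω i) : Vec n) :=
    (PiLp.continuous_toLp 2 _).measurable.comp (measurable_pi_iff.2 hcoord)
  exact h2

/-- Moving the exact resolvent slightly costs at most ‖z₀ - z‖ K in each of the finitely many tests,
since the values over ξ 0, …, ξ N are bounded. -/
theorem IsRegularMonotoneOp.exists_dense_approx {A : Vec n → Set (Vec n)}
    (hA : IsRegularMonotoneOp A) {x z₀ : Vec n} (hz₀ : x - z₀ ∈ A z₀) (ξ : ℕ → Vec n)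
    {Q : Set (Vec n)} (hQ : ∀ ε > 0, ∃ z ∈ Q, dist z₀ z < ε) (N : ℕ) :
    ∃ z ∈ Q, ∀ i ≤ N, ∀ y' ∈ A (ξ i), -(1 / ((N : ℝ) + 1)) ≤ inner ℝ (x - z - y') (z - ξ i) := by
  set r := ∑ i ∈ Finset.range (N + 1), ‖ξ i‖ with hr
  obtain ⟨B, hB⟩ := hA.exists_bound r
  set K := 1 + ‖z₀‖ + r + ‖x - z₀‖ + |B| with hK
  have hr0 : 0 ≤ r := Finset.sum_nonneg fun _ _ => norm_nonneg _
  have hK0 : 0 < K := by positivity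
  obtain ⟨z, hzQ, hz⟩ := hQ (min 1 (1 / ((N : ℝ) + 1) / K)) (by positivity)
  refine ⟨z, hzQ, fun i hi y' hy' => ?_⟩
  have hξ : ‖ξ i‖ ≤ r := Finset.single_le_sum (f := fun i => ‖ξ i‖) (fun _ _ => norm_nonneg _)
    (Finset.mem_range.2 (Nat.lt_succ_of_le hi))
  have hy'B : ‖y'‖ ≤ |B| := (hB _ _ hξ hy').trans (le_abs_self B)
  rw [dist_eq_norm] at hz
  have hd1 : ‖z₀ - z‖ ≤ 1 := (hz.trans_le (min_le_left _ _)).le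
  have hd2 : ‖z₀ - z‖ * K ≤ 1 / ((N : ℝ) + 1) := by
    have := (hz.trans_le (min_le_right _ _)).le
    rwa [le_div_iff₀ hK0] at this
  have h0 := hA.maximal.1 z₀ _ hz₀ (ξ i) y' hy'
  have e : inner ℝ (x - z - y') (z - ξ i) = inner ℝ (x - z₀ - y') (z₀ - ξ i) +
      inner ℝ (z₀ - z) (z - ξ i) - inner ℝ (x - z₀ - y') (z₀ - z) := by
    have e1 : x - z - y' = (x - z₀ - y') + (z₀ - z) := by abel
    have e2 : z₀ - ξ i = (z - ξ i) + (z₀ - z) := by abel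
    rw [e1, e2, inner_add_left, inner_add_right]
    ring
  have b1 : -(‖z₀ - z‖ * (1 + ‖z₀‖ + r)) ≤ inner ℝ (z₀ - z) (z - ξ i) := by
    refine le_trans (neg_le_neg ?_) (neg_abs_le _)
    refine (abs_real_inner_le_norm _ _).trans ?_
    gcongr
    have e3 : z - ξ i = z₀ - (z₀ - z) - ξ i := by abel
    rw [e3]
    refine (norm_sub_le _ _).trans ?_
    have := norm_sub_le z₀ (z₀ - z)
    linarith
  have b2 : inner ℝ (x - z₀ - y') (z₀ - z) ≤ (‖x - z₀‖ + |B|) * ‖z₀ - z‖ := by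
    refine (real_inner_le_norm _ _).trans ?_
    gcongr
    exact (norm_sub_le _ _).trans (by linarith)
  rw [e]
  have : ‖z₀ - z‖ * K = ‖z₀ - z‖ * (1 + ‖z₀‖ + r) + (‖x - z₀‖ + |B|) * ‖z₀ - z‖ := by
    rw [hK]
    ring
  linarith

theorem IsRegularMonotoneOp.exists_limit {A : Vec n → Set (Vec n)}
    (hA : IsRegularMonotoneOp A) {x : Vec n} {ξ : ℕ → Vec n} (hξ : Dense (Set.range ξ))
    {Q : Set (Vec n)} (hQ : IsCompact Q)
    (h : ∀ N : ℕ, ∃ z ∈ Q, ∀ i ≤ N, ∀ y' ∈ A (ξ i),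
      -(1 / ((N : ℝ) + 1)) ≤ inner ℝ (x - z - y') (z - ξ i)) :
    ∃ z ∈ Q, x - z ∈ A z := by
  choose z hzQ hz using h
  obtain ⟨z₀, hz₀, φ, hφ, hlim⟩ := hQ.tendsto_subseq hzQ
  refine ⟨z₀, hz₀, hA.mem_of_dense hξ ?_⟩
  rintro _ ⟨i, rfl⟩ y' hy'
  have h1 : Filter.Tendsto (fun k => (inner ℝ (x - z (φ k) - y') (z (φ k) - ξ i) : ℝ))
      Filter.atTop (nhds (inner ℝ (x - z₀ - y') (z₀ - ξ i))) :=
    ((hlim.const_sub x).sub_const y').inner (hlim.sub_const (ξ i))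
  have h2 : Filter.Tendsto (fun k => -(1 / ((φ k : ℝ) + 1))) Filter.atTop (nhds 0) := by
    have := ((tendsto_one_div_add_atTop_nhds_zero_nat (𝕜 := ℝ)).comp hφ.tendsto_atTop).neg
    rwa [neg_zero] at this
  refine le_of_tendsto_of_tendsto h2 h1 ?_
  filter_upwards [Filter.eventually_ge_atTop i] with k hk
  exact hz (φ k) i (hk.trans (hφ.id_le k)) y' hy'

/-- By uniqueness, ‖J x ω - w‖ ≤ r says that the resolvent equation is solvable in a closed ball. By
density and compactness this is a countable family of conditions, each saying that α(ξ_i, ω) misses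
an open half-space, which is measurable by hypothesis. -/
theorem exists_measurable_resolvent
    (hα : ∀ (x : Vec n) (R : Set (Vec n)), IsOpen R → MeasurableSet {ω | (α x ω ∩ R).Nonempty})
    {Ω₀ : Set Ω} (hΩ₀ : MeasurableSet Ω₀)
    (hreg : ∀ ω ∈ Ω₀, IsRegularMonotoneOp fun x => α x ω) :
    ∃ J : Vec n → Ω → Vec n, (∀ x, Measurable (J x)) ∧
      (∀ ω ∈ Ω₀, ∀ x, x - J x ω ∈ α (J x ω) ω) ∧ (∀ ω ∉ Ω₀, ∀ x, J x ω = (1 / 2 : ℝ) • x) := by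
  classical
  let J : Vec n → Ω → Vec n := fun x ω =>
    if h : ω ∈ Ω₀ then ((hreg ω h).exists_resolvent x).choose else (1 / 2 : ℝ) • x
  have hJ : ∀ ω ∈ Ω₀, ∀ x, x - J x ω ∈ α (J x ω) ω := by
    intro ω hω x
    simp only [J, hω, dif_pos]
    exact ((hreg ω hω).exists_resolvent x).choose_spec
  have hJ' : ∀ ω ∉ Ω₀, ∀ x, J x ω = (1 / 2 : ℝ) • x := by
    intro ω hω x
    simp only [J, hω, dif_neg, not_false_eq_true]
  refine ⟨J, fun x => measurable_of_measurable_norm_sub fun w => ?_, hJ, hJ'⟩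
  refine measurable_of_Iic fun r => ?_
  obtain ⟨D, hDc, hD⟩ := exists_countable_dist_lt
    (Subtype.val : Metric.closedBall w r → Vec n)
  set Q : Set (Vec n) := Subtype.val '' D with hQ
  have hQc : Q.Countable := hDc.image _
  have hQsub : Q ⊆ Metric.closedBall w r := by
    rintro _ ⟨z, -, rfl⟩
    exact z.2
  set ξ := TopologicalSpace.denseSeq (Vec n) with hξ
  have hset : (fun ω => ‖J x ω - w‖) ⁻¹' Set.Iic r =
      (Ω₀ ∩ ⋂ N : ℕ, ⋃ z ∈ Q, ⋂ i ∈ Set.Iic N, {ω | (α (ξ i) ω ∩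
        {y' | inner ℝ (x - z - y') (z - ξ i) < -(1 / ((N : ℝ) + 1))}).Nonempty}ᶜ) ∪
      (Ω₀ᶜ ∩ {_ω | ‖(1 / 2 : ℝ) • x - w‖ ≤ r}) := by
    ext ω
    by_cases hω : ω ∈ Ω₀
    · have hcond : ∀ (N : ℕ) (z : Vec n) (i : ℕ), (ω ∈ {ω | (α (ξ i) ω ∩
          {y' | inner ℝ (x - z - y') (z - ξ i) < -(1 / ((N : ℝ) + 1))}).Nonempty}ᶜ) ↔
          ∀ y' ∈ α (ξ i) ω, -(1 / ((N : ℝ) + 1)) ≤ inner ℝ (x - z - y') (z - ξ i) := by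
        intro N z i
        constructor
        · intro h y' hy'
          by_contra! hlt
          exact h ⟨y', hy', hlt⟩
        · rintro h ⟨y', hy', hlt⟩
          exact absurd (h y' hy') (not_le.2 hlt)
      have hiff : ‖J x ω - w‖ ≤ r ↔ ∀ N : ℕ, ∃ z ∈ Q, ∀ i ≤ N, ∀ y' ∈ α (ξ i) ω,
          -(1 / ((N : ℝ) + 1)) ≤ inner ℝ (x - z - y') (z - ξ i) := by
        constructor
        · intro h N
          have hmem : J x ω ∈ Metric.closedBall w r := mem_closedBall_iff_norm.2 h
          refine (hreg ω hω).exists_dense_approx (hJ ω hω x) ξ (fun ε hε => ?_) N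
          obtain ⟨z, hzD, hz⟩ := hD ⟨_, hmem⟩ ε hε
          exact ⟨z, ⟨z, hzD, rfl⟩, hz⟩
        · intro h
          obtain ⟨z, hz, hzA⟩ := (hreg ω hω).exists_limit (TopologicalSpace.denseRange_denseSeq _)
            (isCompact_closedBall w r) fun N => by
              obtain ⟨z, hz, h'⟩ := h N
              exact ⟨z, hQsub hz, h'⟩
          rw [(hreg ω hω).maximal.1.resolvent_unique (hJ ω hω x) hzA]
          exact mem_closedBall_iff_norm.1 hz
      simp only [Set.mem_preimage, Set.mem_Iic, Set.mem_union, Set.mem_inter_iff, hω, true_and,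
        Set.mem_iInter, Set.mem_iUnion, hcond, Set.mem_compl_iff, not_true_eq_false, false_and,
        or_false, exists_prop]
      exact hiff
    · simp [hω, hJ' ω hω]
  rw [hset]
  refine (hΩ₀.inter (MeasurableSet.iInter fun N => MeasurableSet.biUnion hQc fun z _ =>
    MeasurableSet.biInter (Set.to_countable _) fun i _ => (hα _ _ ?_).compl)).union
    (hΩ₀.compl.inter (MeasurableSet.const _))
  exact isOpen_lt (by fun_prop) continuous_const

end Resolvent

/-! ### A fixed point argument in Hilbert space -/

/-- With s = U + V and C s = U - V, the equation for θ = 1 says exactly U ∈ Kᗮ and V ∈ K. That map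
is merely nonexpansive; damping by θ < 1 makes it a contraction. -/
theorem exists_fixedPoint_reflection {H : Type*} [NormedAddCommGroup H] [InnerProductSpace ℝ H]
    [CompleteSpace H] (K : Submodule ℝ H) [K.HasOrthogonalProjection] {C : H → H}
    (hC : ∀ a b, ‖C a - C b‖ ≤ ‖a - b‖) {θ : ℝ} (hθ0 : 0 < θ) (hθ1 : θ < 1) :
    ∃ s, s = -(θ • K.reflection (C s)) := by
  have hcon : ContractingWith ⟨θ, hθ0.le⟩ (fun s => -(θ • K.reflection (C s))) := by
    refine ⟨by exact_mod_cast hθ1, LipschitzWith.of_dist_le_mul fun a b => ?_⟩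
    rw [dist_neg_neg, dist_smul₀, LinearIsometryEquiv.dist_map, Real.norm_of_nonneg hθ0.le,
      dist_eq_norm, dist_eq_norm]
    exact mul_le_mul_of_nonneg_left (hC a b) hθ0.le
  exact ⟨_, hcon.fixedPoint_isFixedPt.symm⟩

/-- A fixed point of the damped reflection splits into fields almost in `Kᗮ` and `K`. -/
theorem norm_projection_le_of_fixedPoint {H : Type*} [NormedAddCommGroup H]
    [InnerProductSpace ℝ H] (K : Submodule ℝ H) [K.HasOrthogonalProjection]
    {U V : H} {θ : ℝ} (hθ0 : 0 < θ) (hθ1 : θ < 1)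
    (h : U + V = -(θ • K.reflection (U - V))) {κ : ℝ} (hκ : -κ ≤ inner ℝ U V) :
    inner ℝ U V ≤ 0 ∧ ‖K.starProjection U‖ ^ 2 ≤ (1 - θ) * κ ∧
      ‖V - K.starProjection V‖ ^ 2 ≤ (1 - θ) * κ := by
  set a := K.starProjection U with ha
  set a' := K.starProjection V with ha'
  have haK : a ∈ K := Submodule.starProjection_apply_mem K U
  have ha'K : a' ∈ K := Submodule.starProjection_apply_mem K V
  set b := U - a with hb
  set b' := V - a' with hb'
  have hbK : b ∈ Kᗮ := Submodule.sub_starProjection_mem_orthogonal U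
  have hb'K : b' ∈ Kᗮ := Submodule.sub_starProjection_mem_orthogonal V
  have hU : U = a + b := by rw [hb]; abel
  have hV : V = a' + b' := by rw [hb']; abel
  have href : K.reflection (U - V) = (a - a') - (b - b') := by
    rw [Submodule.reflection_apply, map_sub, ← ha, ← ha', hU, hV]
    module
  rw [href] at h
  -- Separating the components in K and in Kᗮ gives two independent equations, both equal to zero.
  have hsplit : (1 + θ) • a + (1 - θ) • a' = -((1 - θ) • b + (1 + θ) • b') := by
    have h1 : (a + b) + (a' + b') = -(θ • ((a - a') - (b - b'))) := by rw [← hU, ← hV]; exact h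
    have h2 : (1 + θ) • a + (1 - θ) • a' + ((1 - θ) • b + (1 + θ) • b') =
        ((a + b) + (a' + b')) + θ • ((a - a') - (b - b')) := by module
    rw [h1, neg_add_cancel] at h2
    exact eq_neg_of_add_eq_zero_left h2
  have hin : (1 + θ) • a + (1 - θ) • a' ∈ K := K.add_mem (K.smul_mem _ haK) (K.smul_mem _ ha'K)
  have hin' : (1 + θ) • a + (1 - θ) • a' ∈ Kᗮ := by
    rw [hsplit]
    exact Kᗮ.neg_mem (Kᗮ.add_mem (Kᗮ.smul_mem _ hbK) (Kᗮ.smul_mem _ hb'K))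
  have hz : (1 + θ) • a + (1 - θ) • a' = 0 :=
    inner_self_eq_zero.1 (Submodule.inner_right_of_mem_orthogonal (𝕜 := ℝ) hin hin')
  have hz' : (1 - θ) • b + (1 + θ) • b' = 0 := by
    rw [hz] at hsplit
    exact neg_eq_zero.1 hsplit.symm
  have hinner : inner ℝ U V = inner ℝ a a' + inner ℝ b b' := by
    rw [hU, hV, inner_add_left, inner_add_right, inner_add_right,
      Submodule.inner_right_of_mem_orthogonal haK hb'K,
      Submodule.inner_left_of_mem_orthogonal ha'K hbK]
    ring
  have h1 : (1 + θ) * ‖a‖ ^ 2 + (1 - θ) * inner ℝ a a' = 0 := by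
    have := congrArg (fun x => (inner ℝ a x : ℝ)) hz
    simpa [inner_add_right, real_inner_smul_right, real_inner_self_eq_norm_sq] using this
  have h2 : (1 - θ) * inner ℝ b b' + (1 + θ) * ‖b'‖ ^ 2 = 0 := by
    have := congrArg (fun x => (inner ℝ x b' : ℝ)) hz'
    simpa [inner_add_left, real_inner_smul_left, real_inner_self_eq_norm_sq] using this
  -- The two unwanted components are paid for by -(1 - θ) ⟨U, V⟩, which the lower bound on ⟨U, V⟩
  -- makes small as θ tends to 1.
  have h3 : (1 - θ) * inner ℝ U V = -((1 + θ) * (‖a‖ ^ 2 + ‖b'‖ ^ 2)) := by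
    rw [hinner]
    linarith
  have hθ' : 0 < 1 - θ := by linarith
  have ha0 : 0 ≤ ‖a‖ ^ 2 := by positivity
  have hb0 : 0 ≤ ‖b'‖ ^ 2 := by positivity
  refine ⟨?_, ?_, ?_⟩
  · by_contra! hpos
    have := mul_pos hθ' hpos
    nlinarith
  · nlinarith [mul_le_mul_of_nonneg_left hκ hθ'.le]
  · nlinarith [mul_le_mul_of_nonneg_left hκ hθ'.le]

/-! ### Existence of a pair of fields with finite energy -/

section Superposition

variable {n : ℕ} {Ω : Type*} [MeasurableSpace Ω] {μ : Measure Ω}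

/-- A measurable family of nonexpansive maps with square integrable value at the origin acts
nonexpansively on `L²`. -/
theorem exists_superposition {N : Vec n → Ω → Vec n}
    (hm : ∀ x, Measurable (N x)) (hne : ∀ ω x x', ‖N x ω - N x' ω‖ ≤ ‖x - x'‖)
    (h0 : MemLp (N 0) 2 μ) :
    ∃ C : Lp (Vec n) 2 μ → Lp (Vec n) 2 μ, (∀ a, C a =ᵐ[μ] fun ω => N (a ω) ω) ∧
      ∀ a b, ‖C a - C b‖ ≤ ‖a - b‖ := by
  have hjoint : Measurable (Function.uncurry N) := by
    refine measurable_uncurry_of_continuous_of_measurable (fun ω => ?_) hm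
    refine LipschitzWith.continuous (K := 1) (LipschitzWith.of_dist_le_mul fun x x' => ?_)
    rw [dist_eq_norm, dist_eq_norm, NNReal.coe_one, one_mul]
    exact hne ω x x'
  have hmem : ∀ a : Lp (Vec n) 2 μ, MemLp (fun ω => N (a ω) ω) 2 μ := by
    intro a
    have hsm : AEStronglyMeasurable (fun ω => N (a ω) ω) μ :=
      (hjoint.comp ((Lp.stronglyMeasurable a).measurable.prodMk measurable_id)).aestronglyMeasurable
    refine ((Lp.memLp a).norm.add h0.norm).mono hsm (ae_of_all _ fun ω => ?_)
    have h1 := hne ω (a ω) 0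
    have h2 := norm_le_norm_add_norm_sub' (N (a ω) ω) (N 0 ω)
    rw [sub_zero] at h1
    simp only [Pi.add_apply]
    rw [Real.norm_of_nonneg (by positivity)]
    linarith
  refine ⟨fun a => (hmem a).toLp _, fun a => (hmem a).coeFn_toLp, fun a b => ?_⟩
  refine Lp.norm_le_norm_of_ae_le ?_
  filter_upwards [Lp.coeFn_sub ((hmem a).toLp _) ((hmem b).toLp _), (hmem a).coeFn_toLp,
    (hmem b).coeFn_toLp, Lp.coeFn_sub a b] with ω h1 h2 h3 h4
  rw [h1, Pi.sub_apply, h2, h3, h4, Pi.sub_apply]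
  exact hne ω _ _

theorem MemLp_of_integrable_rpow {p : ℝ} (hp : 1 < p) {a : Ω → Vec n}
    (ha : AEStronglyMeasurable a μ) (h : Integrable (fun ω => ‖a ω‖ ^ p) μ) :
    MemLp a (ENNReal.ofReal p) μ := by
  have hp0 : 0 < p := by linarith
  refine (integrable_norm_rpow_iff ha (by simpa using hp0) (by simp)).1 ?_
  rwa [ENNReal.toReal_ofReal hp0.le]

theorem norm_integral_le_one_add_integral_rpow [IsProbabilityMeasure μ] {p : ℝ} (hp : 1 < p)
    {a : Ω → Vec n} (h : Integrable (fun ω => ‖a ω‖ ^ p) μ) :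
    ‖∫ ω, a ω ∂μ‖ ≤ 1 + ∫ ω, ‖a ω‖ ^ p ∂μ := by
  have h1 : ‖∫ ω, a ω ∂μ‖ ≤ ∫ ω, (1 + ‖a ω‖ ^ p) ∂μ := by
    refine norm_integral_le_of_norm_le ((integrable_const 1).add h) (ae_of_all _ fun ω => ?_)
    rcases le_total ‖a ω‖ 1 with h1 | h1
    · have : 0 ≤ ‖a ω‖ ^ p := by positivity
      linarith
    · have := Real.self_le_rpow_of_one_le h1 hp.le
      linarith
  rwa [integral_add (integrable_const 1) h, integral_const, probReal_univ, one_smul] at h1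

end Superposition

/-! ### From approximate L² solutions to a pair of finite energy. -/

section Existence

variable {n : ℕ} {Ω : Type*} [MeasurableSpace Ω] {μ : Measure Ω} {T : Vec n → Ω → Ω}
  {α : Vec n → Ω → Set (Vec n)}

/-- Approximate solutions in `L²` of the inclusion `V ∈ α(U)` with `U` solenoidal and `V`
potential. -/
theorem exists_approximate_solution [IsProbabilityMeasure μ] (hT : IsDynamicalSystem μ T)
    (hα : ∀ (x : Vec n) (R : Set (Vec n)), IsOpen R → MeasurableSet {ω | (α x ω ∩ R).Nonempty})
    (hreg : ∀ᵐ ω ∂μ, IsRegularMonotoneOp fun x => α x ω) {k : Ω → ℝ} (hk : Integrable k μ)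
    (hcoer : ∀ᵐ ω ∂μ, ∀ x y, y ∈ α x ω → k ω ≤ inner ℝ x y) {δ : ℝ} (hδ : 0 < δ) :
    ∃ U V : Ω → Vec n, MemLp U 2 μ ∧ MemLp V 2 μ ∧ (∀ᵐ ω ∂μ, V ω ∈ α (U ω) ω) ∧
      ApproxAnnihilates μ T (gradTests n) δ U ∧ ApproxAnnihilates μ T (curlTests n) δ V ∧
      ∫ ω, (inner ℝ (U ω) (V ω) : ℝ) ∂μ ≤ 0 := by
  have hcl : IsClosed (hT.potentialSubspace : Set (Lp (Vec n) 2 μ)) :=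
    hT.isClosed_potentialSubspace
  have : CompleteSpace hT.potentialSubspace := hcl.completeSpace_coe
  obtain ⟨S, hSsub, hSm, hS0⟩ := exists_measurable_superset_of_null
    (ae_iff.1 (hreg.and hcoer))
  have hgood : ∀ ω ∈ Sᶜ, IsRegularMonotoneOp (fun x => α x ω) ∧
      ∀ x y, y ∈ α x ω → k ω ≤ inner ℝ x y := by
    intro ω hω
    by_contra h
    exact hω (hSsub h)
  have hSae : ∀ᵐ ω ∂μ, ω ∈ Sᶜ := compl_mem_ae_iff.2 hS0
  obtain ⟨J, hJm, hJ, hJ'⟩ := exists_measurable_resolvent hα hSm.compl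
    fun ω hω => (hgood ω hω).1
  let N : Vec n → Ω → Vec n := fun x ω => (2 : ℝ) • J x ω - x
  have hNm : ∀ x, Measurable (N x) := fun x => ((hJm x).const_smul (2 : ℝ)).sub_const x
  have hNne : ∀ ω x x', ‖N x ω - N x' ω‖ ≤ ‖x - x'‖ := by
    intro ω x x'
    by_cases hω : ω ∈ Sᶜ
    · exact (hgood ω hω).1.maximal.1.reflected_resolvent_le (hJ ω hω x) (hJ ω hω x')
    -- Off the good set J is half the identity, so the reflected resolvent N vanishes there and is
    -- trivially nonexpansive.
    · simp only [N, hJ' ω hω]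
      rw [smul_smul, smul_smul]
      norm_num
  have hN0 : MemLp (N 0) 2 μ := by
    refine (memLp_two_iff_integrable_sq_norm (hNm 0).aestronglyMeasurable).2 ?_
    refine (hk.norm.const_mul 4).mono' ((hNm 0).norm.pow_const 2).aestronglyMeasurable ?_
    filter_upwards [hSae] with ω hω
    -- At the origin the graph contains (J 0, -J 0), so k ≤ -‖J 0‖² and ‖N 0‖² = 4 ‖J 0‖² is
    -- dominated by 4 |k|.
    have h1 := (hgood ω hω).2 _ _ (hJ ω hω 0)
    rw [zero_sub, inner_neg_right, real_inner_self_eq_norm_sq] at h1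
    have h2 : ‖‖N 0 ω‖ ^ 2‖ = 4 * ‖J 0 ω‖ ^ 2 := by
      rw [Real.norm_of_nonneg (by positivity)]
      simp only [N, sub_zero, norm_smul, Real.norm_two]
      ring
    rw [h2, Real.norm_eq_abs]
    linarith [neg_abs_le (k ω)]
  obtain ⟨C, hC, hCne⟩ := exists_superposition hNm hNne hN0
  set κ := ∫ ω, |k ω| ∂μ with hκ
  have hκ0 : 0 ≤ κ := integral_nonneg fun _ => abs_nonneg _
  -- The damping defect τ = 1 - θ is small enough that the squared projection errors, at most τ κ,
  -- do not exceed δ².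
  set τ := min (1 / 2) (δ ^ 2 / (κ + 1)) with hτ
  have hτ0 : 0 < τ := by positivity
  have hτ1 : τ ≤ 1 / 2 := min_le_left _ _
  have hτκ : τ * κ ≤ δ ^ 2 := by
    have h1 : τ * (κ + 1) ≤ δ ^ 2 := by
      have := min_le_right (1 / 2) (δ ^ 2 / (κ + 1))
      rwa [le_div_iff₀ (by positivity)] at this
    nlinarith
  obtain ⟨s, hs⟩ := exists_fixedPoint_reflection hT.potentialSubspace hCne
    (θ := 1 - τ) (by linarith) (by linarith)
  set U : Lp (Vec n) 2 μ := (1 / 2 : ℝ) • (s + C s) with hU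
  set V : Lp (Vec n) 2 μ := (1 / 2 : ℝ) • (s - C s) with hV
  have hUV : U + V = s := by rw [hU, hV]; module
  have hUV' : U - V = C s := by rw [hU, hV]; module
  have hmem : ∀ᵐ ω ∂μ, V ω ∈ α (U ω) ω := by
    filter_upwards [hC s, Lp.coeFn_smul (1 / 2 : ℝ) (s + C s), Lp.coeFn_smul (1 / 2 : ℝ) (s - C s),
      Lp.coeFn_add s (C s), Lp.coeFn_sub s (C s), hSae] with ω h1 h2 h3 h4 h5 hω
    have e1 : U ω = J (s ω) ω := by
      rw [hU, h2, Pi.smul_apply, h4, Pi.add_apply, h1]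
      simp only [N]
      module
    have e2 : V ω = s ω - J (s ω) ω := by
      rw [hV, h3, Pi.smul_apply, h5, Pi.sub_apply, h1]
      simp only [N]
      module
    rw [e1, e2]
    exact hJ ω hω _
  have hinner : -κ ≤ inner ℝ U V := by
    rw [L2.inner_def, hκ, ← integral_neg]
    refine integral_mono_ae hk.abs.neg (L2.integrable_inner U V) ?_
    filter_upwards [hmem, hcoer] with ω h1 h2
    exact (neg_abs_le _).trans (h2 _ _ h1)
  obtain ⟨r1, r2, r3⟩ := norm_projection_le_of_fixedPoint hT.potentialSubspace
    (U := U) (V := V) (θ := 1 - τ) (by linarith) (by linarith)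
    (by rw [hUV, hUV']; exact hs) hinner
  rw [sub_sub_cancel] at r2 r3
  have approx : ∀ {𝒯 : Set (Vec n → Vec n)} (a e : Lp (Vec n) 2 μ), ‖e‖ ^ 2 ≤ τ * κ →
      (∀ᵐ ω ∂μ, Annihilates 𝒯 fun x => (a - e) (T x ω)) → ApproxAnnihilates μ T 𝒯 δ a := by
    intro 𝒯 a e he hann
    refine ⟨e, (Lp.memLp e).integrable (by norm_num), ?_, ?_⟩
    · refine (eLpNorm_le_eLpNorm_of_exponent_le (q := 2) (by norm_num)
        (Lp.aestronglyMeasurable e)).trans ?_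
      rw [ENNReal.le_ofReal_iff_toReal_le (Lp.eLpNorm_ne_top e) hδ.le, ← Lp.norm_def]
      exact (sq_le_sq₀ (norm_nonneg _) hδ.le).1 (he.trans hτκ)
    · exact hT.ae_annihilates_congr (Lp.coeFn_sub a e) hann
  refine ⟨U, V, Lp.memLp U, Lp.memLp V, hmem, ?_, ?_, ?_⟩
  · exact approx U _ r2 (hT.ae_annihilates_gradTests_of_mem_orthogonal
      (Submodule.sub_starProjection_mem_orthogonal U))
  · refine approx V _ r3 ?_
    rw [sub_sub_cancel]
    exact Submodule.starProjection_apply_mem hT.potentialSubspace V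
  · rw [← L2.inner_def]
    exact r1

/-- Along approximate solutions ∫ U·V ≤ 0, so coercivity on the graph bounds the L^p and L^q norms
and the energy in terms of ∫ |k|, independently of δ. -/
theorem exists_finite_energy [IsProbabilityMeasure μ] (hT : IsDynamicalSystem μ T)
    (hα : ∀ (x : Vec n) (R : Set (Vec n)), IsOpen R → MeasurableSet {ω | (α x ω ∩ R).Nonempty})
    (hreg : ∀ᵐ ω ∂μ, IsRegularMonotoneOp fun x => α x ω) {k : Ω → ℝ} (hk : Integrable k μ)
    {p q c : ℝ} (hp : 1 < p) (hq : 1 < q) (hc : 0 < c)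
    (hcoer : ∀ᵐ ω ∂μ, ∀ x y, y ∈ α x ω → c * (‖x‖ ^ p + ‖y‖ ^ q) + k ω ≤ inner ℝ x y)
    {F : Vec n → Vec n → Ω → ℝ≥0∞} (hF : IsConvexIntegrand μ p q F)
    (hFα : ∀ᵐ ω ∂μ, ∀ x y, y ∈ α x ω → F x y ω ≤ ENNReal.ofReal (inner ℝ x y - k ω)) :
    ∃ U V : Ω → Vec n, MemLp U (ENNReal.ofReal p) μ ∧
      MemLp V (ENNReal.ofReal q) μ ∧ (∀ᵐ ω ∂μ, Annihilates (gradTests n) fun x => U (T x ω)) ∧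
      (∀ᵐ ω ∂μ, Annihilates (curlTests n) fun x => V (T x ω)) ∧
      ∫⁻ ω, F (U ω) (V ω) ω ∂μ < ∞ := by
  have hcoer' : ∀ᵐ ω ∂μ, ∀ x y, y ∈ α x ω → k ω ≤ inner ℝ x y := by
    filter_upwards [hcoer] with ω h x y hy
    have h1 : 0 ≤ c * (‖x‖ ^ p + ‖y‖ ^ q) := by positivity
    linarith [h x y hy]
  set κ := ∫ ω, |k ω| ∂μ with hκ
  have key : ∀ δ : ℝ, 0 < δ → ∃ U V : Ω → Vec n, MemLp U (ENNReal.ofReal p) μ ∧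
      MemLp V (ENNReal.ofReal q) μ ∧ ApproxAnnihilates μ T (gradTests n) δ U ∧
      ApproxAnnihilates μ T (curlTests n) δ V ∧ ‖∫ ω, U ω ∂μ‖ ≤ 1 + κ / c ∧
      ‖∫ ω, V ω ∂μ‖ ≤ 1 + κ / c ∧ ∫⁻ ω, F (U ω) (V ω) ω ∂μ ≤ ENNReal.ofReal κ := by
    intro δ hδ
    obtain ⟨U, V, hU, hV, hmem, hUa, hVa, hUV⟩ :=
      exists_approximate_solution hT hα hreg hk hcoer' hδ
    have hi : Integrable (fun ω => (inner ℝ (U ω) (V ω) : ℝ)) μ :=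
      hU.integrable_inner_of_holderConjugate hV
    have hi' : Integrable (fun ω => (inner ℝ (U ω) (V ω) : ℝ) - k ω) μ := hi.sub hk
    have hle : ∫ ω, ((inner ℝ (U ω) (V ω) : ℝ) - k ω) ∂μ ≤ κ := by
      rw [integral_sub hi hk]
      have : -∫ ω, k ω ∂μ ≤ κ := by
        rw [hκ, ← integral_neg]
        exact integral_mono hk.neg hk.abs fun ω => neg_le_abs _
      linarith
    have hb : ∀ᵐ ω ∂μ, c * (‖U ω‖ ^ p + ‖V ω‖ ^ q) ≤ inner ℝ (U ω) (V ω) - k ω := by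
      filter_upwards [hmem, hcoer] with ω h1 h2
      linarith [h2 _ _ h1]
    have hUp : ∀ᵐ ω ∂μ, ‖U ω‖ ^ p ≤ (inner ℝ (U ω) (V ω) - k ω) / c := by
      filter_upwards [hb] with ω h1
      rw [le_div_iff₀ hc, mul_comm]
      refine le_trans ?_ h1
      have : 0 ≤ ‖V ω‖ ^ q := by positivity
      gcongr
      linarith
    have hVq : ∀ᵐ ω ∂μ, ‖V ω‖ ^ q ≤ (inner ℝ (U ω) (V ω) - k ω) / c := by
      filter_upwards [hb] with ω h1
      rw [le_div_iff₀ hc, mul_comm]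
      refine le_trans ?_ h1
      have : 0 ≤ ‖U ω‖ ^ p := by positivity
      gcongr
      linarith
    have hUi : Integrable (fun ω => ‖U ω‖ ^ p) μ := by
      refine (hi'.div_const c).mono' (hU.1.norm.aemeasurable.pow_const p).aestronglyMeasurable ?_
      filter_upwards [hUp] with ω h
      rwa [Real.norm_of_nonneg (by positivity)]
    have hVi : Integrable (fun ω => ‖V ω‖ ^ q) μ := by
      refine (hi'.div_const c).mono' (hV.1.norm.aemeasurable.pow_const q).aestronglyMeasurable ?_
      filter_upwards [hVq] with ω h
      rwa [Real.norm_of_nonneg (by positivity)]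
    refine ⟨U, V, MemLp_of_integrable_rpow hp hU.1 hUi, MemLp_of_integrable_rpow hq hV.1 hVi,
      hUa, hVa, ?_, ?_, ?_⟩
    · refine (norm_integral_le_one_add_integral_rpow hp hUi).trans ?_
      have := integral_mono_ae hUi (hi'.div_const c) hUp
      rw [integral_div] at this
      have h2 : (∫ ω, ((inner ℝ (U ω) (V ω) : ℝ) - k ω) ∂μ) / c ≤ κ / c := by gcongr
      linarith
    · refine (norm_integral_le_one_add_integral_rpow hq hVi).trans ?_
      have := integral_mono_ae hVi (hi'.div_const c) hVq
      rw [integral_div] at this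
      have h2 : (∫ ω, ((inner ℝ (U ω) (V ω) : ℝ) - k ω) ∂μ) / c ≤ κ / c := by gcongr
      linarith
    · calc ∫⁻ ω, F (U ω) (V ω) ω ∂μ
          ≤ ∫⁻ ω, ENNReal.ofReal (inner ℝ (U ω) (V ω) - k ω) ∂μ := by
            refine lintegral_mono_ae ?_
            filter_upwards [hmem, hFα] with ω h1 h2
            exact h2 _ _ h1
        _ = ENNReal.ofReal (∫ ω, ((inner ℝ (U ω) (V ω) : ℝ) - k ω) ∂μ) := by
            rw [ofReal_integral_eq_lintegral_ofReal hi']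
            filter_upwards [hmem, hcoer'] with ω h1 h2
            exact sub_nonneg.2 (h2 _ _ h1)
        _ ≤ ENNReal.ofReal κ := ENNReal.ofReal_le_ofReal hle
  choose U V hU hV hUa hVa hUm hVm hUF using fun j : ℕ =>
    key (1 / ((j : ℝ) + 1)) (by positivity)
  have hball : ∀ j, ((∫ ω, U j ω ∂μ, ∫ ω, V j ω ∂μ) : Vec n × Vec n) ∈
      Metric.closedBall (0 : Vec n × Vec n) (1 + κ / c) := fun j => by
    rw [mem_closedBall_zero_iff, Prod.norm_def]
    exact max_le (hUm j) (hVm j)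
  -- The means are not prescribed: they are bounded, and any limit point serves as the target pair
  -- of means for the direct method.
  obtain ⟨ζ, -, φ, hφ, hlim⟩ := (isCompact_closedBall _ _).tendsto_subseq hball
  obtain ⟨U', V', h1, h2, h3, h4, -, -, h7⟩ := hF.exists_of_approx hT hp hq (ξ := ζ.1) (η := ζ.2)
    (M := ENNReal.ofReal κ) ENNReal.ofReal_ne_top fun δ hδ => by
      have e1 : ∀ᶠ j in Filter.atTop, 1 / ((φ j : ℝ) + 1) < δ :=
        ((tendsto_one_div_add_atTop_nhds_zero_nat (𝕜 := ℝ)).comp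
          hφ.tendsto_atTop).eventually_lt_const hδ
      have e2 := (Metric.tendsto_nhds.1 hlim) δ hδ
      obtain ⟨j, hj1, hj2⟩ := (e1.and e2).exists
      rw [dist_eq_norm, Prod.norm_def, max_lt_iff] at hj2
      exact ⟨U (φ j), V (φ j), hU _, hV _, (hUa _).mono hj1.le, (hVa _).mono hj1.le,
        hj2.1.le, hj2.2.le, (hUF _).trans le_self_add⟩
  exact ⟨U', V', h1, h2, h3, h4, h7.trans_lt ENNReal.ofReal_lt_top⟩

end Existence

/-! ### Extended real integrands bounded below -/

section ExtendedReal

theorem EReal.continuous_sub_coe :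
    Continuous fun z : EReal × ℝ => z.1 - (z.2 : EReal) := by
  have h1 : Continuous fun z : EReal × ℝ => (z.1, -(z.2 : EReal)) :=
    continuous_fst.prodMk (continuous_neg.comp (continuous_coe_real_ereal.comp continuous_snd))
  refine continuous_iff_continuousAt.2 fun z => ?_
  have h2 : ContinuousAt (fun w : EReal × EReal => w.1 + w.2) (z.1, -(z.2 : EReal)) :=
    EReal.continuousAt_add (Or.inr (by rw [← EReal.coe_neg]; exact EReal.coe_ne_bot _))
      (Or.inr (by rw [← EReal.coe_neg]; exact EReal.coe_ne_top _))
  exact h2.comp (f := fun z : EReal × ℝ => (z.1, -(z.2 : EReal))) h1.continuousAt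

theorem EReal.toENNReal_sub_combo_le {e e₁ e₂ : EReal} {a b k : ℝ} (ha : 0 < a) (hb : 0 < b)
    (hab : a + b = 1) (he : e ≤ (a : EReal) * e₁ + (b : EReal) * e₂) (h₁ : (k : EReal) ≤ e₁)
    (h₂ : (k : EReal) ≤ e₂) :
    (e - k).toENNReal ≤
      ENNReal.ofReal a * (e₁ - k).toENNReal + ENNReal.ofReal b * (e₂ - k).toENNReal := by
  induction e₁ with
  | bot => simp at h₁
  | top => simp [ENNReal.mul_top, ha]
  | coe r₁ =>
    induction e₂ with
    | bot => simp at h₂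
    | top => simp [ENNReal.mul_top, hb]
    | coe r₂ =>
      have h₁ : k ≤ r₁ := by exact_mod_cast h₁
      have h₂ : k ≤ r₂ := by exact_mod_cast h₂
      rw [← EReal.coe_sub, ← EReal.coe_sub, EReal.real_coe_toENNReal, EReal.real_coe_toENNReal,
        ← ENNReal.ofReal_mul ha.le, ← ENNReal.ofReal_mul hb.le,
        ← ENNReal.ofReal_add (mul_nonneg ha.le (by linarith)) (mul_nonneg hb.le (by linarith)),
        ← EReal.real_coe_toENNReal]
      refine EReal.toENNReal_le_toENNReal ?_
      have h3 : a * (r₁ - k) + b * (r₂ - k) = a * r₁ + b * r₂ - k := by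
        linear_combination (-k) * hab
      rw [h3, EReal.coe_sub]
      refine EReal.sub_le_sub ?_ le_rfl
      exact_mod_cast he

theorem EReal.coe_combo_add_le {s t : ℝ≥0∞} {a b K : ℝ} (ha : 0 < a) (hb : 0 < b)
    (hab : a + b = 1) :
    ((ENNReal.ofReal a * s + ENNReal.ofReal b * t : ℝ≥0∞) : EReal) + K ≤
      (a : EReal) * (s + K) + (b : EReal) * (t + K) := by
  have hmul : ∀ (c : ℝ), 0 < c → (c : EReal) * (⊤ + (K : EReal)) = ⊤ := fun c hc => by
    rw [EReal.top_add_coe, EReal.coe_mul_top_of_pos hc]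
  have hbot : ∀ (c : ℝ) (x : ℝ≥0∞), 0 < c → (c : EReal) * ((x : EReal) + K) ≠ ⊥ := by
    intro c x hc
    induction x with
    | top => rw [EReal.coe_ennreal_top, hmul c hc]; exact top_ne_bot
    | coe x =>
      rw [EReal.coe_nnreal_eq_coe_real]
      exact_mod_cast EReal.coe_ne_bot (c * ((x : ℝ) + K))
  induction s with
  | top =>
    rw [EReal.coe_ennreal_top, hmul a ha, EReal.top_add_of_ne_bot (hbot b t hb)]
    exact le_top
  | coe s =>
    induction t with
    | top =>
      rw [EReal.coe_ennreal_top, hmul b hb, EReal.add_top_of_ne_bot (hbot a s ha)]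
      exact le_top
    | coe t =>
      have e1 : ENNReal.ofReal a * s + ENNReal.ofReal b * t =
          ENNReal.ofReal (a * s + b * t) := by
        rw [ENNReal.ofReal_add (by positivity) (by positivity), ENNReal.ofReal_mul ha.le,
          ENNReal.ofReal_mul hb.le, ENNReal.ofReal_coe_nnreal, ENNReal.ofReal_coe_nnreal]
      rw [e1, EReal.coe_ennreal_ofReal, max_eq_left (by positivity), EReal.coe_nnreal_eq_coe_real,
        EReal.coe_nnreal_eq_coe_real]
      have e2 : a * (s : ℝ) + b * t + K = a * (s + K) + b * (t + K) := by
        linear_combination (-K) * hab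
      exact_mod_cast e2.le

theorem extIntegral_eq_of_le {Ω : Type*} [MeasurableSpace Ω] {μ : Measure Ω} {g : Ω → EReal}
    (hg : AEMeasurable g μ) {k : Ω → ℝ} (hk : Integrable k μ)
    (hkg : ∀ᵐ ω ∂μ, (k ω : EReal) ≤ g ω) :
    extIntegral μ g = ((∫⁻ ω, (g ω - k ω).toENNReal ∂μ : ℝ≥0∞) : EReal) + ((∫ ω, k ω ∂μ : ℝ) :
      EReal) := by
  have hgk : AEMeasurable (fun ω => (g ω - k ω).toENNReal) μ :=
    (EReal.continuous_sub_coe.measurable.comp_aemeasurable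
      (hg.prodMk hk.1.aemeasurable)).ereal_toENNReal
  -- The identity g⁺ + k⁻ = (g - k) + k⁺ + g⁻ is free of subtractions between integrals. Only the
  -- integrals of g⁺ and g - k can be infinite, and then both are.
  have hid : (∫⁻ ω, (g ω).toENNReal ∂μ) + ∫⁻ ω, ENNReal.ofReal (-k ω) ∂μ =
      (∫⁻ ω, (g ω - k ω).toENNReal ∂μ) + ∫⁻ ω, ENNReal.ofReal (k ω) ∂μ +
        ∫⁻ ω, (-g ω).toENNReal ∂μ := by
    rw [← lintegral_add_left' hg.ereal_toENNReal, ← lintegral_add_left' hgk,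
      ← lintegral_add_left' (f := fun ω => (g ω - k ω).toENNReal + ENNReal.ofReal (k ω))
        (hgk.add hk.1.aemeasurable.ennreal_ofReal)]
    refine lintegral_congr_ae ?_
    filter_upwards [hkg] with ω hω
    generalize g ω = e at hω
    generalize k ω = r at hω
    induction e with
    | bot => simp at hω
    | top => simp
    | coe s =>
      have hrs : r ≤ s := by exact_mod_cast hω
      rw [← EReal.coe_sub, ← EReal.coe_neg]
      simp only [EReal.real_coe_toENNReal]
      rcases le_total 0 r with h | h
      · rw [ENNReal.ofReal_of_nonpos (neg_nonpos.2 h),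
          ENNReal.ofReal_of_nonpos (neg_nonpos.2 (h.trans hrs)),
          ← ENNReal.ofReal_add (by linarith) h]
        simp
      · rw [ENNReal.ofReal_of_nonpos h, add_zero]
        rcases le_total 0 s with h' | h'
        · rw [ENNReal.ofReal_of_nonpos (neg_nonpos.2 h'), add_zero,
            ← ENNReal.ofReal_add h' (by linarith), sub_eq_add_neg]
        · rw [ENNReal.ofReal_of_nonpos h', zero_add,
            ← ENNReal.ofReal_add (by linarith) (by linarith)]
          congr 1
          ring
  have hle : ∫⁻ ω, (-g ω).toENNReal ∂μ ≤ ∫⁻ ω, ENNReal.ofReal (-k ω) ∂μ := by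
    refine lintegral_mono_ae ?_
    filter_upwards [hkg] with ω hω
    rw [← EReal.real_coe_toENNReal, EReal.coe_neg]
    exact EReal.toENNReal_le_toENNReal (EReal.neg_le_neg_iff.2 hω)
  have hkp : ∫⁻ ω, ENNReal.ofReal (k ω) ∂μ ≠ ∞ := hk.lintegral_lt_top.ne
  have hkn : ∫⁻ ω, ENNReal.ofReal (-k ω) ∂μ ≠ ∞ := hk.neg.lintegral_lt_top.ne
  have hgn : ∫⁻ ω, (-g ω).toENNReal ∂μ ≠ ∞ := ne_top_of_le_ne_top hkn hle
  rw [extIntegral, integral_eq_lintegral_pos_part_sub_lintegral_neg_part hk]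
  generalize ∫⁻ ω, (g ω).toENNReal ∂μ = A at *
  generalize ∫⁻ ω, ENNReal.ofReal (-k ω) ∂μ = B at *
  generalize ∫⁻ ω, (g ω - k ω).toENNReal ∂μ = C at *
  generalize ∫⁻ ω, ENNReal.ofReal (k ω) ∂μ = D at *
  generalize ∫⁻ ω, (-g ω).toENNReal ∂μ = E at *
  lift B to NNReal using hkn
  lift D to NNReal using hkp
  lift E to NNReal using hgn
  induction A with
  | top =>
    have : C = ⊤ := by
      by_contra h
      lift C to NNReal using h
      simp at hid
      exact absurd hid.symm (by exact_mod_cast ENNReal.coe_ne_top (r := C + D + E))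
    rw [this, ← EReal.coe_ennreal_toReal (ENNReal.coe_ne_top (r := E))]
    simp only [EReal.coe_ennreal_top, EReal.top_sub_coe, EReal.top_add_coe]
  | coe A =>
    have hC : C ≠ ⊤ := by
      rintro rfl
      simp at hid
    lift C to NNReal using hC
    have hid' : A + B = C + D + E := by exact_mod_cast hid
    have hid2 : (A : ℝ) + B = C + D + E := by exact_mod_cast hid'
    simp only [EReal.coe_nnreal_eq_coe_real, ENNReal.coe_toReal]
    have : (A : ℝ) - E = C + (D - B) := by linarith
    exact_mod_cast this

end ExtendedReal

/-! ### The excess over the lower bound as a nonnegative integrand. -/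

section Excess

variable {n : ℕ} {Ω : Type*} [MeasurableSpace Ω] {μ : Measure Ω}
  {f : Vec n → Vec n → Ω → EReal} {k : Ω → ℝ} {p q c : ℝ}

theorem IsMeasurableRepresentative.isConvexIntegrand (hf : IsMeasurableRepresentative μ f)
    (hk : Measurable k) (hc : 0 < c) (hcoer : ∀ᵐ ω ∂μ, ∀ ξ η : Vec n,
      ((c * (‖ξ‖ ^ p + ‖η‖ ^ q) + k ω : ℝ) : EReal) ≤ f ξ η ω) :
    IsConvexIntegrand μ p q fun x y ω => (f x y ω - k ω).toENNReal where
  measurable := (EReal.continuous_sub_coe.measurable.comp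
    (hf.measurable.prodMk (hk.comp measurable_snd))).ereal_toENNReal
  convex := by
    filter_upwards [hf.convex, hcoer] with ω h1 h2 x₁ y₁ x₂ y₂ a b ha hb hab
    have h3 : ∀ x y, (k ω : EReal) ≤ f x y ω := fun x y => by
      refine le_trans ?_ (h2 x y)
      rw [EReal.coe_le_coe_iff]
      have : 0 ≤ c * (‖x‖ ^ p + ‖y‖ ^ q) := by positivity
      linarith
    exact EReal.toENNReal_sub_combo_le ha hb hab (h1 x₁ y₁ x₂ y₂ a b ha hb hab) (h3 _ _) (h3 _ _)
  lsc := by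
    filter_upwards [hf.lsc] with ω hω
    have h1 : Continuous fun e : EReal => (e - k ω).toENNReal :=
      (EReal.continuous_sub_coe.comp (continuous_id.prodMk continuous_const)).ereal_toENNReal
    exact h1.comp_lowerSemicontinuous hω fun e e' h =>
      EReal.toENNReal_le_toENNReal (EReal.sub_le_sub h le_rfl)
  coercive := by
    refine ⟨c, hc, ?_⟩
    filter_upwards [hcoer] with ω h x y
    rw [← EReal.real_coe_toENNReal]
    refine EReal.toENNReal_le_toENNReal ?_
    have h1 := EReal.sub_le_sub (h x y) (le_refl (k ω : EReal))
    rwa [← EReal.coe_sub, add_sub_cancel_right] at h1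

end Excess

/-! ### Constant fields -/

theorem integral_partialDeriv_eq_zero {n : ℕ} {φ : Vec n → ℝ} (hφ : IsTestFunction φ) (j : Fin n) :
    ∫ x, partialDeriv j φ x = 0 := by
  have h := integral_mul_fderiv_eq_neg_fderiv_mul_of_integrable (μ := (volume : Measure (Vec n)))
    (f := fun _ => (1 : ℝ)) (g := φ) (v := EuclideanSpace.single j 1) (by simp)
    (by
      simp only [one_mul]
      exact (hφ.continuous_partialDeriv j).integrable_of_hasCompactSupport
        (hφ.hasCompactSupport_partialDeriv j))
    (by simpa using hφ.1.continuous.integrable_of_hasCompactSupport hφ.2)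
    (fun x _ => differentiableAt_const _)
    (fun x _ => (hφ.1.differentiable (by simp)).differentiableAt)
  simpa [partialDeriv] using h

theorem annihilates_gradTests_const {n : ℕ} (a : Vec n) :
    Annihilates (gradTests n) fun _ => a := by
  refine isSolenoidalField_iff.1 ⟨locallyIntegrable_const _, fun φ hφ => ?_⟩
  exact Finset.sum_eq_zero fun i _ => by
    rw [integral_const_mul, integral_partialDeriv_eq_zero hφ, mul_zero]

theorem annihilates_curlTests_const {n : ℕ} (a : Vec n) :
    Annihilates (curlTests n) fun _ => a := by
  refine isPotentialField_iff.1 ⟨locallyIntegrable_const _, fun i j φ hφ => ?_⟩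
  have h : ∀ l, Integrable (partialDeriv l φ) volume := fun l =>
    (hφ.continuous_partialDeriv l).integrable_of_hasCompactSupport
      (hφ.hasCompactSupport_partialDeriv l)
  rw [integral_sub ((h j).const_mul _) ((h i).const_mul _), integral_const_mul, integral_const_mul,
    integral_partialDeriv_eq_zero hφ, integral_partialDeriv_eq_zero hφ]
  simp

/-! ### The cell problem -/

/-- `(U, V)` is a pair of a solenoidal and a potential field with means `ξ` and `η`. -/
structure IsAdmissible {n : ℕ} {Ω : Type*} [MeasurableSpace Ω] (μ : Measure Ω) (T : Vec n → Ω → Ω)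
    (p q : ℝ) (ξ η : Vec n) (U V : Ω → Vec n) : Prop where
  memLp_left : MemLp U (ENNReal.ofReal p) μ
  memLp_right : MemLp V (ENNReal.ofReal q) μ
  solenoidal : ∀ᵐ ω ∂μ, Annihilates (gradTests n) fun x => U (T x ω)
  potential : ∀ᵐ ω ∂μ, Annihilates (curlTests n) fun x => V (T x ω)
  integral_left : ∫ ω, U ω ∂μ = ξ
  integral_right : ∫ ω, V ω ∂μ = η

/-- The minimal value of the cell problem for a nonnegative integrand. -/
noncomputable def cellInf {n : ℕ} {Ω : Type*} [MeasurableSpace Ω] (μ : Measure Ω)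
    (T : Vec n → Ω → Ω) (p q : ℝ) (F : Vec n → Vec n → Ω → ℝ≥0∞) (ξ η : Vec n) : ℝ≥0∞ :=
  ⨅ (U) (V) (_ : IsAdmissible μ T p q ξ η U V), ∫⁻ ω, F (U ω) (V ω) ω ∂μ

section CellProblem

variable {n : ℕ} {Ω : Type*} [MeasurableSpace Ω] {μ : Measure Ω} {T : Vec n → Ω → Ω} {p q : ℝ}
  {F : Vec n → Vec n → Ω → ℝ≥0∞} {ξ η : Vec n} {U V : Ω → Vec n}

theorem one_le_ofReal_of_one_lt {r : ℝ} (hr : 1 < r) : (1 : ℝ≥0∞) ≤ ENNReal.ofReal r := by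
  rw [← ENNReal.ofReal_one]
  exact ENNReal.ofReal_le_ofReal hr.le

theorem IsAdmissible.cellInf_le (h : IsAdmissible μ T p q ξ η U V) :
    cellInf μ T p q F ξ η ≤ ∫⁻ ω, F (U ω) (V ω) ω ∂μ :=
  iInf_le_of_le U (iInf_le_of_le V (iInf_le _ h))

theorem IsAdmissible.translate [IsProbabilityMeasure μ] (hp : 1 < p) (hq : 1 < q)
    (h : IsAdmissible μ T p q ξ η U V) (a b : Vec n) :
    IsAdmissible μ T p q (a + ξ) (b + η) (fun ω => a + U ω) (fun ω => b + V ω) where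
  memLp_left := (memLp_const a).add h.memLp_left
  memLp_right := (memLp_const b).add h.memLp_right
  solenoidal := h.solenoidal.mono fun ω hω =>
    (annihilates_gradTests_const a).add (isTestFamily_gradTests n) hω
  potential := h.potential.mono fun ω hω =>
    (annihilates_curlTests_const b).add (isTestFamily_curlTests n) hω
  integral_left := by
    rw [integral_add (integrable_const a)
      (h.memLp_left.integrable (one_le_ofReal_of_one_lt hp)), h.integral_left]
    simp
  integral_right := by
    rw [integral_add (integrable_const b)
      (h.memLp_right.integrable (one_le_ofReal_of_one_lt hq)), h.integral_right]
    simp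

theorem isAdmissible_const [IsProbabilityMeasure μ] (ξ η : Vec n) :
    IsAdmissible μ T p q ξ η (fun _ => ξ) (fun _ => η) where
  memLp_left := memLp_const ξ
  memLp_right := memLp_const η
  solenoidal := ae_of_all _ fun _ => annihilates_gradTests_const ξ
  potential := ae_of_all _ fun _ => annihilates_curlTests_const η
  integral_left := by simp
  integral_right := by simp

theorem isAdmissible_zero_iff : IsAdmissible μ T p q 0 0 U V ↔ U ∈ VSol μ T p ∧ V ∈ VPot μ T q := by
  constructor
  · intro h
    exact ⟨⟨h.memLp_left, h.solenoidal.mono fun _ => isSolenoidalField_iff.2, h.integral_left⟩,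
      h.memLp_right, h.potential.mono fun _ => isPotentialField_iff.2, h.integral_right⟩
  · rintro ⟨⟨h1, h2, h3⟩, h4, h5, h6⟩
    exact ⟨h1, h4, h2.mono fun _ => isSolenoidalField_iff.1, h5.mono fun _ => isPotentialField_iff.1,
      h3, h6⟩

theorem IsAdmissible.combo [IsProbabilityMeasure μ] (hp : 1 < p) (hq : 1 < q)
    {ξ' η' : Vec n} {U' V' : Ω → Vec n} (h : IsAdmissible μ T p q ξ η U V)
    (h' : IsAdmissible μ T p q ξ' η' U' V') (a b : ℝ) :
    IsAdmissible μ T p q (a • ξ + b • ξ') (a • η + b • η') (fun ω => a • U ω + b • U' ω)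
      (fun ω => a • V ω + b • V' ω) where
  memLp_left := (h.memLp_left.const_smul a).add (h'.memLp_left.const_smul b)
  memLp_right := (h.memLp_right.const_smul a).add (h'.memLp_right.const_smul b)
  solenoidal := by
    filter_upwards [h.solenoidal, h'.solenoidal] with ω h1 h2
    exact (h1.smul a).add (isTestFamily_gradTests n) (h2.smul b)
  potential := by
    filter_upwards [h.potential, h'.potential] with ω h1 h2
    exact (h1.smul a).add (isTestFamily_curlTests n) (h2.smul b)
  integral_left := by
    have hp1 := one_le_ofReal_of_one_lt hp
    rw [integral_add ((h.memLp_left.integrable hp1).fun_smul a)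
      ((h'.memLp_left.integrable hp1).fun_smul b), integral_smul, integral_smul, h.integral_left,
      h'.integral_left]
  integral_right := by
    have hq1 := one_le_ofReal_of_one_lt hq
    rw [integral_add ((h.memLp_right.integrable hq1).fun_smul a)
      ((h'.memLp_right.integrable hq1).fun_smul b), integral_smul, integral_smul,
      h.integral_right, h'.integral_right]

/-- Existence of a minimizer, in a form that also yields lower semicontinuity. -/
theorem IsConvexIntegrand.exists_isAdmissible_le [IsProbabilityMeasure μ]
    (hF : IsConvexIntegrand μ p q F) (hT : IsDynamicalSystem μ T) (hp : 1 < p) (hq : 1 < q)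
    {M : ℝ≥0∞} (hM : M ≠ ∞)
    (h : ∀ δ : ℝ, 0 < δ → ∃ ξ' η', ‖ξ' - ξ‖ ≤ δ ∧ ‖η' - η‖ ≤ δ ∧
      cellInf μ T p q F ξ' η' < M + ENNReal.ofReal δ) :
    ∃ U V, IsAdmissible μ T p q ξ η U V ∧ ∫⁻ ω, F (U ω) (V ω) ω ∂μ ≤ M := by
  obtain ⟨U, V, h1, h2, h3, h4, h5, h6, h7⟩ := hF.exists_of_approx hT hp hq (ξ := ξ) (η := η) hM
    fun δ hδ => by
      obtain ⟨ξ', η', hξ, hη, hlt⟩ := h δ hδ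
      simp only [cellInf, iInf_lt_iff] at hlt
      obtain ⟨U, V, hUV, hlt⟩ := hlt
      exact ⟨U, V, hUV.memLp_left, hUV.memLp_right, approxAnnihilates_of_ae hUV.solenoidal,
        approxAnnihilates_of_ae hUV.potential, by rwa [hUV.integral_left],
        by rwa [hUV.integral_right], hlt.le⟩
  exact ⟨U, V, ⟨h1, h2, h3, h4, h5, h6⟩, h7⟩

theorem IsConvexIntegrand.exists_minimizer [IsProbabilityMeasure μ]
    (hF : IsConvexIntegrand μ p q F) (hT : IsDynamicalSystem μ T) (hp : 1 < p) (hq : 1 < q)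
    (ξ η : Vec n) :
    ∃ U V, IsAdmissible μ T p q ξ η U V ∧
      ∫⁻ ω, F (U ω) (V ω) ω ∂μ = cellInf μ T p q F ξ η := by
  -- When the infimum is infinite every competitor attains it, and constant fields provide one.
  by_cases hM : cellInf μ T p q F ξ η = ∞
  · exact ⟨_, _, isAdmissible_const ξ η,
      le_antisymm (hM ▸ le_top) (isAdmissible_const ξ η).cellInf_le⟩
  · obtain ⟨U, V, hUV, hle⟩ := hF.exists_isAdmissible_le hT hp hq (ξ := ξ) (η := η) hM
      fun δ hδ => ⟨ξ, η, by simpa using hδ.le, by simpa using hδ.le,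
        ENNReal.lt_add_right hM (by simpa using hδ)⟩
    exact ⟨U, V, hUV, hle.antisymm hUV.cellInf_le⟩

/-- If it failed at z, points arbitrarily close to z would have value at most some M below the value
at z; the direct method would then produce a competitor at z with energy at most M. -/
theorem IsConvexIntegrand.lowerSemicontinuous_cellInf [IsProbabilityMeasure μ]
    (hF : IsConvexIntegrand μ p q F) (hT : IsDynamicalSystem μ T) (hp : 1 < p) (hq : 1 < q) :
    LowerSemicontinuous fun z : Vec n × Vec n => cellInf μ T p q F z.1 z.2 := by
  intro z M hM
  by_contra hcon
  have hfreq : ∃ᶠ z' in nhds z, cellInf μ T p q F z'.1 z'.2 ≤ M := by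
    simpa only [Filter.not_eventually, not_lt] using hcon
  obtain ⟨U, V, hUV, hle⟩ := hF.exists_isAdmissible_le hT hp hq (ξ := z.1) (η := z.2)
    hM.ne_top fun δ hδ => by
      obtain ⟨z', hz', hdist⟩ := (hfreq.and_eventually (Metric.ball_mem_nhds z hδ)).exists
      rw [dist_eq_norm, Prod.norm_def, max_lt_iff] at hdist
      exact ⟨z'.1, z'.2, hdist.1.le, hdist.2.le,
        hz'.trans_lt (ENNReal.lt_add_right hM.ne_top (by simpa using hδ))⟩
  exact absurd (hUV.cellInf_le.trans hle) (not_le.2 hM)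

theorem IsConvexIntegrand.cellInf_combo_le [IsProbabilityMeasure μ]
    (hF : IsConvexIntegrand μ p q F) (hT : IsDynamicalSystem μ T) (hp : 1 < p) (hq : 1 < q)
    (x₁ y₁ x₂ y₂ : Vec n) {a b : ℝ} (ha : 0 < a) (hb : 0 < b) (hab : a + b = 1) :
    cellInf μ T p q F (a • x₁ + b • x₂) (a • y₁ + b • y₂) ≤
      ENNReal.ofReal a * cellInf μ T p q F x₁ y₁ + ENNReal.ofReal b * cellInf μ T p q F x₂ y₂ := by
  obtain ⟨U, V, h, e⟩ := hF.exists_minimizer hT hp hq x₁ y₁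
  obtain ⟨U', V', h', e'⟩ := hF.exists_minimizer hT hp hq x₂ y₂
  rw [← e, ← e']
  exact (h.combo hp hq h' a b).cellInf_le.trans
    (hF.lintegral_combo_le h.memLp_left.1 h.memLp_right.1 ha hb hab)

/-- Subtracting the mean from `U` alone suffices, as orthogonality needs only one of the two fields
to have mean zero. -/
theorem IsAdmissible.integral_inner [IsProbabilityMeasure μ] (hT : IsDynamicalSystem μ T)
    (hE : IsErgodicSystem μ T) (hpq : p.HolderConjugate q) (h : IsAdmissible μ T p q ξ η U V) :
    Integrable (fun ω => (inner ℝ (U ω) (V ω) : ℝ)) μ ∧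
      ∫ ω, (inner ℝ (U ω) (V ω) : ℝ) ∂μ = inner ℝ ξ η := by
  have : (ENNReal.ofReal p).HolderConjugate (ENNReal.ofReal q) := hpq.ennrealOfReal
  have hi : Integrable (fun ω => (inner ℝ (U ω) (V ω) : ℝ)) μ :=
    h.memLp_left.integrable_inner_of_holderConjugate h.memLp_right
  have hVi := h.memLp_right.integrable (one_le_ofReal_of_one_lt hpq.symm.lt)
  refine ⟨hi, ?_⟩
  have h0 := h.translate hpq.lt hpq.symm.lt (-ξ) 0
  have h1 := hT.integral_inner_eq_zero hE hpq h0.memLp_left h.memLp_right h0.solenoidal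
    h.potential (by rw [h0.integral_left, neg_add_cancel])
  simp only [inner_add_left, inner_neg_left] at h1
  rw [integral_add (f := fun ω => -inner ℝ ξ (V ω)) (hVi.const_inner ξ).neg hi, integral_neg, _root_.integral_inner hVi,
    h.integral_right] at h1
  linarith

theorem IsAdmissible.ofReal_inner_sub_le [IsProbabilityMeasure μ] (hT : IsDynamicalSystem μ T)
    (hE : IsErgodicSystem μ T) (hpq : p.HolderConjugate q) {k : Ω → ℝ} (hk : Integrable k μ)
    (hle : ∀ᵐ ω ∂μ, ∀ x y, ENNReal.ofReal (inner ℝ x y - k ω) ≤ F x y ω)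
    (h : IsAdmissible μ T p q ξ η U V) :
    ENNReal.ofReal (inner ℝ ξ η - ∫ ω, k ω ∂μ) ≤ ∫⁻ ω, F (U ω) (V ω) ω ∂μ := by
  obtain ⟨hi, he⟩ := h.integral_inner hT hE hpq
  have hi' : Integrable (fun ω => (inner ℝ (U ω) (V ω) : ℝ) - k ω) μ := hi.sub hk
  rw [← he, ← integral_sub hi hk]
  refine le_trans ?_ (lintegral_mono_ae (hle.mono fun ω hω => hω (U ω) (V ω)))
  rw [integral_eq_lintegral_pos_part_sub_lintegral_neg_part hi']
  refine (ENNReal.ofReal_le_ofReal (sub_le_self _ ENNReal.toReal_nonneg)).trans ?_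
  exact ENNReal.ofReal_toReal_le

end CellProblem

/-! ### The homogenized representation -/

section Homogenized

variable {n : ℕ} {Ω : Type*} [MeasurableSpace Ω] {μ : Measure Ω} {T : Vec n → Ω → Ω} {p q c : ℝ}
  {f : Vec n → Vec n → Ω → EReal} {k : Ω → ℝ}

theorem IsAdmissible.extIntegral_eq (hf : IsMeasurableRepresentative μ f)
    (hk : Integrable k μ) (hkf : ∀ᵐ ω ∂μ, ∀ x y, (k ω : EReal) ≤ f x y ω) {ξ η : Vec n}
    {U V : Ω → Vec n} (h : IsAdmissible μ T p q ξ η U V) :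
    extIntegral μ (fun ω => f (U ω) (V ω) ω) =
      ((∫⁻ ω, (f (U ω) (V ω) ω - k ω).toENNReal ∂μ : ℝ≥0∞) : EReal) + ((∫ ω, k ω ∂μ : ℝ) : EReal) :=
  extIntegral_eq_of_le
    (hf.measurable.comp_aemeasurable ((h.memLp_left.1.aemeasurable.prodMk
      h.memLp_right.1.aemeasurable).prodMk aemeasurable_id)) hk
    (hkf.mono fun ω hω => hω (U ω) (V ω))

/-- The homogenized representation in terms of the minimal value of the cell problem for the
nonnegative integrand `f - k`; the infimum is attained. -/
theorem homogenized_eq [IsProbabilityMeasure μ] (hT : IsDynamicalSystem μ T)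
    (hp : 1 < p) (hq : 1 < q) (hf : IsMeasurableRepresentative μ f)
    (hk : Integrable k μ) (hkf : ∀ᵐ ω ∂μ, ∀ x y, (k ω : EReal) ≤ f x y ω)
    (hF : IsConvexIntegrand μ p q fun x y ω => (f x y ω - k ω).toENNReal) (ξ η : Vec n) :
    (∃ u ∈ VSol μ T p, ∃ v ∈ VPot μ T q, energy μ f ξ η u v = homogenized μ T p q f ξ η) ∧
      homogenized μ T p q f ξ η =
        (cellInf μ T p q (fun x y ω => (f x y ω - k ω).toENNReal) ξ η : EReal) +
          ((∫ ω, k ω ∂μ : ℝ) : EReal) := by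
  obtain ⟨U, V, hUV, hmin⟩ := hF.exists_minimizer hT hp hq ξ η
  have h0 := hUV.translate hp hq (-ξ) (-η)
  rw [neg_add_cancel, neg_add_cancel, isAdmissible_zero_iff] at h0
  have henergy : energy μ f ξ η (fun ω => -ξ + U ω) (fun ω => -η + V ω) =
      (cellInf μ T p q (fun x y ω => (f x y ω - k ω).toENNReal) ξ η : EReal) +
        ((∫ ω, k ω ∂μ : ℝ) : EReal) := by
    simp only [energy, add_neg_cancel_left]
    rw [hUV.extIntegral_eq hf hk hkf, hmin]
  have hle : homogenized μ T p q f ξ η ≤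
      (cellInf μ T p q (fun x y ω => (f x y ω - k ω).toENNReal) ξ η : EReal) +
        ((∫ ω, k ω ∂μ : ℝ) : EReal) := by
    rw [← henergy]
    exact (iInf₂_le _ h0.1).trans (iInf₂_le _ h0.2)
  have hge : (cellInf μ T p q (fun x y ω => (f x y ω - k ω).toENNReal) ξ η : EReal) +
      ((∫ ω, k ω ∂μ : ℝ) : EReal) ≤ homogenized μ T p q f ξ η := by
    refine le_iInf₂ fun u hu => le_iInf₂ fun v hv => ?_
    have h1 := (isAdmissible_zero_iff.2 ⟨hu, hv⟩).translate hp hq ξ η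
    rw [add_zero, add_zero] at h1
    rw [energy, h1.extIntegral_eq hf hk hkf]
    exact add_le_add (EReal.coe_ennreal_le_coe_ennreal_iff.2 h1.cellInf_le) le_rfl
  have heq := hle.antisymm hge
  exact ⟨⟨_, h0.1, _, h0.2, henergy.trans heq.symm⟩, heq⟩

end Homogenized

theorem proposition3p4 {n : ℕ} (hn : 1 ≤ n) {Ω : Type*} [MeasurableSpace Ω]
    (μ : Measure Ω) [IsProbabilityMeasure μ]
    (T : Vec n → Ω → Ω) (hT : IsDynamicalSystem μ T) (hE : IsErgodicSystem μ T)
    (p q : ℝ) (hp : 1 < p) (hq : q = p / (p - 1))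
    (α : Vec n → Ω → Set (Vec n)) (hα : IsRandomMaximalMonotone μ α)
    (f : Vec n → Vec n → Ω → EReal) (hf : IsMeasurableRepresentative μ f)
    (hfα : Represents μ f α) (hc : IsCoerciveIntegrand μ p q f) :
    (∀ ξ η : Vec n, ∃ u ∈ VSol μ T p, ∃ v ∈ VPot μ T q,
        energy μ f ξ η u v = homogenized μ T p q f ξ η) ∧
      IsRepresentative (homogenized μ T p q f) := by
  have hpq : p.HolderConjugate q := by
    rw [hq]
    exact Real.HolderConjugate.conjExponent hp
  have hq1 : 1 < q := hpq.symm.lt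
  obtain ⟨c, hc0, k₀, hk₀, hcoer₀⟩ := hc
  -- A measurable representative of the lower bound is needed because joint measurability of the
  -- excess is required everywhere, not almost everywhere.
  obtain ⟨k, hkm, hkk⟩ := hk₀.1.aemeasurable
  have hk : Integrable k μ := hk₀.congr hkk
  have hcoer : ∀ᵐ ω ∂μ, ∀ ξ η : Vec n,
      ((c * (‖ξ‖ ^ p + ‖η‖ ^ q) + k ω : ℝ) : EReal) ≤ f ξ η ω := by
    filter_upwards [hkk] with ω hω ξ η
    rw [← hω]
    exact hcoer₀ ξ η ω
  have hkf : ∀ᵐ ω ∂μ, ∀ x y, (k ω : EReal) ≤ f x y ω := by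
    filter_upwards [hcoer] with ω h x y
    refine le_trans ?_ (h x y)
    rw [EReal.coe_le_coe_iff]
    have : 0 ≤ c * (‖x‖ ^ p + ‖y‖ ^ q) := by positivity
    linarith
  have hF := hf.isConvexIntegrand hkm hc0 hcoer
  have hmain := homogenized_eq (T := T) hT hp hq1 hf hk hkf hF
  set F : Vec n → Vec n → Ω → ℝ≥0∞ := fun x y ω => (f x y ω - k ω).toENNReal with hFdef
  have hinner : ∀ ξ η : Vec n, ((inner ℝ ξ η : ℝ) : EReal) ≤ homogenized μ T p q f ξ η := by
    intro ξ η
    obtain ⟨U, V, hUV, hmin⟩ := hF.exists_minimizer hT hp hq1 ξ η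
    have hFi : ∀ᵐ ω ∂μ, ∀ x y, ENNReal.ofReal (inner ℝ x y - k ω) ≤ F x y ω := by
      filter_upwards [hf.inner_le] with ω h x y
      rw [← EReal.real_coe_toENNReal, EReal.coe_sub]
      exact EReal.toENNReal_le_toENNReal (EReal.sub_le_sub (h x y) le_rfl)
    have h1 := hUV.ofReal_inner_sub_le hT hE hpq hk hFi
    rw [hmin] at h1
    rw [(hmain ξ η).2]
    have h2 : ((inner ℝ ξ η - ∫ ω, k ω ∂μ : ℝ) : EReal) ≤ (cellInf μ T p q F ξ η : EReal) := by
      refine le_trans ?_ (EReal.coe_ennreal_le_coe_ennreal_iff.2 h1)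
      rw [EReal.coe_ennreal_ofReal]
      exact_mod_cast le_max_left _ _
    have h3 := add_le_add h2 (le_refl ((∫ ω, k ω ∂μ : ℝ) : EReal))
    rwa [← EReal.coe_add, sub_add_cancel] at h3
  refine ⟨fun ξ η => (hmain ξ η).1, ?_, ?_, ?_, ?_, hinner⟩
  · intro x y
    exact ((EReal.bot_lt_coe _).trans_le (hinner x y)).ne'
  -- Properness is the only part that uses the operator α: points of its graph supply finite values
  -- of f.
  · have hreg : ∀ᵐ ω ∂μ, IsRegularMonotoneOp fun x => α x ω := by
      filter_upwards [hα.maximal, hf.convex, hf.lsc, hf.inner_le, hfα, hcoer]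
        with ω h1 h2 h3 h4 h5 h6
      exact isRegularMonotoneOp_of_coercive h1 h2 h3 h4 h5 hc0 hq1 h6
    obtain ⟨U, V, hU, hV, hUs, hVp, hfin⟩ := exists_finite_energy hT
      (fun x R hR => measurable_prodMk_left (hα.measurable R hR)) hreg hk hp hq1 hc0
      (by
        filter_upwards [hfα, hcoer] with ω h1 h2 x y hy
        have h3 := h2 x y
        rw [(h1 x y).1 hy] at h3
        exact_mod_cast h3) hF
      (by
        filter_upwards [hfα] with ω h1 x y hy
        simp only [hFdef, (h1 x y).1 hy]
        rw [← EReal.coe_sub, EReal.real_coe_toENNReal])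
    refine ⟨∫ ω, U ω ∂μ, ∫ ω, V ω ∂μ, ?_⟩
    have hUV : IsAdmissible μ T p q (∫ ω, U ω ∂μ) (∫ ω, V ω ∂μ) U V :=
      ⟨hU, hV, hUs, hVp, rfl, rfl⟩
    have h1 : cellInf μ T p q F (∫ ω, U ω ∂μ) (∫ ω, V ω ∂μ) ≠ ∞ :=
      (hUV.cellInf_le.trans_lt hfin).ne
    rw [(hmain _ _).2, ← EReal.coe_ennreal_toReal h1, ← EReal.coe_add]
    exact EReal.coe_ne_top _
  · intro x₁ y₁ x₂ y₂ a b ha hb hab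
    rw [(hmain _ _).2, (hmain x₁ y₁).2, (hmain x₂ y₂).2]
    exact (add_le_add (EReal.coe_ennreal_le_coe_ennreal_iff.2
      (hF.cellInf_combo_le hT hp hq1 x₁ y₁ x₂ y₂ ha hb hab)) le_rfl).trans
      (EReal.coe_combo_add_le ha hb hab)
  · have hcont : Continuous fun s : ℝ≥0∞ => (s : EReal) + ((∫ ω, k ω ∂μ : ℝ) : EReal) := by
      have h1 := EReal.continuous_sub_coe.comp
        (continuous_coe_ennreal_ereal.prodMk
          (continuous_const (y := -∫ ω, k ω ∂μ)))
      refine h1.congr fun s => ?_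
      simp [sub_eq_add_neg]
    have h2 := hcont.comp_lowerSemicontinuous (hF.lowerSemicontinuous_cellInf hT hp hq1)
      fun s t hst => add_le_add (EReal.coe_ennreal_le_coe_ennreal_iff.2 hst) le_rfl
    have h3 : (fun z : Vec n × Vec n => homogenized μ T p q f z.1 z.2) = _ :=
      funext fun z => (hmain z.1 z.2).2
    rw [IsLscFun, h3]
    exact h2
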